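/- **Setting.** Let $X$ be a separable ordered real Banach space whose positive cone $X_+=\{g\in X: 0\le g\}$ is closed and generating ($X=X_+-X_+$) and whose norm is additive on $X_+$: $\|g+h\|=\|g\|+\|h\|$ for $g,h\in X_+$. Write $\mathbb R_+=[0,\infty)$; "a.a." and "a.e." refer to Lebesgue measure. Let $\mathcal D\subset X_+$ be dense in $X_+$ and p-saturated, i.e. nonempty and such that $0\le g\le h\in\mathcal D$ implies $g\in\mathcal D$. Let $Q^\pm:\mathbb R_+\times\mathcal D\to X_+$ be such that $t\mapsto Q^\pm(t,g(t))$ is measurable for every measurable $g:\mathbb R_+\to X_+$ with $g(t)\in\mathcal D$ a.e., and such that for a.a. $t\ge0$ the maps $Q^\pm(t,\cdot)$ are isotone ($g\le h\Rightarrow Q^\pm(t,g)\le Q^\pm(t,h)$) and o-closed: if $(g_n)\subset\mathcal D$ is increasing, $g_n\to g$ and $Q^\pm(t,g_n)\to h$ in $X$, then $g\in\mathcal D$ and $Q^\pm(t,g)=h$. For a linear operator $\Lambda$ with domain $\mathcal D(\Lambda)\subset X$ put $\mathcal D_+(\Lambda^k)=\mathcal D(\Lambda^k)\cap X_+$ and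 $\mathcal D_+(\Lambda^\infty)=\bigcap_{k\ge1}\mathcal D_+(\Lambda^k)$. Assume: - **(A)** $-\Lambda$ is the infinitesimal generator of a positive $C_0$ semigroup on $X$, $\mathcal D_+(\Lambda)\subset\mathcal D$, and $Q^\pm(t,\mathcal D_+(\Lambda^k))\subset\mathcal D_+(\Lambda^{k-1})$ for a.a. $t\ge0$ and $k=2,3$. - **(A$_0$)** There is $\lambda_0>0$ with $\lambda_0 g\le\Lambda g$ for all $g\in\mathcal D_+(\Lambda)$. - **(A$_1$)** There is a non-decreasing convex function $a:\mathbb R_+\to\mathbb R_+$ such that for a.a. $t\ge0$: $0\le Q^-(t,g)\le a(\|\Lambda g\|)\Lambda g$ for all $g\in\mathcal D_+(\Lambda)$, and $g\mapsto a(\|\Lambda g\|)\Lambda g-Q^-(t,g)$ is isotone on $\mathcal D_+(\Lambda)$. - **(A$_2$)** For a.a. $t\ge0$, $\Delta(t,g):=\|\Lambda Q^-(t,g)\|-\|\Lambda Q^+(t,g)\|\ge0$ for all $g\in\mathcal D_+(\Lambda^2)$, and $g\mapsto\Delta(t,g)$ is isotone on $\mathcal D_+(\Lambda^2)$. - **(A$_3$)**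 There are a non-decreasing function $\rho:\mathbb R_+\to\mathbb R_+$ and a closed positive linear operator $\Lambda_1:\mathcal D(\Lambda_1)\subset X_+\to X_+$ (that is, $\mathcal D(\Lambda_1)$ is a convex cone in $X_+$ on which $\Lambda_1$ is additive and positively homogeneous, and the graph of $\Lambda_1$ is closed) with $\mathcal D_+(\Lambda)\subset\mathcal D(\Lambda_1)$, such that for a.a. $t\ge0$: $\|\Lambda_1Q^-(t,g)\|-\|\Lambda_1Q^+(t,g)\|\ge0$ for all $g\in\mathcal D_+(\Lambda^2)$, and $\|\Lambda^2Q^+(t,g)\|\le\|\Lambda^2Q^-(t,g)\|+\rho(\|\Lambda_1g\|)\,\|\Lambda^2g\|$ for all $g\in\mathcal D_+(\Lambda^3)$. A positive strong solution on $\mathbb R_+$ of $$\frac{d}{dt}f(t)=Q^+(t,f(t))-Q^-(t,f(t)),\qquad f(0)=f_0,\tag{1}$$ is a function $f:\mathbb R_+\to X_+$ that is absolutely continuous on every bounded interval, is differentiable a.e., satisfies the equation a.e. (with $f(t)\in\mathcal D$ a.e.), and has $f(0)=f_0$. **Theorem.** Let $f_0\in\mathcal D_+(\Lambda^2)$, and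 let at least one of the following hold: (a) $Q^+(t,\mathcal D_+(\Lambda^\infty))\subset\mathcal D_+(\Lambda^\infty)$ for a.a. $t\ge0$, and $t\mapsto\Lambda^kQ^+(t,g)$ belongs to $L^1_{loc}(\mathbb R_+;X_+)$ for every $g\in\mathcal D_+(\Lambda^\infty)$ and $k=1,2,\dots$; (b) $Q^\pm$ do not depend on $t$. Then (1) has a unique positive strong solution $f$ on $\mathbb R_+$ such that $f(t)\in\mathcal D_+(\Lambda^2)$ for all $t\ge0$ and $\|\Lambda^2f(\cdot)\|$ is locally bounded on $\mathbb R_+$. Moreover, $\Lambda f\in C(\mathbb R_+;X_+)$, the function $s\mapsto\Delta(s,f(s))$ is locally integrable, and for all $t\ge0$ $$\|\Lambda f(t)\|+\int_0^t\Delta(s,f(s))\,ds=\|\Lambda f_0\|,\qquad \|\Lambda^2f(t)\|\le\|\Lambda^2f_0\|\exp\big(\rho(\|\Lambda_1f_0\|)\,t\big).$$ -/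

import Mathlib

open Set Filter Topology MeasureTheory

namespace OrderedEvolution

section Operators

variable {X : Type*} [NormedAddCommGroup X] [NormedSpace ℝ X]

/-- A `C₀` semigroup of bounded linear operators on `X` (only the values at times `t ≥ 0` matter). -/
structure IsC0Semigroup (S : ℝ → X →L[ℝ] X) : Prop where
  zero : S 0 = ContinuousLinearMap.id ℝ X
  add : ∀ s t : ℝ, 0 ≤ s → 0 ≤ t → S (s + t) = (S s).comp (S t)
  continuousOn : ∀ x : X, ContinuousOn (fun t => S t x) (Ici 0)

/-- `A` is the infinitesimal generator of `S`: its domain is the set of all `x` for which the right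
derivative of `t ↦ S t x` at `0` exists, and `A x` is this derivative. -/
def IsInfinitesimalGenerator (S : ℝ → X →L[ℝ] X) (A : X →ₗ.[ℝ] X) : Prop :=
  ∀ x y : X, (x, y) ∈ A.graph ↔
    Tendsto (fun t : ℝ => t⁻¹ • (S t x - x)) (𝓝[>] 0) (𝓝 y)

open Classical in
/-- The value `Λ x` of a partially defined operator, with the value `0` outside of its domain. -/
noncomputable def opVal (Λ : X →ₗ.[ℝ] X) (x : X) : X :=
  if h : x ∈ Λ.domain then Λ ⟨x, h⟩ else 0

/-- `Λ ^ k x`, meaningful for `x ∈ domPow Λ k`. -/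
noncomputable def opPow (Λ : X →ₗ.[ℝ] X) : ℕ → X → X
  | 0, x => x
  | k + 1, x => opVal Λ (opPow Λ k x)

/-- The domain of `Λ ^ k`. -/
def domPow (Λ : X →ₗ.[ℝ] X) : ℕ → Set X
  | 0 => univ
  | k + 1 => {x | x ∈ domPow Λ k ∧ opPow Λ k x ∈ Λ.domain}

end Operators

section Ordered

variable {X : Type*} [NormedAddCommGroup X] [NormedSpace ℝ X] [PartialOrder X]

/-- The positive part `D₊(Λ ^ k)` of the domain of `Λ ^ k`. -/
def posDom (Λ : X →ₗ.[ℝ] X) (k : ℕ) : Set X := {x | 0 ≤ x ∧ x ∈ domPow Λ k}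

/-- `D₊(Λ ^ ∞)`, the positive elements in the domains of all powers of `Λ`. -/
def posDomInf (Λ : X →ₗ.[ℝ] X) : Set X := {x | 0 ≤ x ∧ ∀ k, x ∈ domPow Λ k}

/-- The positive cone is closed and generating, and the norm is additive on it. -/
structure IsAbstractStateSpace (X : Type*) [NormedAddCommGroup X] [PartialOrder X] : Prop where
  isClosed_cone : IsClosed {x : X | 0 ≤ x}
  generating : ∀ x : X, ∃ u v : X, 0 ≤ u ∧ 0 ≤ v ∧ x = u - v
  norm_add : ∀ g h : X, 0 ≤ g → 0 ≤ h → ‖g + h‖ = ‖g‖ + ‖h‖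

/-- A nonempty set containing, with `h`, all `g` such that `0 ≤ g ≤ h`. -/
def PSaturated (M : Set X) : Prop :=
  M.Nonempty ∧ ∀ h ∈ M, ∀ g : X, 0 ≤ g → g ≤ h → g ∈ M

/-- The operator `Γ` with domain `D` is closed with respect to the order. -/
def OClosed (D : Set X) (Γ : X → X) : Prop :=
  ∀ (u : ℕ → X) (g h : X), Monotone u → (∀ n, u n ∈ D) →
    Tendsto u atTop (𝓝 g) → Tendsto (fun n => Γ (u n)) atTop (𝓝 h) → g ∈ D ∧ Γ g = h

/-- A positive linear operator `L : D(L) ⊂ X₊ → X₊` with domain in the positive cone: `D(L)` is a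
convex cone, on which `L` is additive and positively homogeneous. (Each positive linear operator
with domain a linear subspace of `X` restricts to such an operator on the positive elements of its
domain, and the restriction is closed if the operator and the cone are.) -/
structure IsPositiveConeOperator (D : Set X) (L : X → X) : Prop where
  domain_nonneg : ∀ x ∈ D, 0 ≤ x
  add_mem : ∀ x ∈ D, ∀ y ∈ D, x + y ∈ D
  smul_mem : ∀ c : ℝ, 0 ≤ c → ∀ x ∈ D, c • x ∈ D
  map_add : ∀ x ∈ D, ∀ y ∈ D, L (x + y) = L x + L y
  map_smul : ∀ c : ℝ, 0 ≤ c → ∀ x ∈ D, L (c • x) = c • L x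
  map_nonneg : ∀ x ∈ D, 0 ≤ L x

/-- The operator `L` with domain `D` has a closed graph. -/
def IsClosedOperator (D : Set X) (L : X → X) : Prop :=
  IsClosed {p : X × X | p.1 ∈ D ∧ p.2 = L p.1}

/-- Lebesgue measure on `[0, ∞)`. -/
noncomputable def timeMeasure : Measure ℝ := volume.restrict (Ici 0)

/-- `Δ(t, g) = ‖Λ Q⁻(t, g)‖ - ‖Λ Q⁺(t, g)‖`. -/
noncomputable def dissipation (Λ : X →ₗ.[ℝ] X) (Qp Qm : ℝ → X → X) (t : ℝ) (g : X) : ℝ :=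
  ‖opVal Λ (Qm t g)‖ - ‖opVal Λ (Qp t g)‖

/-- The general assumptions on `Q⁺`, `Q⁻ : [0, ∞) × D → X₊`. -/
structure GeneralAssumptions (D : Set X) (Qp Qm : ℝ → X → X) : Prop where
  domain_nonneg : ∀ g ∈ D, 0 ≤ g
  domain_dense : {g : X | 0 ≤ g} ⊆ closure D
  domain_saturated : PSaturated D
  Qp_nonneg : ∀ t : ℝ, 0 ≤ t → ∀ g ∈ D, 0 ≤ Qp t g
  Qm_nonneg : ∀ t : ℝ, 0 ≤ t → ∀ g ∈ D, 0 ≤ Qm t g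
  Qp_measurable : ∀ g : ℝ → X, AEStronglyMeasurable g timeMeasure → (∀ t, 0 ≤ t → 0 ≤ g t) →
    (∀ᵐ t ∂timeMeasure, g t ∈ D) → AEStronglyMeasurable (fun t => Qp t (g t)) timeMeasure
  Qm_measurable : ∀ g : ℝ → X, AEStronglyMeasurable g timeMeasure → (∀ t, 0 ≤ t → 0 ≤ g t) →
    (∀ᵐ t ∂timeMeasure, g t ∈ D) → AEStronglyMeasurable (fun t => Qm t (g t)) timeMeasure
  Qp_isotone : ∀ᵐ t ∂timeMeasure, MonotoneOn (Qp t) D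
  Qm_isotone : ∀ᵐ t ∂timeMeasure, MonotoneOn (Qm t) D
  Qp_oClosed : ∀ᵐ t ∂timeMeasure, OClosed D (Qp t)
  Qm_oClosed : ∀ᵐ t ∂timeMeasure, OClosed D (Qm t)

/-- `-Λ` generates a positive `C₀` semigroup, `D₊(Λ) ⊆ D`, and `Q⁺`, `Q⁻` map `D₊(Λ ^ k)` to
`D₊(Λ ^ (k - 1))` for `k = 2, 3`. -/
structure AssumptionA (D : Set X) (Qp Qm : ℝ → X → X) (Λ : X →ₗ.[ℝ] X) : Prop where
  generator : ∃ S : ℝ → X →L[ℝ] X, IsC0Semigroup S ∧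
    (∀ t : ℝ, 0 ≤ t → ∀ x : X, 0 ≤ x → 0 ≤ S t x) ∧ IsInfinitesimalGenerator S (-Λ)
  posDom_subset : posDom Λ 1 ⊆ D
  Qp_maps : ∀ k : ℕ, k = 2 ∨ k = 3 →
    ∀ᵐ t ∂timeMeasure, ∀ g ∈ posDom Λ k, Qp t g ∈ posDom Λ (k - 1)
  Qm_maps : ∀ k : ℕ, k = 2 ∨ k = 3 →
    ∀ᵐ t ∂timeMeasure, ∀ g ∈ posDom Λ k, Qm t g ∈ posDom Λ (k - 1)

/-- `Λ` is bounded from below by a positive multiple of the identity on `D₊(Λ)`. -/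
def AssumptionA0 (Λ : X →ₗ.[ℝ] X) : Prop :=
  ∃ lam : ℝ, 0 < lam ∧ ∀ g ∈ posDom Λ 1, lam • g ≤ opVal Λ g

/-- `Q⁻(t, g) ≤ a(‖Λ g‖) Λ g` on `D₊(Λ)`, with an isotone difference, where
`a : [0, ∞) → [0, ∞)` is non-decreasing and convex. -/
structure AssumptionA1 (Qm : ℝ → X → X) (Λ : X →ₗ.[ℝ] X) (a : ℝ → ℝ) : Prop where
  nonneg : ∀ x : ℝ, 0 ≤ x → 0 ≤ a x
  mono : MonotoneOn a (Ici 0)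
  convex : ConvexOn ℝ (Ici 0) a
  bound : ∀ᵐ t ∂timeMeasure, ∀ g ∈ posDom Λ 1,
    0 ≤ Qm t g ∧ Qm t g ≤ a ‖opVal Λ g‖ • opVal Λ g
  isotone : ∀ᵐ t ∂timeMeasure,
    MonotoneOn (fun g => a ‖opVal Λ g‖ • opVal Λ g - Qm t g) (posDom Λ 1)

/-- `Δ(t, ·)` is nonnegative and isotone on `D₊(Λ ^ 2)`. -/
structure AssumptionA2 (Qp Qm : ℝ → X → X) (Λ : X →ₗ.[ℝ] X) : Prop where
  nonneg : ∀ᵐ t ∂timeMeasure, ∀ g ∈ posDom Λ 2, 0 ≤ dissipation Λ Qp Qm t g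
  isotone : ∀ᵐ t ∂timeMeasure, MonotoneOn (dissipation Λ Qp Qm t) (posDom Λ 2)

/-- The assumption on the operator `Λ₁`, with domain `D₁`, and on the function
`ρ : [0, ∞) → [0, ∞)`. -/
structure AssumptionA3 (Qp Qm : ℝ → X → X) (Λ : X →ₗ.[ℝ] X) (D₁ : Set X) (Λ₁ : X → X)
    (ρ : ℝ → ℝ) : Prop where
  rho_nonneg : ∀ x : ℝ, 0 ≤ x → 0 ≤ ρ x
  rho_mono : MonotoneOn ρ (Ici 0)
  positive : IsPositiveConeOperator D₁ Λ₁
  closed : IsClosedOperator D₁ Λ₁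
  posDom_subset : posDom Λ 1 ⊆ D₁
  dissipative : ∀ᵐ t ∂timeMeasure, ∀ g ∈ posDom Λ 2, 0 ≤ ‖Λ₁ (Qm t g)‖ - ‖Λ₁ (Qp t g)‖
  povzner : ∀ᵐ t ∂timeMeasure, ∀ g ∈ posDom Λ 3,
    ‖opPow Λ 2 (Qp t g)‖ ≤ ‖opPow Λ 2 (Qm t g)‖ + ρ ‖Λ₁ g‖ * ‖opPow Λ 2 g‖

/-- `Q⁺(t, ·)` leaves `D₊(Λ ^ ∞)` invariant for a.e. `t`, and `Λ ^ k Q⁺(·, g)` is locally Bochner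
integrable on `[0, ∞)` for all `g ∈ D₊(Λ ^ ∞)` and `k ≥ 1`. -/
def ConditionA (Qp : ℝ → X → X) (Λ : X →ₗ.[ℝ] X) : Prop :=
  (∀ᵐ t ∂timeMeasure, ∀ g ∈ posDomInf Λ, Qp t g ∈ posDomInf Λ) ∧
  ∀ k : ℕ, 1 ≤ k → ∀ g ∈ posDomInf Λ, ∀ T : ℝ, 0 < T →
    IntegrableOn (fun t => opPow Λ k (Qp t g)) (Icc 0 T)

/-- `Q⁺` and `Q⁻` do not depend on the time. -/
def ConditionB (D : Set X) (Qp Qm : ℝ → X → X) : Prop :=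
  ∀ s t : ℝ, 0 ≤ s → 0 ≤ t → ∀ g ∈ D, Qp s g = Qp t g ∧ Qm s g = Qm t g

/-- `f` is a positive strong solution on `[0, ∞)` of `f' = Q⁺(t, f) - Q⁻(t, f)`, `f(0) = f₀`:
it is absolutely continuous (on each bounded interval), differentiable almost everywhere, and
satisfies the equation almost everywhere. -/
structure IsPositiveStrongSolution (D : Set X) (Qp Qm : ℝ → X → X) (f₀ : X) (f : ℝ → X) :
    Prop where
  nonneg : ∀ t : ℝ, 0 ≤ t → 0 ≤ f t
  absolutelyContinuous : ∀ T : ℝ, 0 < T → AbsolutelyContinuousOnInterval f 0 T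
  mem_domain : ∀ᵐ t ∂timeMeasure, f t ∈ D
  equation : ∀ᵐ t ∂timeMeasure, HasDerivAt f (Qp t (f t) - Qm t (f t)) t
  initial : f 0 = f₀

/-- The class of solutions with `f(t) ∈ D₊(Λ ^ 2)` for all `t ≥ 0` and `‖Λ ^ 2 f‖` locally
bounded on `[0, ∞)`. -/
structure IsRegularSolution (D : Set X) (Qp Qm : ℝ → X → X) (Λ : X →ₗ.[ℝ] X) (f₀ : X)
    (f : ℝ → X) : Prop where
  solution : IsPositiveStrongSolution D Qp Qm f₀ f
  mem_posDom : ∀ t : ℝ, 0 ≤ t → f t ∈ posDom Λ 2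
  locallyBounded : ∀ T : ℝ, 0 < T → ∃ C : ℝ, ∀ t ∈ Icc 0 T, ‖opPow Λ 2 (f t)‖ ≤ C

end Ordered

end OrderedEvolution

/-!
The proof reduces the problem to bounded operators. By the lower bound `λ₀ g ≤ Λ g`, the integral
`J = ∫₀^∞ S(t) dt` of the semigroup `S` generated by `-Λ` exists, is the bounded inverse of `Λ`, and
both preserves and reflects the order (`exists_isDampingPair`). A regular solution is `f = J² y` with
`y = Λ² f ≥ 0` locally bounded, and the equation becomes `J y(t) = J y₀ + ∫₀ᵗ (P(s, y) - M(s, y)) ds`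
with `P = Λ Q⁺ J²` and `M = Λ Q⁻ J²`; the assumptions turn into the properties of
`IsReducedProblem`. The functional `x ↦ ‖Λ₁ J x‖` is additive on the cone and hence extends to a
bounded linear functional `φ`.

Let `D(t)` be the energy dissipated up to the time `t`. A solution satisfies the energy identity
`‖J y(t)‖ + D(t) = ‖J y₀‖`, because the norm is linear on the cone. Hence it also solves the equation
in which the damping `a(‖J y₀‖) y` is added to one side and `a(‖J y‖ + D) y` to the other. The
right-hand side `P(y) - M(y) + a(‖J y‖ + D) y` of the latter is nonnegative and isotone in the pair
`(y, D)`: this uses the convexity of `a` and the isotonicity of `a(‖Λ g‖) Λ g - Q⁻(g)`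
(`dampedRhs_mono`). The equation with damping can therefore be solved by monotone iteration from
zero. To apply `J⁻¹` to the right-hand side, its argument is smoothed by the averages
`2ⁿ ∫₀^(2⁻ⁿ) S(t) dt`, which commute with `J`, map into its range, and increase to the identity.

The averages also make the a priori bounds rigorous. If `z` is the result of a step applied to
`y ≤ z`, then the smoothed `a(‖J y₀‖) J⁻¹ ∫₀ᵗ y` lies below `a(‖J y₀‖) J⁻¹ ∫₀ᵗ z`, so that for each
positive functional the damping absorbs the term with the factor `a(‖J y‖ + D) ≤ a(‖J y₀‖)`
(`functional_schemeStep_le`). For the functionals `‖J ·‖`, `φ ∘ J` and `‖·‖` this gives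
`‖J y‖ + D ≤ ‖J y₀‖`, `φ(J y) ≤ φ(J y₀)` and `‖y(t)‖ ≤ ‖y₀‖ exp(ρ(φ(J y₀)) t)`, where the last bound
uses the Povzner-type inequality for `Λ²`. Bounded increasing sequences converge, since the norm is
additive on the cone, and the limit solves the equation with damping. The defect
`e = ‖J y₀‖ - ‖J y‖ - D` satisfies `e(t) ≤ C ∫₀ᵗ e`, as `a` is Lipschitz continuous on bounded
intervals, so `e = 0` (`limit_energy`) and the damping cancels.

A second solution `z` lies above all approximations (`scheme_le_solution`), hence above `y`, and it
dissipates at least as much energy. By the energy identity `‖J z‖ ≤ ‖J y‖`, and `J y ≤ J z` forces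
`J z = J y` (`exists_unique_solution`).
-/

set_option linter.unusedSectionVars false

/-! ### Ordered spaces with additive norm -/

namespace OrderedEvolution

section OrderedSpace

variable {X : Type*} [NormedAddCommGroup X] [NormedSpace ℝ X] [PartialOrder X]
  [IsOrderedAddMonoid X] [IsOrderedModule ℝ X]

theorem IsAbstractStateSpace.orderClosedTopology (hX : IsAbstractStateSpace X) :
    OrderClosedTopology X where
  isClosed_le' := by
    have : {p : X × X | p.1 ≤ p.2} = (fun p : X × X => p.2 - p.1) ⁻¹' {x | 0 ≤ x} := by
      ext p; simp
    rw [this]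
    exact hX.isClosed_cone.preimage (by fun_prop)

theorem IsAbstractStateSpace.norm_sub (hX : IsAbstractStateSpace X) {g h : X} (hg : 0 ≤ g)
    (hgh : g ≤ h) : ‖h - g‖ = ‖h‖ - ‖g‖ := by
  have := hX.norm_add g (h - g) hg (sub_nonneg.2 hgh)
  rw [add_sub_cancel] at this
  linarith

theorem IsAbstractStateSpace.norm_le (hX : IsAbstractStateSpace X) {g h : X} (hg : 0 ≤ g)
    (hgh : g ≤ h) : ‖g‖ ≤ ‖h‖ := by
  have := hX.norm_sub hg hgh
  linarith [norm_nonneg (h - g)]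

/-- Since the norm is additive on the cone, it measures the increments of an increasing sequence,
so that bounded increasing sequences are Cauchy. -/
theorem IsAbstractStateSpace.exists_tendsto_of_monotone [CompleteSpace X]
    (hX : IsAbstractStateSpace X) {u : ℕ → X} (hu : Monotone u) (h0 : ∀ n, 0 ≤ u n) {C : ℝ}
    (hC : ∀ n, ‖u n‖ ≤ C) : ∃ x, Tendsto u atTop (𝓝 x) := by
  have hmono : Monotone fun n => ‖u n‖ := fun m n hmn => hX.norm_le (h0 m) (hu hmn)
  have hconv := tendsto_atTop_ciSup hmono ⟨C, by rintro _ ⟨n, rfl⟩; exact hC n⟩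
  refine cauchySeq_tendsto_of_complete ?_
  have hc := hconv.cauchySeq
  rw [Metric.cauchySeq_iff'] at hc ⊢
  intro ε hε
  obtain ⟨N, hN⟩ := hc ε hε
  refine ⟨N, fun n hn => ?_⟩
  rw [dist_eq_norm, hX.norm_sub (h0 N) (hu hn)]
  exact lt_of_le_of_lt (le_abs_self _) (hN n hn)

/-- **Andô's theorem.** The decomposition of the elements of `X` into differences of positive
elements can be chosen with norm control. This is the open mapping theorem for the map
`c ↦ ∑ c_g g` from the `ℓ¹` space over the positive part of the unit ball to `X`. -/
theorem IsAbstractStateSpace.exists_decomposition [CompleteSpace X]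
    (hX : IsAbstractStateSpace X) :
    ∃ K : ℝ, 0 ≤ K ∧ ∀ x : X, ∃ u v : X, 0 ≤ u ∧ 0 ≤ v ∧ x = u - v ∧ ‖u‖ ≤ K * ‖x‖ ∧
      ‖v‖ ≤ K * ‖x‖ := by
  classical
  have hclosed := hX.orderClosedTopology
  let I := {g : X // 0 ≤ g ∧ ‖g‖ ≤ 1}
  let E := lp (fun _ : I => ℝ) 1
  have hsum1 (c : E) : Summable fun i : I => |c i| := by
    simpa using (lp.memℓp c).summable (by simp)
  have hnorm (c : E) : ‖c‖ = ∑' i : I, |c i| := by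
    simpa using lp.norm_eq_tsum_rpow (by simp) c
  have hsumN {c : I → ℝ} (hc : Summable fun i => |c i|) : Summable fun i : I => ‖c i • i.1‖ := by
    refine Summable.of_nonneg_of_le (fun _ => norm_nonneg _) (fun i => ?_) hc
    rw [norm_smul, Real.norm_eq_abs]
    exact mul_le_of_le_one_right (abs_nonneg _) i.2.2
  have hle {c : I → ℝ} (hc : Summable fun i => |c i|) :
      ‖∑' i : I, c i • i.1‖ ≤ ∑' i : I, |c i| := by
    refine (norm_tsum_le_tsum_norm (hsumN hc)).trans ((hsumN hc).tsum_le_tsum (fun i => ?_) hc)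
    rw [norm_smul, Real.norm_eq_abs]
    exact mul_le_of_le_one_right (abs_nonneg _) i.2.2
  let L : E →ₗ[ℝ] X :=
    { toFun := fun c => ∑' i : I, c i • i.1
      map_add' := fun c d => by
        rw [← (hsumN (hsum1 c)).of_norm.tsum_add (hsumN (hsum1 d)).of_norm]
        simp [add_smul]
      map_smul' := fun r c => by
        rw [RingHom.id_apply, ← (hsumN (hsum1 c)).of_norm.tsum_const_smul r]
        exact tsum_congr fun i => mul_smul r (c i) i.1 }
  let L' : E →L[ℝ] X := L.mkContinuous 1 fun c => by
    rw [one_mul, hnorm]; exact hle (hsum1 c)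
  have hL (c : E) : L' c = ∑' i : I, c i • i.1 := rfl
  -- each positive element is a multiple of an element of the positive part of the unit ball
  have hpos (u : X) (hu : 0 ≤ u) : ∃ c : E, L' c = u := by
    let i : I := ⟨(‖u‖ + 1)⁻¹ • u, smul_nonneg (by positivity) hu, by
      rw [norm_smul, norm_inv, Real.norm_of_nonneg (by positivity), inv_mul_le_one₀ (by positivity)]
      linarith⟩
    refine ⟨lp.single 1 i (‖u‖ + 1), ?_⟩
    rw [hL, tsum_eq_single i]
    · rw [lp.single_apply_self]
      simp only [i]
      rw [smul_smul, mul_inv_cancel₀ (by positivity), one_smul]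
    · intro j hj
      rw [lp.single_apply_ne _ _ _ hj, zero_smul]
  have hsurj : Function.Surjective L' := fun x => by
    obtain ⟨u, v, hu, hv, rfl⟩ := hX.generating x
    obtain ⟨c, rfl⟩ := hpos u hu
    obtain ⟨d, rfl⟩ := hpos v hv
    exact ⟨c - d, map_sub _ _ _⟩
  obtain ⟨K, hK, hpre⟩ := L'.exists_preimage_norm_le hsurj
  refine ⟨K, hK.le, fun x => ?_⟩
  obtain ⟨c, rfl, hc⟩ := hpre x
  have hp : Summable fun i : I => |max (c i) 0| :=
    Summable.of_nonneg_of_le (fun _ => abs_nonneg _)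
      (fun i => by rw [abs_of_nonneg (le_max_right _ _)]
                   exact max_le (le_abs_self _) (abs_nonneg _)) (hsum1 c)
  have hm : Summable fun i : I => |max (-c i) 0| :=
    Summable.of_nonneg_of_le (fun _ => abs_nonneg _)
      (fun i => by rw [abs_of_nonneg (le_max_right _ _)]
                   exact max_le (neg_le_abs _) (abs_nonneg _)) (hsum1 c)
  refine ⟨∑' i : I, max (c i) 0 • i.1, ∑' i : I, max (-c i) 0 • i.1,
    tsum_nonneg fun i => smul_nonneg (le_max_right _ _) i.2.1,
    tsum_nonneg fun i => smul_nonneg (le_max_right _ _) i.2.1, ?_, ?_, ?_⟩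
  · rw [hL, ← (hsumN hp).of_norm.tsum_sub (hsumN hm).of_norm]
    refine tsum_congr fun i => ?_
    rw [← sub_smul]
    congr 1
    rcases le_total (c i) 0 with h | h
    · rw [max_eq_right h, max_eq_left (by linarith)]; ring
    · rw [max_eq_left h, max_eq_right (by linarith)]; ring
  · refine (hle hp).trans ((hp.tsum_le_tsum (fun i => ?_) (hsum1 c)).trans ((hnorm c).symm.le.trans hc))
    rw [abs_of_nonneg (le_max_right _ _)]
    exact max_le (le_abs_self _) (abs_nonneg _)
  · refine (hle hm).trans ((hm.tsum_le_tsum (fun i => ?_) (hsum1 c)).trans ((hnorm c).symm.le.trans hc))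
    rw [abs_of_nonneg (le_max_right _ _)]
    exact max_le (neg_le_abs _) (abs_nonneg _)

/-- A nonnegative, additive and positively homogeneous functional on the cone is the restriction of
a bounded linear functional on `X`. -/
theorem IsAbstractStateSpace.exists_functional [CompleteSpace X] (hX : IsAbstractStateSpace X)
    (p : X → ℝ) (h0 : ∀ g, 0 ≤ g → 0 ≤ p g)
    (hadd : ∀ g h, 0 ≤ g → 0 ≤ h → p (g + h) = p g + p h)
    (hsmul : ∀ c : ℝ, 0 ≤ c → ∀ g, 0 ≤ g → p (c • g) = c * p g) :
    ∃ φ : X →L[ℝ] ℝ, ∀ g, 0 ≤ g → φ g = p g := by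
  have hclosed := hX.orderClosedTopology
  have hmono : ∀ g h, 0 ≤ g → g ≤ h → p g ≤ p h := fun g h hg hgh => by
    have := hadd g (h - g) hg (sub_nonneg.2 hgh)
    rw [add_sub_cancel] at this
    linarith [h0 _ (sub_nonneg.2 hgh)]
  -- an unbounded `p` would be infinite at the sum of a suitable series
  have hbdd : ∃ M : ℝ, 0 ≤ M ∧ ∀ g, 0 ≤ g → p g ≤ M * ‖g‖ := by
    by_contra! hcon
    have hcon' : ∀ n : ℕ, ∃ g : X, 0 ≤ g ∧ ‖g‖ ≤ (1 / 2) ^ n ∧ (n : ℝ) ≤ p g := fun n => by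
      obtain ⟨g, hg, hlt⟩ := hcon (n * 2 ^ n) (by positivity)
      have hne : 0 < ‖g‖ := by
        rcases (norm_nonneg g).lt_or_eq with h | h
        · exact h
        · rw [norm_eq_zero.1 h.symm, norm_zero, mul_zero] at hlt
          have := hsmul 0 le_rfl 0 le_rfl
          simp only [smul_zero, zero_mul] at this
          linarith
      refine ⟨((1 / 2) ^ n * ‖g‖⁻¹) • g, smul_nonneg (by positivity) hg, ?_, ?_⟩
      · rw [norm_smul, Real.norm_of_nonneg (by positivity), mul_assoc, inv_mul_cancel₀ hne.ne',
          mul_one]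
      · rw [hsmul _ (by positivity) g hg]
        calc (n : ℝ) = (1 / 2) ^ n * ‖g‖⁻¹ * (n * 2 ^ n * ‖g‖) := by
              field_simp
              rw [mul_assoc, ← mul_pow]; norm_num
          _ ≤ _ := mul_le_mul_of_nonneg_left hlt.le (by positivity)
    choose g hg hgn hpg using hcon'
    have hs : Summable g := Summable.of_norm_bounded (g := fun n : ℕ => (1 / 2 : ℝ) ^ n)
      (summable_geometric_of_lt_one (by norm_num) (by norm_num)) hgn
    obtain ⟨n, hn⟩ := exists_nat_gt (p (∑' n, g n))
    have := hmono (g n) (∑' n, g n) (hg n) (hs.le_tsum n fun m _ => hg m)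
    linarith [hpg n]
  obtain ⟨M, hM, hpM⟩ := hbdd
  obtain ⟨K, hK, hdec⟩ := hX.exists_decomposition
  choose u v hu hv huv hun hvn using hdec
  have key : ∀ x a b, 0 ≤ a → 0 ≤ b → x = a - b → p (u x) - p (v x) = p a - p b := by
    intro x a b ha hb hx
    have h1 : u x + b = a + v x := by
      have := huv x
      rw [hx] at this
      have h2 : u (a - b) = a - b + v (a - b) := by rw [eq_sub_iff_add_eq] at this; exact this.symm
      rw [hx, h2]; abel
    have h2 := congrArg p h1
    rw [hadd _ _ (hu x) hb, hadd _ _ ha (hv x)] at h2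
    linarith
  let φ : X →ₗ[ℝ] ℝ :=
    { toFun := fun x => p (u x) - p (v x)
      map_add' := fun x y => by
        rw [key (x + y) (u x + u y) (v x + v y) (add_nonneg (hu x) (hu y))
          (add_nonneg (hv x) (hv y)) (by nth_rw 1 [huv x, huv y]; abel),
          hadd _ _ (hu x) (hu y), hadd _ _ (hv x) (hv y)]
        ring
      map_smul' := fun c x => by
        simp only [RingHom.id_apply, smul_eq_mul]
        rcases le_total 0 c with hc | hc
        · rw [key (c • x) (c • u x) (c • v x) (smul_nonneg hc (hu x)) (smul_nonneg hc (hv x))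
            (by rw [← smul_sub, ← huv x]), hsmul c hc _ (hu x), hsmul c hc _ (hv x)]
          ring
        · have hc' : 0 ≤ -c := by linarith
          rw [key (c • x) ((-c) • v x) ((-c) • u x) (smul_nonneg hc' (hv x))
            (smul_nonneg hc' (hu x)) (by
              rw [← smul_sub, neg_smul, ← smul_neg, neg_sub, ← huv x]),
            hsmul _ hc' _ (hu x), hsmul _ hc' _ (hv x)]
          ring }
  refine ⟨φ.mkContinuous (M * K) fun x => ?_, fun g hg => ?_⟩
  · change |p (u x) - p (v x)| ≤ _
    have h1 : p (u x) ≤ M * K * ‖x‖ := (hpM _ (hu x)).trans (by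
      rw [mul_assoc]; exact mul_le_mul_of_nonneg_left (hun x) hM)
    have h2 : p (v x) ≤ M * K * ‖x‖ := (hpM _ (hv x)).trans (by
      rw [mul_assoc]; exact mul_le_mul_of_nonneg_left (hvn x) hM)
    rw [abs_le]
    constructor <;> linarith [h0 _ (hu x), h0 _ (hv x)]
  · change p (u g) - p (v g) = p g
    rw [key g g 0 hg le_rfl (by simp)]
    have := hsmul 0 le_rfl 0 le_rfl
    simp only [smul_zero, zero_mul] at this
    rw [this, sub_zero]

theorem IsAbstractStateSpace.exists_normFunctional [CompleteSpace X]
    (hX : IsAbstractStateSpace X) : ∃ ψ : X →L[ℝ] ℝ, ∀ g, 0 ≤ g → ψ g = ‖g‖ :=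
  hX.exists_functional (fun g => ‖g‖) (fun _ _ => norm_nonneg _) hX.norm_add
    fun c hc g _ => by rw [norm_smul, Real.norm_of_nonneg hc]

end OrderedSpace

section TimeIntegrals

variable {E : Type*} [NormedAddCommGroup E] [NormedSpace ℝ E]

theorem ae_restrict_Ioc_of_ae_timeMeasure {p : ℝ → Prop} (h : ∀ᵐ s ∂timeMeasure, p s) (t : ℝ) :
    ∀ᵐ s ∂volume.restrict (Ioc 0 t), p s ∧ 0 < s ∧ s ≤ t := by
  have h1 : ∀ᵐ s ∂volume.restrict (Ioc 0 t), p s :=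
    ae_mono (Measure.restrict_mono (fun s hs => hs.1.le) le_rfl) h
  filter_upwards [h1, ae_restrict_mem measurableSet_Ioc] with s hs hst using ⟨hs, hst.1, hst.2⟩

theorem integral_congr_of_ae_timeMeasure {f g : ℝ → E} {t : ℝ} (ht : 0 ≤ t)
    (h : ∀ᵐ s ∂timeMeasure, s ≤ t → f s = g s) :
    ∫ s in (0 : ℝ)..t, f s = ∫ s in (0 : ℝ)..t, g s := by
  rw [intervalIntegral.integral_of_le ht, intervalIntegral.integral_of_le ht]
  refine integral_congr_ae ?_
  filter_upwards [ae_restrict_Ioc_of_ae_timeMeasure h t] with s hs using hs.1 hs.2.2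

variable [PartialOrder E] [IsOrderedAddMonoid E] [IsOrderedModule ℝ E] [ClosedIciTopology E]

theorem integral_nonneg_of_ae_timeMeasure {f : ℝ → E} {t : ℝ} (ht : 0 ≤ t)
    (h : ∀ᵐ s ∂timeMeasure, s ≤ t → 0 ≤ f s) : 0 ≤ ∫ s in (0 : ℝ)..t, f s := by
  rw [intervalIntegral.integral_of_le ht]
  refine MeasureTheory.integral_nonneg_of_ae ?_
  filter_upwards [ae_restrict_Ioc_of_ae_timeMeasure h t] with s hs using hs.1 hs.2.2

theorem integral_mono_of_ae_timeMeasure {f g : ℝ → E} {t : ℝ} (ht : 0 ≤ t)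
    (hf : IntervalIntegrable f volume 0 t) (hg : IntervalIntegrable g volume 0 t)
    (h : ∀ᵐ s ∂timeMeasure, s ≤ t → f s ≤ g s) :
    ∫ s in (0 : ℝ)..t, f s ≤ ∫ s in (0 : ℝ)..t, g s := by
  rw [intervalIntegral.integral_of_le ht, intervalIntegral.integral_of_le ht]
  refine MeasureTheory.integral_mono_ae hf.1 hg.1 ?_
  filter_upwards [ae_restrict_Ioc_of_ae_timeMeasure h t] with s hs using hs.1 hs.2.2

end TimeIntegrals

end OrderedEvolution

/-! ### Semigroups below the identity and their smoothing operators -/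

namespace OrderedEvolution

section Semigroup

variable {X : Type*} [NormedAddCommGroup X] [NormedSpace ℝ X] [CompleteSpace X]
  {S : ℝ → X →L[ℝ] X}

theorem IsC0Semigroup.continuous_max (hS : IsC0Semigroup S) (x : X) :
    Continuous fun t : ℝ => S (max t 0) x :=
  (hS.continuousOn x).comp_continuous (by fun_prop) fun t => le_max_right t 0

theorem IsC0Semigroup.intervalIntegrable (hS : IsC0Semigroup S) (x : X) {s t : ℝ} (hs : 0 ≤ s)
    (ht : 0 ≤ t) : IntervalIntegrable (fun r => S r x) volume s t :=
  ((hS.continuousOn x).mono fun r hr => by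
    rw [mem_uIcc] at hr
    rcases hr with h | h
    · exact hs.trans h.1
    · exact ht.trans h.1).intervalIntegrable

theorem IsC0Semigroup.tendsto_integral (hS : IsC0Semigroup S) (x : X) {h : ℝ} (hh : 0 ≤ h) :
    Tendsto (fun τ : ℝ => τ⁻¹ • ((∫ s in (0 : ℝ)..(h + τ), S s x) - ∫ s in (0 : ℝ)..h, S s x))
      (𝓝[>] 0) (𝓝 (S h x)) := by
  have hd : HasDerivAt (fun u : ℝ => ∫ s in (0 : ℝ)..u, S (max s 0) x) (S (max h 0) x) h :=
    intervalIntegral.integral_hasDerivAt_right ((hS.continuous_max x).intervalIntegrable _ _)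
      ((hS.continuous_max x).stronglyMeasurableAtFilter _ _) (hS.continuous_max x).continuousAt
  rw [max_eq_left hh] at hd
  have heq : ∀ u : ℝ, 0 ≤ u →
      ∫ s in (0 : ℝ)..u, S (max s 0) x = ∫ s in (0 : ℝ)..u, S s x := fun u hu =>
    intervalIntegral.integral_congr fun s hs => by
      rw [uIcc_of_le hu] at hs
      simp only [max_eq_left hs.1]
  refine hd.tendsto_slope_zero_right.congr' ?_
  filter_upwards [self_mem_nhdsWithin] with τ hτ
  have hτ' : (0 : ℝ) < τ := hτ
  rw [heq _ (by linarith), heq _ hh]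

theorem IsC0Semigroup.map_integral (hS : IsC0Semigroup S) (x : X) {h τ : ℝ} (hh : 0 ≤ h)
    (hτ : 0 ≤ τ) :
    S τ (∫ s in (0 : ℝ)..h, S s x)
      = (∫ s in (0 : ℝ)..(h + τ), S s x) - ∫ s in (0 : ℝ)..τ, S s x := by
  rw [← ContinuousLinearMap.intervalIntegral_comp_comm _ (hS.intervalIntegrable x le_rfl hh),
    intervalIntegral.integral_interval_sub_left
      (hS.intervalIntegrable x le_rfl (add_nonneg hh hτ)) (hS.intervalIntegrable x le_rfl hτ)]
  have h1 : ∫ s in (0 : ℝ)..h, S τ (S s x) = ∫ s in (0 : ℝ)..h, S (τ + s) x :=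
    intervalIntegral.integral_congr fun s hs => by
      rw [uIcc_of_le hh] at hs
      simp only [hS.add τ s hτ hs.1, ContinuousLinearMap.comp_apply]
  rw [h1, intervalIntegral.integral_comp_add_left (fun s => S s x) τ, add_zero, add_comm]

theorem IsC0Semigroup.map_integral' (hS : IsC0Semigroup S) (x : X) {h τ : ℝ} (hh : 0 ≤ h)
    (hτ : 0 ≤ τ) :
    S τ (∫ s in (0 : ℝ)..h, S s x) = ∫ s in (0 : ℝ)..h, S s (S τ x) := by
  rw [← ContinuousLinearMap.intervalIntegral_comp_comm _ (hS.intervalIntegrable x le_rfl hh)]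
  refine intervalIntegral.integral_congr fun s hs => ?_
  rw [uIcc_of_le hh] at hs
  have h1 := congrArg (fun T => T x) (hS.add τ s hτ hs.1)
  have h2 := congrArg (fun T => T x) (hS.add s τ hs.1 hτ)
  simp only [ContinuousLinearMap.comp_apply] at h1 h2
  simp only [← h1, ← h2, add_comm]

/-- `Λ x` is the limit of the difference quotients of the semigroup generated by `-Λ`. -/
theorem mem_domain_iff_of_generator {Λ : X →ₗ.[ℝ] X} (hgen : IsInfinitesimalGenerator S (-Λ))
    (x y : X) : (x ∈ Λ.domain ∧ opVal Λ x = y) ↔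
      Tendsto (fun t : ℝ => t⁻¹ • (x - S t x)) (𝓝[>] 0) (𝓝 y) := by
  have h1 : (x ∈ Λ.domain ∧ opVal Λ x = y) ↔ (x, -y) ∈ (-Λ).graph := by
    rw [LinearPMap.mem_graph_iff]
    constructor
    · rintro ⟨hx, rfl⟩
      refine ⟨⟨x, hx⟩, rfl, ?_⟩
      simp [opVal, hx]
    · rintro ⟨⟨z, hz⟩, rfl, h⟩
      refine ⟨hz, ?_⟩
      have hz' : z ∈ Λ.domain := hz
      simp only [LinearPMap.neg_apply, neg_inj] at h
      simp only [opVal, hz', dif_pos]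
      exact h
  rw [h1, hgen x (-y)]
  constructor
  · intro h
    have := h.neg
    rw [neg_neg] at this
    refine this.congr fun t => ?_
    rw [← smul_neg, neg_sub]
  · intro h
    refine h.neg.congr fun t => ?_
    rw [← smul_neg, neg_sub]

variable [PartialOrder X]

/-- `S` is a positive `C₀` semigroup, bounded on `[0, ∞)`, and `J` is a bounded operator with
`∫₀ᵗ S(s) x ds = J x - S(t) J x`, that is, the inverse of the generator up to the sign. Moreover `J`
preserves and reflects positivity. -/
structure IsDampingPair (S : ℝ → X →L[ℝ] X) (J : X →L[ℝ] X) : Prop where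
  semigroup : IsC0Semigroup S
  nonneg : ∀ t : ℝ, 0 ≤ t → ∀ x : X, 0 ≤ x → 0 ≤ S t x
  bounded : ∃ C : ℝ, 0 ≤ C ∧ ∀ t : ℝ, 0 ≤ t → ∀ x : X, ‖S t x‖ ≤ C * ‖x‖
  comm : ∀ t : ℝ, 0 ≤ t → ∀ x : X, S t (J x) = J (S t x)
  integral : ∀ t : ℝ, 0 ≤ t → ∀ x : X, ∫ s in (0 : ℝ)..t, S s x = J x - S t (J x)
  J_nonneg : ∀ x : X, 0 ≤ x → 0 ≤ J x
  nonneg_of_J : ∀ x : X, 0 ≤ J x → 0 ≤ x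

variable [IsOrderedAddMonoid X] [IsOrderedModule ℝ X] [OrderClosedTopology X]

/-- Under the lower bound `λ₀ g ≤ Λ g`, the integrals `G h = ∫₀ʰ S(s) ds` of the semigroup generated
by `-Λ` satisfy `λ₀ G h g ≤ Λ (G h g) = g - S(h) g` for `g ≥ 0`. Hence they increase to a bounded
operator `J`, the semigroup is dominated by the identity and vanishes strongly at infinity, and `J`
is the inverse of `Λ`. -/
theorem exists_isDampingPair (hX : IsAbstractStateSpace X) {Λ : X →ₗ.[ℝ] X}
    (hS : IsC0Semigroup S) (hpos : ∀ t : ℝ, 0 ≤ t → ∀ x : X, 0 ≤ x → 0 ≤ S t x)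
    (hgen : IsInfinitesimalGenerator S (-Λ)) (hA0 : AssumptionA0 Λ) :
    ∃ J : X →L[ℝ] X, IsDampingPair S J ∧
      ∀ x y, (x ∈ Λ.domain ∧ opVal Λ x = y) ↔ x = J y := by
  obtain ⟨lam, hlam, hA0⟩ := hA0
  have hmem := mem_domain_iff_of_generator hgen
  set G : ℝ → X → X := fun h x => ∫ s in (0 : ℝ)..h, S s x with hG
  have hSzero : ∀ x, S 0 x = x := fun x => by rw [hS.zero]; rfl
  have hGdom : ∀ h, 0 ≤ h → ∀ x, G h x ∈ Λ.domain ∧ opVal Λ (G h x) = x - S h x := by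
    intro h hh x
    rw [hmem]
    have h1 := (hS.tendsto_integral x le_rfl).sub (hS.tendsto_integral x hh)
    rw [hSzero] at h1
    refine h1.congr' ?_
    filter_upwards [self_mem_nhdsWithin] with τ hτ
    have hτ' : (0 : ℝ) < τ := hτ
    simp only [hG]
    rw [hS.map_integral x hh hτ'.le, ← smul_sub, zero_add, intervalIntegral.integral_same]
    congr 1
    abel
  have hGnonneg : ∀ h, 0 ≤ h → ∀ g, 0 ≤ g → 0 ≤ G h g := fun h hh g hg => by
    refine integral_nonneg_of_ae_timeMeasure hh ?_
    filter_upwards [ae_restrict_mem measurableSet_Ici] with s hs _ using hpos s hs g hg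
  have hGle : ∀ h, 0 ≤ h → ∀ g, 0 ≤ g → lam • G h g ≤ g - S h g := fun h hh g hg => by
    rw [← (hGdom h hh g).2]
    exact hA0 _ ⟨hGnonneg h hh g hg, ⟨mem_univ _, (hGdom h hh g).1⟩⟩
  have hSle : ∀ h, 0 ≤ h → ∀ g, 0 ≤ g → S h g ≤ g := fun h hh g hg =>
    sub_nonneg.1 ((smul_nonneg hlam.le (hGnonneg h hh g hg)).trans (hGle h hh g hg))
  have hGnorm : ∀ h, 0 ≤ h → ∀ g, 0 ≤ g → ‖G h g‖ ≤ lam⁻¹ * ‖g‖ := fun h hh g hg => by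
    have h1 : lam • G h g ≤ g :=
      (hGle h hh g hg).trans (sub_le_self _ (hpos h hh g hg))
    have h2 := hX.norm_le (smul_nonneg hlam.le (hGnonneg h hh g hg)) h1
    rw [norm_smul, Real.norm_of_nonneg hlam.le] at h2
    rwa [inv_mul_eq_div, le_div_iff₀' hlam]
  have hGadd : ∀ h, 0 ≤ h → ∀ τ, 0 ≤ τ → ∀ x, G (h + τ) x = G τ x + S τ (G h x) :=
    fun h hh τ hτ x => by
      simp only [hG]
      rw [hS.map_integral x hh hτ]; abel
  have hGlin : ∀ h, 0 ≤ h → ∀ x y, G h (x + y) = G h x + G h y := fun h hh x y => by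
    simp only [hG, map_add]
    exact intervalIntegral.integral_add (hS.intervalIntegrable x le_rfl hh)
      (hS.intervalIntegrable y le_rfl hh)
  have hGsmul : ∀ h, ∀ (c : ℝ) x, G h (c • x) = c • G h x := fun h c x => by
    simp only [hG, map_smul]
    exact intervalIntegral.integral_smul c _
  obtain ⟨K, hK, hdec⟩ := hX.exists_decomposition
  have hSbdd : ∀ t, 0 ≤ t → ∀ x, ‖S t x‖ ≤ (2 * K) * ‖x‖ := fun t ht x => by
    obtain ⟨u, v, hu, hv, huv, hun, hvn⟩ := hdec x
    have h1 := hX.norm_le (hpos t ht u hu) (hSle t ht u hu)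
    have h2 := hX.norm_le (hpos t ht v hv) (hSle t ht v hv)
    calc ‖S t x‖ = ‖S t u - S t v‖ := by rw [huv, map_sub]
      _ ≤ ‖S t u‖ + ‖S t v‖ := norm_sub_le _ _
      _ ≤ _ := by linarith
  have hGsub : ∀ h, 0 ≤ h → ∀ x y, G h (x - y) = G h x - G h y := fun h hh x y => by
    have := hGlin h hh (x - y) y
    rw [sub_add_cancel] at this
    rw [this, add_sub_cancel_right]
  have hGconvpos : ∀ g, 0 ≤ g → ∃ y, Tendsto (fun n : ℕ => G n g) atTop (𝓝 y) := fun g hg => by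
    refine hX.exists_tendsto_of_monotone (monotone_nat_of_le_succ fun n => ?_)
      (fun n => hGnonneg n n.cast_nonneg g hg) fun n => hGnorm n n.cast_nonneg g hg
    rw [Nat.cast_succ, add_comm, hGadd 1 zero_le_one n n.cast_nonneg]
    exact le_add_of_nonneg_right (hpos n n.cast_nonneg _ (hGnonneg 1 zero_le_one g hg))
  have hGconv : ∀ x, ∃ y, Tendsto (fun n : ℕ => G n x) atTop (𝓝 y) := fun x => by
    obtain ⟨u, v, hu, hv, rfl⟩ := hX.generating x
    obtain ⟨y, hy⟩ := hGconvpos u hu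
    obtain ⟨z, hz⟩ := hGconvpos v hv
    exact ⟨y - z, (hy.sub hz).congr fun n => (hGsub n n.cast_nonneg u v).symm⟩
  choose Jf hJf using hGconv
  let Jl : X →ₗ[ℝ] X :=
    { toFun := Jf
      map_add' := fun x y => tendsto_nhds_unique (hJf (x + y))
        (((hJf x).add (hJf y)).congr fun n => (hGlin n n.cast_nonneg x y).symm)
      map_smul' := fun c x => tendsto_nhds_unique (hJf (c • x))
        (((hJf x).const_smul c).congr fun n => (hGsmul n c x).symm) }
  let J : X →L[ℝ] X := Jl.mkContinuous (lam⁻¹ * (2 * K)) fun x => by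
    refine le_of_tendsto (hJf x).norm (Eventually.of_forall fun n => ?_)
    obtain ⟨u, v, hu, hv, huv, hun, hvn⟩ := hdec x
    have hl : 0 ≤ lam⁻¹ := inv_nonneg.2 hlam.le
    calc ‖G n x‖ = ‖G n u - G n v‖ := by rw [huv, hGsub n n.cast_nonneg]
      _ ≤ ‖G n u‖ + ‖G n v‖ := norm_sub_le _ _
      _ ≤ lam⁻¹ * ‖u‖ + lam⁻¹ * ‖v‖ :=
        add_le_add (hGnorm n n.cast_nonneg u hu) (hGnorm n n.cast_nonneg v hv)
      _ ≤ lam⁻¹ * (K * ‖x‖) + lam⁻¹ * (K * ‖x‖) := by gcongr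
      _ = _ := by ring
  have hJ : ∀ x, Tendsto (fun n : ℕ => G n x) atTop (𝓝 (J x)) := hJf
  -- `n ‖S(n) g‖ ≤ ‖G n g‖` for `g ≥ 0`, since `S` decreases
  have hSzero_pos : ∀ g, 0 ≤ g → Tendsto (fun n : ℕ => S n g) atTop (𝓝 0) := fun g hg => by
    rw [tendsto_zero_iff_norm_tendsto_zero]
    have hle : ∀ᶠ n : ℕ in atTop, ‖S n g‖ ≤ (lam⁻¹ * ‖g‖) / n := by
      filter_upwards [eventually_ge_atTop 1] with n hn
      have hn' : (0 : ℝ) < n := by exact_mod_cast hn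
      rw [le_div_iff₀' hn']
      refine le_trans ?_ (hGnorm n hn'.le g hg)
      have h1 : (n : ℝ) • S n g ≤ G n g := by
        have h2 : ∫ s in (0 : ℝ)..n, S n g = (n : ℝ) • S n g := by simp
        rw [← h2]
        refine integral_mono_of_ae_timeMeasure hn'.le (by simp)
          (hS.intervalIntegrable g le_rfl hn'.le) ?_
        filter_upwards [ae_restrict_mem measurableSet_Ici] with s hs hsn
        have hs' : (0 : ℝ) ≤ s := hs
        have h3 := hS.add (n - s) s (sub_nonneg.2 hsn) hs'
        rw [sub_add_cancel] at h3
        rw [h3]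
        exact hSle _ (sub_nonneg.2 hsn) _ (hpos s hs' g hg)
      have h2 := hX.norm_le (smul_nonneg hn'.le (hpos n hn'.le g hg)) h1
      rwa [norm_smul, Real.norm_of_nonneg hn'.le] at h2
    exact squeeze_zero' (Eventually.of_forall fun _ => norm_nonneg _) hle
      (tendsto_const_nhds.div_atTop tendsto_natCast_atTop_atTop)
  have hSlim : ∀ x, Tendsto (fun n : ℕ => S n x) atTop (𝓝 0) := fun x => by
    obtain ⟨u, v, hu, hv, rfl⟩ := hX.generating x
    simpa using (hSzero_pos u hu).sub (hSzero_pos v hv)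
  have hSJ : ∀ t, 0 ≤ t → ∀ x, S t (J x) = J x - G t x := fun t ht x => by
    have h1 : Tendsto (fun n : ℕ => S t (G n x)) atTop (𝓝 (S t (J x))) :=
      ((S t).continuous.tendsto _).comp (hJ x)
    have h2 : Tendsto (fun n : ℕ => G n x + S n (G t x) - G t x) atTop (𝓝 (J x + 0 - G t x)) :=
      ((hJ x).add (hSlim _)).sub tendsto_const_nhds
    rw [add_zero] at h2
    refine tendsto_nhds_unique h1 (h2.congr fun n => ?_)
    have h3 := hGadd n n.cast_nonneg t ht x
    rw [← hGadd t ht n n.cast_nonneg, add_comm t, h3, add_sub_cancel_left]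
  have hdom : ∀ x, J x ∈ Λ.domain ∧ opVal Λ (J x) = x := fun x => by
    rw [hmem]
    have h1 := hS.tendsto_integral x le_rfl
    rw [hSzero] at h1
    refine h1.congr' ?_
    filter_upwards [self_mem_nhdsWithin] with τ hτ
    have hτ' : (0 : ℝ) < τ := hτ
    rw [hSJ τ hτ'.le, sub_sub_cancel, zero_add, intervalIntegral.integral_same, sub_zero]
  have hJpos : ∀ x, 0 ≤ x → 0 ≤ J x := fun x hx =>
    ge_of_tendsto' (hJ x) fun n => hGnonneg n n.cast_nonneg x hx
  have hcomm : ∀ t, 0 ≤ t → ∀ x, S t (J x) = J (S t x) := fun t ht x =>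
    tendsto_nhds_unique (((S t).continuous.tendsto _).comp (hJ x))
      ((hJ (S t x)).congr fun n => (hS.map_integral' x n.cast_nonneg ht).symm)
  refine ⟨J, ⟨hS, hpos, ⟨2 * K, by positivity, hSbdd⟩, hcomm, fun t ht x => ?_, hJpos,
    fun x hx => ?_⟩, fun x y => ⟨fun h => ?_, ?_⟩⟩
  · rw [hSJ t ht, sub_sub_cancel]
  · have h1 := hA0 (J x) ⟨hx, mem_univ _, (hdom x).1⟩
    rw [(hdom x).2] at h1
    exact (smul_nonneg hlam.le hx).trans h1
  · rw [hmem] at h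
    have h1 := (J.continuous.tendsto _).comp h
    have h2 := hS.tendsto_integral x le_rfl
    rw [hSzero] at h2
    refine tendsto_nhds_unique h2 (h1.congr' ?_)
    filter_upwards [self_mem_nhdsWithin] with τ hτ
    have hτ' : (0 : ℝ) < τ := hτ
    rw [Function.comp_apply, map_smul, map_sub, ← hcomm τ hτ'.le, hSJ τ hτ'.le, sub_sub_cancel,
      zero_add, intervalIntegral.integral_same, sub_zero]
  · rintro rfl
    exact hdom y

namespace IsDampingPair

variable {J : X →L[ℝ] X} (h : IsDampingPair S J)

include h

theorem zero_apply (x : X) : S 0 x = x := by rw [h.semigroup.zero]; rfl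

theorem J_mono {x y : X} (hxy : x ≤ y) : J x ≤ J y := by
  have := h.J_nonneg _ (sub_nonneg.2 hxy)
  rwa [map_sub, sub_nonneg] at this

theorem le_of_J {x y : X} (hxy : J x ≤ J y) : x ≤ y := by
  refine sub_nonneg.1 (h.nonneg_of_J _ ?_)
  rwa [map_sub, sub_nonneg]

theorem injective : Function.Injective J := fun _ _ hxy =>
  le_antisymm (h.le_of_J hxy.le) (h.le_of_J hxy.ge)

theorem apply_le {t : ℝ} (ht : 0 ≤ t) {g : X} (hg : 0 ≤ g) : S t g ≤ g := by
  refine h.le_of_J (sub_nonneg.1 ?_)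
  rw [← h.comm t ht, ← h.integral t ht]
  refine integral_nonneg_of_ae_timeMeasure ht ?_
  filter_upwards [ae_restrict_mem measurableSet_Ici] with s hs _ using h.nonneg s hs g hg

end IsDampingPair

/-- The difference quotient `2ⁿ (1 - S(2⁻ⁿ))`, a bounded approximation of `J⁻¹`, which increases
with `n` on the positive cone. -/
noncomputable def diffQuot (S : ℝ → X →L[ℝ] X) (n : ℕ) : X →L[ℝ] X :=
  (2 ^ n : ℝ) • (ContinuousLinearMap.id ℝ X - S ((2 ^ n : ℝ)⁻¹))

/-- The average `2ⁿ ∫₀ᵗ S(s) ds` over `[0, t]`, `t = 2⁻ⁿ`, an approximation of the identity which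
maps into the range of `J`, that is, into the domain of the generator. It is written as
`2ⁿ (1 - S(2⁻ⁿ)) J`. -/
noncomputable def smoothing (S : ℝ → X →L[ℝ] X) (J : X →L[ℝ] X) (n : ℕ) : X →L[ℝ] X :=
  (diffQuot S n).comp J

theorem diffQuot_apply (n : ℕ) (x : X) :
    diffQuot S n x = (2 ^ n : ℝ) • (x - S ((2 ^ n : ℝ)⁻¹) x) := rfl

theorem smoothing_apply (J : X →L[ℝ] X) (n : ℕ) (x : X) :
    smoothing S J n x = diffQuot S n (J x) := rfl

namespace IsDampingPair

variable {J : X →L[ℝ] X} (h : IsDampingPair S J)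

include h

theorem diffQuot_nonneg (n : ℕ) {g : X} (hg : 0 ≤ g) : 0 ≤ diffQuot S n g := by
  rw [diffQuot_apply]
  exact smul_nonneg (by positivity) (sub_nonneg.2 (h.apply_le (by positivity) hg))

theorem diffQuot_le (n : ℕ) {x y : X} (hxy : x ≤ y) : diffQuot S n x ≤ diffQuot S n y := by
  have := h.diffQuot_nonneg n (sub_nonneg.2 hxy)
  rwa [map_sub, sub_nonneg] at this

/-- With `T = S(2⁻⁽ⁿ⁺¹⁾)`, the increment of the difference quotients is `2ⁿ (1 - T)²`. -/
theorem diffQuot_le_succ (n : ℕ) {g : X} (hg : 0 ≤ g) : diffQuot S n g ≤ diffQuot S (n + 1) g := by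
  set τ : ℝ := (2 ^ (n + 1) : ℝ)⁻¹ with hτ
  have hτ0 : 0 ≤ τ := by positivity
  have h2 : ((2 : ℝ) ^ n)⁻¹ = τ + τ := by rw [hτ, pow_succ]; field_simp; norm_num
  have h3 : S ((2 : ℝ) ^ n)⁻¹ g = S τ (S τ g) := by
    rw [h2, h.semigroup.add τ τ hτ0 hτ0]; rfl
  have h4 : diffQuot S (n + 1) g - diffQuot S n g
      = (2 ^ n : ℝ) • ((g - S τ g) - S τ (g - S τ g)) := by
    rw [diffQuot_apply, diffQuot_apply, h3, ← hτ, pow_succ, mul_smul, ← smul_sub, map_sub, two_smul]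
    congr 1
    abel
  rw [← sub_nonneg, h4]
  exact smul_nonneg (by positivity)
    (sub_nonneg.2 (h.apply_le hτ0 (sub_nonneg.2 (h.apply_le hτ0 hg))))

theorem diffQuot_J (n : ℕ) (x : X) : diffQuot S n (J x) = J (diffQuot S n x) := by
  rw [diffQuot_apply, diffQuot_apply, h.comm _ (by positivity), map_smul, map_sub]

theorem smoothing_eq (n : ℕ) (x : X) : smoothing S J n x = J (diffQuot S n x) := by
  rw [smoothing_apply, h.diffQuot_J]

theorem smoothing_nonneg (n : ℕ) {g : X} (hg : 0 ≤ g) : 0 ≤ smoothing S J n g :=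
  h.diffQuot_nonneg n (h.J_nonneg g hg)

theorem smoothing_mono (n : ℕ) {x y : X} (hxy : x ≤ y) : smoothing S J n x ≤ smoothing S J n y :=
  h.diffQuot_le n (h.J_mono hxy)

theorem smoothing_le_succ (n : ℕ) {g : X} (hg : 0 ≤ g) :
    smoothing S J n g ≤ smoothing S J (n + 1) g :=
  h.diffQuot_le_succ n (h.J_nonneg g hg)

theorem smoothing_eq_integral (n : ℕ) (x : X) :
    smoothing S J n x = (2 ^ n : ℝ) • ∫ s in (0 : ℝ)..(2 ^ n : ℝ)⁻¹, S s x := by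
  rw [smoothing_apply, diffQuot_apply, h.integral _ (by positivity)]

theorem smoothing_le (n : ℕ) {g : X} (hg : 0 ≤ g) : smoothing S J n g ≤ g := by
  have h0 : (0 : ℝ) ≤ (2 ^ n : ℝ)⁻¹ := by positivity
  have h1 : ∫ s in (0 : ℝ)..(2 ^ n : ℝ)⁻¹, S s g ≤ ∫ s in (0 : ℝ)..(2 ^ n : ℝ)⁻¹, g := by
    refine integral_mono_of_ae_timeMeasure h0
      (h.semigroup.intervalIntegrable g le_rfl h0) (by simp) ?_
    filter_upwards [ae_restrict_mem measurableSet_Ici] with s hs _ using h.apply_le hs hg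
  rw [intervalIntegral.integral_const, sub_zero] at h1
  rw [h.smoothing_eq_integral]
  calc _ ≤ (2 ^ n : ℝ) • ((2 ^ n : ℝ)⁻¹ • g) := smul_le_smul_of_nonneg_left h1 (by positivity)
    _ = g := by rw [smul_smul, mul_inv_cancel₀ (by positivity), one_smul]

theorem tendsto_smoothing (x : X) : Tendsto (fun n => smoothing S J n x) atTop (𝓝 x) := by
  have h1 := h.semigroup.tendsto_integral x le_rfl
  rw [h.zero_apply] at h1
  have h2 : Tendsto (fun n : ℕ => (2 ^ n : ℝ)⁻¹) atTop (𝓝[>] 0) :=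
    tendsto_inv_atTop_nhdsGT_zero.comp (tendsto_pow_atTop_atTop_of_one_lt one_lt_two)
  refine (h1.comp h2).congr fun n => ?_
  simp [h.smoothing_eq_integral]

/-- As the smoothing operators increase to the identity, they can be applied along an increasing
sequence without changing its limit. -/
theorem tendsto_smoothing_of_monotone (hX : IsAbstractStateSpace X) {u : ℕ → X} {g : X}
    (hu : Monotone u) (hg : Tendsto u atTop (𝓝 g)) :
    Tendsto (fun n => smoothing S J n (u n)) atTop (𝓝 g) := by
  have h1 : Tendsto (fun n => smoothing S J n (g - u n)) atTop (𝓝 0) := by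
    refine squeeze_zero_norm (fun n => ?_) (a := fun n => ‖g - u n‖) (by
      simpa using ((tendsto_const_nhds (x := g)).sub hg).norm)
    have h0 : 0 ≤ g - u n := sub_nonneg.2 (hu.ge_of_tendsto hg n)
    exact hX.norm_le (h.smoothing_nonneg n h0) (h.smoothing_le n h0)
  have h2 := (h.tendsto_smoothing g).sub h1
  rw [sub_zero] at h2
  exact h2.congr fun n => by rw [map_sub, sub_sub_cancel]

/-- `J⁻¹` preserves measurability, as a limit of bounded operators. -/
theorem aestronglyMeasurable_of_J {α : Type*} [MeasurableSpace α] {μ : Measure α} {f : α → X}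
    (hf : AEStronglyMeasurable (fun s => J (f s)) μ) : AEStronglyMeasurable f μ :=
  aestronglyMeasurable_of_tendsto_ae atTop
    (fun n => (diffQuot S n).continuous.comp_aestronglyMeasurable hf)
    (Eventually.of_forall fun s => h.tendsto_smoothing (f s))

end IsDampingPair

end Semigroup

end OrderedEvolution

/-! ### Duhamel integrals -/

namespace OrderedEvolution

section LocallyBounded

instance : SFinite timeMeasure := by unfold timeMeasure; infer_instance

variable {E F : Type*} [NormedAddCommGroup E] [NormedSpace ℝ E] [NormedAddCommGroup F]
  [NormedSpace ℝ F]

/-- Measurable and essentially bounded on each interval `[0, T]`. -/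
structure IsLocBdd (b : ℝ → E) : Prop where
  meas : AEStronglyMeasurable b timeMeasure
  bound : ∀ T : ℝ, ∃ C : ℝ, ∀ᵐ s ∂timeMeasure, s ≤ T → ‖b s‖ ≤ C

namespace IsLocBdd

variable {b c : ℝ → E}

theorem of_bound (hb : AEStronglyMeasurable b timeMeasure) (C : ℝ → ℝ)
    (hC : ∀ T s, 0 ≤ s → s ≤ T → ‖b s‖ ≤ C T) : IsLocBdd b :=
  ⟨hb, fun T => ⟨C T, by
    filter_upwards [ae_restrict_mem measurableSet_Ici] with s hs hsT using hC T s hs hsT⟩⟩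

theorem mono (hb : IsLocBdd b) {c : ℝ → F} (hc : AEStronglyMeasurable c timeMeasure)
    (h : ∀ᵐ s ∂timeMeasure, ‖c s‖ ≤ ‖b s‖) : IsLocBdd c :=
  ⟨hc, fun T => by
    obtain ⟨C, hC⟩ := hb.bound T
    exact ⟨C, by filter_upwards [hC, h] with s h1 h2 hs using h2.trans (h1 hs)⟩⟩

theorem add (hb : IsLocBdd b) (hc : IsLocBdd c) : IsLocBdd fun s => b s + c s :=
  ⟨hb.meas.add hc.meas, fun T => by
    obtain ⟨C, hC⟩ := hb.bound T
    obtain ⟨C', hC'⟩ := hc.bound T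
    refine ⟨C + C', ?_⟩
    filter_upwards [hC, hC'] with s h1 h2 hs
    exact (norm_add_le _ _).trans (add_le_add (h1 hs) (h2 hs))⟩

theorem smul {r : ℝ → ℝ} (hr : IsLocBdd r) (hb : IsLocBdd b) : IsLocBdd fun s => r s • b s :=
  ⟨hr.meas.smul hb.meas, fun T => by
    obtain ⟨C, hC⟩ := hr.bound T
    obtain ⟨C', hC'⟩ := hb.bound T
    refine ⟨C * C', ?_⟩
    filter_upwards [hC, hC'] with s h1 h2 hs
    rw [norm_smul]
    exact mul_le_mul (h1 hs) (h2 hs) (norm_nonneg _) ((norm_nonneg _).trans (h1 hs))⟩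

theorem const (x : E) : IsLocBdd fun _ : ℝ => x :=
  .of_bound aestronglyMeasurable_const (fun _ => ‖x‖) fun _ _ _ _ => le_rfl

theorem clm (hb : IsLocBdd b) (L : E →L[ℝ] F) : IsLocBdd fun s => L (b s) :=
  ⟨L.continuous.comp_aestronglyMeasurable hb.meas, fun T => by
    obtain ⟨C, hC⟩ := hb.bound T
    refine ⟨‖L‖ * C, ?_⟩
    filter_upwards [hC] with s h1 hs
    exact (L.le_opNorm _).trans (mul_le_mul_of_nonneg_left (h1 hs) (norm_nonneg _))⟩

theorem norm (hb : IsLocBdd b) : IsLocBdd fun s => ‖b s‖ :=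
  hb.mono hb.meas.norm (Eventually.of_forall fun s => by simp)

theorem sub (hb : IsLocBdd b) (hc : IsLocBdd c) : IsLocBdd fun s => b s - c s := by
  simpa only [sub_eq_add_neg, neg_smul, one_smul] using hb.add ((IsLocBdd.const (-1 : ℝ)).smul hc)

theorem intervalIntegrable (hb : IsLocBdd b) {s t : ℝ} (hs : 0 ≤ s) (ht : 0 ≤ t) :
    IntervalIntegrable b volume s t := by
  have key : ∀ t, 0 ≤ t → IntervalIntegrable b volume 0 t := fun t ht => by
    obtain ⟨C, hC⟩ := hb.bound t
    rw [intervalIntegrable_iff_integrableOn_Ioc_of_le ht]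
    have hsub : volume.restrict (Ioc 0 t) ≤ timeMeasure :=
      Measure.restrict_mono (fun s hs => hs.1.le) le_rfl
    refine Integrable.of_bound (hb.meas.mono_measure hsub) C ?_
    filter_upwards [ae_restrict_Ioc_of_ae_timeMeasure hC t] with s hs using hs.1 hs.2.2
  exact (key s hs).symm.trans (key t ht)

theorem of_continuousOn (hb : ContinuousOn b (Ici 0)) : IsLocBdd b := by
  refine ⟨hb.aestronglyMeasurable measurableSet_Ici, fun T => ?_⟩
  obtain ⟨C, hC⟩ := isCompact_Icc.exists_bound_of_continuousOn (hb.mono fun s hs => (hs : s ∈ Icc 0 T).1)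
  refine ⟨C, ?_⟩
  filter_upwards [ae_restrict_mem measurableSet_Ici] with s hs hsT using hC s ⟨hs, hsT⟩

theorem continuousOn_integral (hb : IsLocBdd b) :
    ContinuousOn (fun t => ∫ s in (0 : ℝ)..t, b s) (Ici 0) := by
  intro t ht
  have ht' : (0 : ℝ) ≤ t := ht
  have h1 : ContinuousOn (fun t => ∫ s in (0 : ℝ)..t, b s) (uIcc 0 (t + 1)) :=
    intervalIntegral.continuousOn_primitive_interval'
      (hb.intervalIntegrable le_rfl (by linarith)) left_mem_uIcc
  rw [uIcc_of_le (by linarith)] at h1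
  refine (h1 t ⟨ht', by linarith⟩).mono_of_mem_nhdsWithin ?_
  rw [mem_nhdsWithin]
  exact ⟨Iio (t + 1), isOpen_Iio, by simp, fun s hs => ⟨hs.2, hs.1.le⟩⟩

end IsLocBdd

/-- Fubini's theorem on a triangle. -/
theorem integral_triangle_swap {K : ℝ → ℝ → E}
    (hK : AEStronglyMeasurable (Function.uncurry K) (timeMeasure.prod timeMeasure)) {t : ℝ}
    (ht : 0 ≤ t) {C : ℝ}
    (hC : ∀ᵐ r ∂timeMeasure, ∀ s, r ≤ s → s ≤ t → ‖K s r‖ ≤ C) :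
    ∫ s in (0 : ℝ)..t, ∫ r in (0 : ℝ)..s, K s r = ∫ r in (0 : ℝ)..t, ∫ s in r..t, K s r := by
  let K' : ℝ → ℝ → E := fun s r => {p : ℝ × ℝ | p.2 ≤ p.1}.indicator (Function.uncurry K) (s, r)
  have hsub : (volume.restrict (Ioc 0 t)).prod (volume.restrict (Ioc 0 t))
      ≤ timeMeasure.prod timeMeasure := by
    unfold timeMeasure
    rw [Measure.prod_restrict, Measure.prod_restrict]
    exact Measure.restrict_mono (prod_mono (fun s hs => hs.1.le) fun s hs => hs.1.le) le_rfl
  have hmeas : MeasurableSet {p : ℝ × ℝ | p.2 ≤ p.1} := measurableSet_le measurable_snd measurable_fst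
  have hK' : Integrable (Function.uncurry K')
      ((volume.restrict (Ioc 0 t)).prod (volume.restrict (Ioc 0 t))) := by
    refine Integrable.of_bound (C := max C 0)
      (((hK.mono_measure hsub).indicator hmeas).congr (Eventually.of_forall fun p => rfl)) ?_
    have h1 : ∀ᵐ p ∂(volume.restrict (Ioc 0 t)).prod (volume.restrict (Ioc 0 t)),
        ∀ s, p.2 ≤ s → s ≤ t → ‖K s p.2‖ ≤ C := by
      refine (Measure.quasiMeasurePreserving_snd (μ := volume.restrict (Ioc 0 t))
        (ν := volume.restrict (Ioc 0 t))).ae (p := fun r => ∀ s, r ≤ s → s ≤ t → ‖K s r‖ ≤ C) ?_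
      filter_upwards [ae_restrict_Ioc_of_ae_timeMeasure hC t] with r hr using hr.1
    have h2 : ∀ᵐ p ∂(volume.restrict (Ioc 0 t)).prod (volume.restrict (Ioc 0 t)),
        p.1 ∈ Ioc 0 t := by
      refine (Measure.quasiMeasurePreserving_fst (μ := volume.restrict (Ioc 0 t))
        (ν := volume.restrict (Ioc 0 t))).ae (p := fun s => s ∈ Ioc 0 t) ?_
      exact ae_restrict_mem measurableSet_Ioc
    filter_upwards [h1, h2] with p hp hp'
    simp only [Function.uncurry, K', indicator_apply, mem_ofPred_eq]
    split_ifs with hle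
    · exact (hp p.1 hle hp'.2).trans (le_max_left _ _)
    · simp
  have hswap := integral_integral_swap hK'
  rw [intervalIntegral.integral_of_le ht, intervalIntegral.integral_of_le ht]
  have hl : ∀ s ∈ Ioc 0 t, ∫ r in Ioc 0 t, K' s r = ∫ r in (0 : ℝ)..s, K s r := fun s hs => by
    rw [intervalIntegral.integral_of_le hs.1.le]
    have : ∀ r, K' s r = (Iic s).indicator (K s) r := fun r => by
      simp only [K', indicator_apply, mem_ofPred_eq, mem_Iic, Function.uncurry]
    simp_rw [this]
    rw [integral_indicator measurableSet_Iic, Measure.restrict_restrict measurableSet_Iic]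
    congr 2
    ext r
    simp only [mem_inter_iff, mem_Iic, mem_Ioc]
    exact ⟨fun h => ⟨h.2.1, h.1⟩, fun h => ⟨h.2, h.1, h.2.trans hs.2⟩⟩
  have hr : ∀ r ∈ Ioc 0 t, ∫ s in Ioc 0 t, K' s r = ∫ s in r..t, K s r := fun r hr => by
    rw [intervalIntegral.integral_of_le hr.2, ← integral_Icc_eq_integral_Ioc (x := r) (y := t)]
    have : ∀ s, K' s r = (Ici r).indicator (fun s => K s r) s := fun s => by
      simp only [K', indicator_apply, mem_ofPred_eq, mem_Ici, Function.uncurry]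
    simp_rw [this]
    rw [integral_indicator measurableSet_Ici, Measure.restrict_restrict measurableSet_Ici]
    congr 2
    ext s
    simp only [mem_inter_iff, mem_Ici, mem_Ioc, mem_Icc]
    exact ⟨fun h => ⟨h.1, h.2.2⟩, fun h => ⟨h.1, hr.1.trans_le h.1, h.2⟩⟩
  rw [setIntegral_congr_fun measurableSet_Ioc hl, setIntegral_congr_fun measurableSet_Ioc hr]
    at hswap
  exact hswap

theorem tendsto_integral_of_dominated {F : ℕ → ℝ → E} {f : ℝ → E} {g : ℝ → ℝ}
    (hF : ∀ n, IsLocBdd (F n)) (hg : IsLocBdd g)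
    (hle : ∀ n, ∀ᵐ s ∂timeMeasure, ‖F n s‖ ≤ g s)
    (hlim : ∀ᵐ s ∂timeMeasure, Tendsto (fun n => F n s) atTop (𝓝 (f s))) {t : ℝ} (ht : 0 ≤ t) :
    Tendsto (fun n => ∫ s in (0 : ℝ)..t, F n s) atTop (𝓝 (∫ s in (0 : ℝ)..t, f s)) := by
  simp only [intervalIntegral.integral_of_le ht]
  refine tendsto_integral_of_dominated_convergence g
    (fun n => ((hF n).intervalIntegrable le_rfl ht).1.aestronglyMeasurable)
    (hg.intervalIntegrable le_rfl ht).1 (fun n => ?_) ?_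
  · filter_upwards [ae_restrict_Ioc_of_ae_timeMeasure (hle n) t] with s hs using hs.1
  · filter_upwards [ae_restrict_Ioc_of_ae_timeMeasure hlim t] with s hs using hs.1

end LocallyBounded

section Duhamel

variable {X : Type*} [NormedAddCommGroup X] [NormedSpace ℝ X] [CompleteSpace X]
  {S : ℝ → X →L[ℝ] X} [PartialOrder X]

/-- The Duhamel integral `∫₀ᵗ S(α (t - s)) b(s) ds` of the semigroup `S(α ·)`. -/
noncomputable def duhamel (S : ℝ → X →L[ℝ] X) (α : ℝ) (b : ℝ → X) (t : ℝ) : X :=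
  ∫ s in (0 : ℝ)..t, S (α * (t - s)) (b s)

namespace IsDampingPair

variable {J : X →L[ℝ] X} (h : IsDampingPair S J)

include h

theorem continuous_uncurry : Continuous fun p : X × ℝ => S (max p.2 0) p.1 := by
  obtain ⟨C, hC, hS⟩ := h.bounded
  refine continuous_prod_of_continuous_lipschitzWith _ ⟨C, hC⟩ h.semigroup.continuous_max
    fun t => LipschitzWith.of_dist_le_mul fun x y => ?_
  rw [dist_eq_norm, dist_eq_norm, ← map_sub]
  exact hS _ (le_max_right _ _) _

theorem aestronglyMeasurable_kernel {μ : Measure (ℝ × ℝ)} {k : ℝ × ℝ → ℝ} (hk : Continuous k)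
    {b : ℝ × ℝ → X} (hb : AEStronglyMeasurable b μ) :
    AEStronglyMeasurable (fun p => S (max (k p) 0) (b p)) μ :=
  h.continuous_uncurry.comp_aestronglyMeasurable (hb.prodMk hk.aestronglyMeasurable)

theorem smul_integral {α : ℝ} (hα : 0 ≤ α) {τ : ℝ} (hτ : 0 ≤ τ) (x : X) :
    α • ∫ s in (0 : ℝ)..τ, S (α * s) x = J x - S (α * τ) (J x) := by
  rw [intervalIntegral.smul_integral_comp_mul_left (fun s => S s x) α, mul_zero,
    h.integral _ (mul_nonneg hα hτ)]

theorem isLocBdd_kernel (α : ℝ) {b : ℝ → X} (hb : IsLocBdd b) (t : ℝ) :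
    IsLocBdd fun s => S (max (α * (t - s)) 0) (b s) := by
  obtain ⟨C, hC, hS⟩ := h.bounded
  refine ⟨h.continuous_uncurry.comp_aestronglyMeasurable
    (hb.meas.prodMk (by fun_prop : Continuous fun s : ℝ => α * (t - s)).aestronglyMeasurable),
    fun T => ?_⟩
  obtain ⟨C', hC'⟩ := hb.bound T
  refine ⟨C * C', ?_⟩
  filter_upwards [hC'] with s hs hsT
  exact (hS _ (le_max_right _ _) _).trans (mul_le_mul_of_nonneg_left (hs hsT) hC)

theorem duhamel_eq {α : ℝ} (hα : 0 ≤ α) (b : ℝ → X) {t : ℝ} (ht : 0 ≤ t) :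
    duhamel S α b t = ∫ s in (0 : ℝ)..t, S (max (α * (t - s)) 0) (b s) :=
  intervalIntegral.integral_congr fun s hs => by
    rw [uIcc_of_le ht] at hs
    simp only [max_eq_left (mul_nonneg hα (sub_nonneg.2 hs.2))]

theorem intervalIntegrable_kernel {α : ℝ} (hα : 0 ≤ α) {b : ℝ → X} (hb : IsLocBdd b) {t : ℝ}
    (ht : 0 ≤ t) : IntervalIntegrable (fun s => S (α * (t - s)) (b s)) volume 0 t := by
  refine ((h.isLocBdd_kernel α hb t).intervalIntegrable le_rfl ht).congr fun s hs => ?_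
  rw [uIoc_of_le ht] at hs
  simp only [max_eq_left (mul_nonneg hα (sub_nonneg.2 hs.2))]

theorem isLocBdd_duhamel {α : ℝ} (hα : 0 ≤ α) {b : ℝ → X} (hb : IsLocBdd b) :
    IsLocBdd (duhamel S α b) := by
  obtain ⟨C, hC, hS⟩ := h.bounded
  constructor
  · let K : ℝ × ℝ → X := {p : ℝ × ℝ | p.2 ≤ p.1}.indicator
      fun p => S (max (α * (p.1 - p.2)) 0) (b p.2)
    have hK : AEStronglyMeasurable K (timeMeasure.prod timeMeasure) :=
      (h.aestronglyMeasurable_kernel (k := fun p => α * (p.1 - p.2)) (by fun_prop)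
        hb.meas.comp_snd).indicator (measurableSet_le measurable_snd measurable_fst)
    refine hK.integral_prod_right'.congr ?_
    filter_upwards [ae_restrict_mem measurableSet_Ici] with t ht
    have ht' : (0 : ℝ) ≤ t := ht
    rw [h.duhamel_eq hα b ht', intervalIntegral.integral_of_le ht',
      ← integral_Icc_eq_integral_Ioc]
    have : ∀ s, K (t, s) = (Iic t).indicator (fun s => S (max (α * (t - s)) 0) (b s)) s :=
      fun s => by simp only [K, indicator_apply, mem_ofPred_eq, mem_Iic]
    simp_rw [this]
    unfold timeMeasure
    rw [integral_indicator measurableSet_Iic, Measure.restrict_restrict measurableSet_Iic,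
      inter_comm, Ici_inter_Iic]
  · intro T
    obtain ⟨C', hC'⟩ := hb.bound T
    refine ⟨C * max C' 0 * |T|, ?_⟩
    filter_upwards [ae_restrict_mem measurableSet_Ici] with t ht htT
    have ht' : (0 : ℝ) ≤ t := ht
    have hle : ‖duhamel S α b t‖ ≤ (C * max C' 0) * |t - 0| := by
      refine intervalIntegral.norm_integral_le_of_norm_le_const_ae ?_
      have := ae_restrict_Ioc_of_ae_timeMeasure hC' t
      rw [ae_restrict_iff' measurableSet_Ioc] at this
      filter_upwards [this] with s hs hst
      rw [uIoc_of_le ht'] at hst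
      refine (hS _ (mul_nonneg hα (sub_nonneg.2 hst.2)) _).trans ?_
      exact mul_le_mul_of_nonneg_left
        (((hs hst).1 (hst.2.trans htT)).trans (le_max_left _ _)) hC
    refine hle.trans (mul_le_mul_of_nonneg_left ?_ (mul_nonneg hC (le_max_right _ _)))
    rw [sub_zero, abs_of_nonneg ht']
    exact htT.trans (le_abs_self T)

/-- The mild form of `α J⁻¹ ∫₀ᵗ u = ∫₀ᵗ b - u(t)` for the Duhamel integral `u` of `b`. -/
theorem smul_integral_duhamel {α : ℝ} (hα : 0 ≤ α) {b : ℝ → X} (hb : IsLocBdd b) {t : ℝ}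
    (ht : 0 ≤ t) :
    α • ∫ s in (0 : ℝ)..t, duhamel S α b s = J ((∫ s in (0 : ℝ)..t, b s) - duhamel S α b t) := by
  obtain ⟨C, hC, hS⟩ := h.bounded
  obtain ⟨C', hC'⟩ := hb.bound t
  have h1 : ∫ s in (0 : ℝ)..t, duhamel S α b s
      = ∫ s in (0 : ℝ)..t, ∫ r in (0 : ℝ)..s, S (max (α * (s - r)) 0) (b r) :=
    intervalIntegral.integral_congr fun s hs => by
      rw [uIcc_of_le ht] at hs
      exact h.duhamel_eq hα b hs.1
  rw [h1, integral_triangle_swap (C := C * C') (K := fun s r => S (max (α * (s - r)) 0) (b r))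
    (h.aestronglyMeasurable_kernel (k := fun p => α * (p.1 - p.2)) (by fun_prop)
      hb.meas.comp_snd) ht
    (by filter_upwards [hC'] with r hr s hrs hst
        exact (hS _ (le_max_right _ _) _).trans
          (mul_le_mul_of_nonneg_left (hr (hrs.trans hst)) hC)),
    ← intervalIntegral.integral_smul, map_sub, duhamel,
    ← ContinuousLinearMap.intervalIntegral_comp_comm _ (hb.intervalIntegrable le_rfl ht),
    ← ContinuousLinearMap.intervalIntegral_comp_comm _ (h.intervalIntegrable_kernel hα hb ht),
    ← intervalIntegral.integral_sub ((hb.clm J).intervalIntegrable le_rfl ht)]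
  · refine intervalIntegral.integral_congr fun r hr => ?_
    rw [uIcc_of_le ht] at hr
    have hrt : 0 ≤ t - r := sub_nonneg.2 hr.2
    rw [intervalIntegral.integral_comp_sub_right (fun s => S (max (α * s) 0) (b r)) r, sub_self,
      ← h.comm _ (mul_nonneg hα hrt), ← h.smul_integral hα hrt]
    congr 1
    refine intervalIntegral.integral_congr fun s hs => ?_
    rw [uIcc_of_le hrt] at hs
    simp only [max_eq_left (mul_nonneg hα hs.1)]
  · have := h.intervalIntegrable_kernel hα (hb.clm J) ht
    refine this.congr fun s hs => ?_
    rw [uIoc_of_le ht] at hs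
    exact h.comm _ (mul_nonneg hα (sub_nonneg.2 hs.2)) _

theorem smul_duhamel_integral {α : ℝ} (hα : 0 ≤ α) {b : ℝ → X} (hb : IsLocBdd b) {t : ℝ}
    (ht : 0 ≤ t) :
    α • duhamel S α (fun s => ∫ r in (0 : ℝ)..s, b r) t
      = J ((∫ s in (0 : ℝ)..t, b s) - duhamel S α b t) := by
  obtain ⟨C, hC, hS⟩ := h.bounded
  obtain ⟨C', hC'⟩ := hb.bound t
  have h1 : duhamel S α (fun s => ∫ r in (0 : ℝ)..s, b r) t
      = ∫ s in (0 : ℝ)..t, ∫ r in (0 : ℝ)..s, S (max (α * (t - s)) 0) (b r) := by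
    rw [h.duhamel_eq hα _ ht]
    refine intervalIntegral.integral_congr fun s hs => ?_
    rw [uIcc_of_le ht] at hs
    exact (ContinuousLinearMap.intervalIntegral_comp_comm _
      (hb.intervalIntegrable le_rfl hs.1)).symm
  rw [h1, integral_triangle_swap (C := C * C') (K := fun s r => S (max (α * (t - s)) 0) (b r))
    (h.aestronglyMeasurable_kernel (k := fun p => α * (t - p.1)) (by fun_prop)
      hb.meas.comp_snd) ht
    (by filter_upwards [hC'] with r hr s hrs hst
        exact (hS _ (le_max_right _ _) _).trans
          (mul_le_mul_of_nonneg_left (hr (hrs.trans hst)) hC)),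
    ← intervalIntegral.integral_smul, map_sub, duhamel,
    ← ContinuousLinearMap.intervalIntegral_comp_comm _ (hb.intervalIntegrable le_rfl ht),
    ← ContinuousLinearMap.intervalIntegral_comp_comm _ (h.intervalIntegrable_kernel hα hb ht),
    ← intervalIntegral.integral_sub ((hb.clm J).intervalIntegrable le_rfl ht)]
  · refine intervalIntegral.integral_congr fun r hr => ?_
    rw [uIcc_of_le ht] at hr
    have hrt : 0 ≤ t - r := sub_nonneg.2 hr.2
    rw [intervalIntegral.integral_comp_sub_left (fun s => S (max (α * s) 0) (b r)) t, sub_self,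
      ← h.comm _ (mul_nonneg hα hrt), ← h.smul_integral hα hrt]
    congr 1
    refine intervalIntegral.integral_congr fun s hs => ?_
    rw [uIcc_of_le hrt] at hs
    simp only [max_eq_left (mul_nonneg hα hs.1)]
  · have := h.intervalIntegrable_kernel hα (hb.clm J) ht
    refine this.congr fun s hs => ?_
    rw [uIoc_of_le ht] at hs
    exact h.comm _ (mul_nonneg hα (sub_nonneg.2 hs.2)) _

theorem isLocBdd_orbit {α : ℝ} (hα : 0 ≤ α) (x : X) : IsLocBdd fun t => S (α * t) x :=
  .of_continuousOn ((h.semigroup.continuousOn x).comp (by fun_prop) fun t ht => mul_nonneg hα ht)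

/-- Duhamel's formula: a solution `u = u₀ + ∫ c` satisfies the mild form of `u' + α J⁻¹ u = b` with
`b = c + α J⁻¹ u`. -/
theorem eq_duhamel {α : ℝ} (hα : 0 ≤ α) {c y : ℝ → X} (hc : IsLocBdd c) (hy : IsLocBdd y) {x : X}
    (hsol : ∀ t, 0 ≤ t → J (y t) = x + ∫ s in (0 : ℝ)..t, c s)
    (hinj : Function.Injective J) {t : ℝ} (ht : 0 ≤ t) :
    J (y t) = S (α * t) x + duhamel S α (fun s => c s + α • y s) t := by
  have hky := h.intervalIntegrable_kernel hα hy ht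
  have hky' : IntervalIntegrable (fun s => α • S (α * (t - s)) (y s)) volume 0 t := hky.smul α
  have h1 : duhamel S α (fun s => c s + α • y s) t
      = duhamel S α c t + α • duhamel S α y t := by
    simp only [duhamel, map_add, map_smul]
    rw [intervalIntegral.integral_add (h.intervalIntegrable_kernel hα hc ht) hky',
      intervalIntegral.integral_smul]
  have h2 : J (duhamel S α y t)
      = ∫ s in (0 : ℝ)..t, (S (α * (t - s)) x + S (α * (t - s)) (∫ r in (0 : ℝ)..s, c r)) := by
    rw [duhamel, ← ContinuousLinearMap.intervalIntegral_comp_comm _ hky]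
    refine intervalIntegral.integral_congr fun s hs => ?_
    rw [uIcc_of_le ht] at hs
    rw [← h.comm _ (mul_nonneg hα (sub_nonneg.2 hs.2)), hsol s hs.1, map_add]
  have h3 : α • ∫ s in (0 : ℝ)..t, S (α * (t - s)) x = J x - S (α * t) (J x) := by
    rw [intervalIntegral.integral_comp_sub_left (fun s => S (α * s) x) t, sub_self, sub_zero,
      h.smul_integral hα ht]
  refine hinj ?_
  rw [h1, map_add, map_add, map_smul, h2, intervalIntegral.integral_add
    (h.intervalIntegrable_kernel hα (.const x) ht)
    (h.intervalIntegrable_kernel hα (.of_continuousOn hc.continuousOn_integral) ht), smul_add, h3]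
  have h4 := h.smul_duhamel_integral hα hc ht
  rw [duhamel] at h4
  rw [h4, hsol t ht, h.comm _ (mul_nonneg hα ht), map_sub, map_add]
  abel

variable [IsOrderedAddMonoid X] [IsOrderedModule ℝ X] [OrderClosedTopology X]

theorem duhamel_nonneg {α : ℝ} (hα : 0 ≤ α) {b : ℝ → X} {t : ℝ} (ht : 0 ≤ t)
    (h0 : ∀ᵐ s ∂timeMeasure, 0 ≤ b s) : 0 ≤ duhamel S α b t :=
  integral_nonneg_of_ae_timeMeasure ht (by
    filter_upwards [h0] with s hs hst
    exact h.nonneg _ (mul_nonneg hα (sub_nonneg.2 hst)) _ hs)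

theorem duhamel_mono {α : ℝ} (hα : 0 ≤ α) {b c : ℝ → X} (hb : IsLocBdd b) (hc : IsLocBdd c)
    {t : ℝ} (ht : 0 ≤ t) (hbc : ∀ᵐ s ∂timeMeasure, b s ≤ c s) :
    duhamel S α b t ≤ duhamel S α c t :=
  integral_mono_of_ae_timeMeasure ht (h.intervalIntegrable_kernel hα hb ht)
    (h.intervalIntegrable_kernel hα hc ht) (by
      filter_upwards [hbc] with s hs hst
      have := h.nonneg _ (mul_nonneg hα (sub_nonneg.2 hst)) _ (sub_nonneg.2 hs)
      rwa [map_sub, sub_nonneg] at this)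

end IsDampingPair

end Duhamel

end OrderedEvolution

/-! ### The reduced problem -/

namespace OrderedEvolution

section RealFunctions

/-- A convex function has increasing increments. -/
theorem ConvexOn.increment_le {a : ℝ → ℝ} (ha : ConvexOn ℝ (Ici 0) a) (hmono : MonotoneOn a (Ici 0))
    {x x' d d' : ℝ} (hx : 0 ≤ x) (hxx' : x ≤ x') (hd : 0 ≤ d) (hdd' : d ≤ d') :
    a (x + d) - a x ≤ a (x' + d') - a x' := by
  have h1 : a (x' + d) ≤ a (x' + d') :=
    hmono (mem_Ici.2 (by linarith)) (mem_Ici.2 (by linarith)) (by linarith)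
  suffices a (x + d) + a x' ≤ a x + a (x' + d) by linarith
  rcases hd.eq_or_lt with rfl | hd
  · simp
  have hl : 0 < x' + d - x := by linarith
  have e1 : d / (x' + d - x) + (x' - x) / (x' + d - x) = 1 := by field_simp; ring
  have e2 : (x' - x) / (x' + d - x) + d / (x' + d - x) = 1 := by field_simp; ring
  have p1 : 0 ≤ d / (x' + d - x) := by positivity
  have p2 : 0 ≤ (x' - x) / (x' + d - x) := div_nonneg (by linarith) hl.le
  have hx1 : x ∈ Ici (0 : ℝ) := hx
  have hx2 : x' + d ∈ Ici (0 : ℝ) := mem_Ici.2 (by linarith)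
  have h2 := ha.2 hx1 hx2 p1 p2 e1
  have h3 := ha.2 hx1 hx2 p2 p1 e2
  simp only [smul_eq_mul] at h2 h3
  have q1 : d / (x' + d - x) * x + (x' - x) / (x' + d - x) * (x' + d) = x' := by field_simp; ring
  have q2 : (x' - x) / (x' + d - x) * x + d / (x' + d - x) * (x' + d) = x + d := by
    field_simp; ring
  rw [q1] at h2
  rw [q2] at h3
  have h4 : (d / (x' + d - x) + (x' - x) / (x' + d - x)) * (a x + a (x' + d))
      = a x + a (x' + d) := by rw [e1, one_mul]
  nlinarith [h2, h3, h4]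

/-- A convex nondecreasing function on `[0, ∞)` is Lipschitz continuous on `[0, N]`, its slopes being
bounded by the slope between `N` and `N + 1`. -/
theorem ConvexOn.sub_le_mul {a : ℝ → ℝ} (ha : ConvexOn ℝ (Ici 0) a) {N x y : ℝ} (hx : 0 ≤ x)
    (hxy : x ≤ y) (hy : y ≤ N) : a y - a x ≤ (a (N + 1) - a N) * (y - x) := by
  rcases hxy.eq_or_lt with rfl | hlt
  · simp
  have h1 : (a y - a x) / (y - x) ≤ (a (N + 1) - a y) / (N + 1 - y) :=
    ha.slope_mono_adjacent (mem_Ici.2 hx) (mem_Ici.2 (by linarith)) hlt (by linarith)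
  have h2 : (a (N + 1) - a y) / (N + 1 - y) ≤ a (N + 1) - a N := by
    rcases hy.eq_or_lt with rfl | hyN
    · simp
    · have h3 := ha.slope_mono_adjacent (mem_Ici.2 (by linarith : 0 ≤ y))
        (mem_Ici.2 (by linarith : 0 ≤ N + 1)) hyN (lt_add_one N)
      rw [add_sub_cancel_left, div_one, div_le_iff₀ (by linarith)] at h3
      rw [div_le_iff₀ (by linarith)]
      nlinarith
  rw [div_le_iff₀ (by linarith)] at h1
  calc a y - a x ≤ _ := h1
    _ ≤ _ := mul_le_mul_of_nonneg_right h2 (by linarith)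

/-- Gronwall's inequality in integral form, without an inhomogeneous term. -/
theorem eq_zero_of_le_mul_integral {e : ℝ → ℝ} {K T : ℝ} (he : ContinuousOn e (Ici 0))
    (h0 : ∀ t, 0 ≤ t → 0 ≤ e t) (hle : ∀ t ∈ Icc 0 T, e t ≤ K * ∫ s in (0 : ℝ)..t, e s) :
    ∀ t ∈ Icc 0 T, e t = 0 := by
  have hint : ∀ t, 0 ≤ t → IntervalIntegrable e volume 0 t := fun t ht =>
    (he.mono fun s hs => by rw [uIcc_of_le ht] at hs; exact hs.1).intervalIntegrable
  have hnn : ∀ t, 0 ≤ t → 0 ≤ ∫ s in (0 : ℝ)..t, e s := fun t ht =>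
    intervalIntegral.integral_nonneg ht fun s hs => h0 s hs.1
  have hd : ∀ t, 0 ≤ t → HasDerivWithinAt (fun t => ∫ s in (0 : ℝ)..t, e s) (e t) (Ici t) t :=
    fun t ht => by
      have hsub : ContinuousWithinAt e (Ioi t) t :=
        (he t ht).mono fun s hs => (ht.trans (le_of_lt hs) : (0 : ℝ) ≤ s)
      refine intervalIntegral.integral_hasDerivWithinAt_right (hint t ht) (t := Ioi t) ?_ hsub
      refine ⟨Ioi t, self_mem_nhdsWithin, ?_⟩
      exact (he.mono fun s hs => (ht.trans (le_of_lt hs) : (0 : ℝ) ≤ s)).aestronglyMeasurable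
        measurableSet_Ioi
  have hz : ∀ t ∈ Icc 0 T, ∫ s in (0 : ℝ)..t, e s = 0 := by
    intro t ht
    refine eq_zero_of_abs_deriv_le_mul_abs_self_of_eq_zero_right (K := K) (a := 0) (b := T)
      (f := fun t => ∫ s in (0 : ℝ)..t, e s) (f' := e) ?_ (fun x hx => hd x hx.1) (by simp) ?_ t ht
    · intro x hx
      have := (IsLocBdd.of_continuousOn he).continuousOn_integral x hx.1
      exact this.mono fun s hs => hs.1
    · intro x hx
      rw [Real.norm_of_nonneg (h0 x hx.1), Real.norm_of_nonneg (hnn x hx.1)]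
      exact hle x ⟨hx.1, hx.2.le⟩
  intro t ht
  have := hle t ht
  rw [hz t ht, mul_zero] at this
  exact le_antisymm this (h0 t ht.1)

end RealFunctions

section Reduced

variable {X : Type*} [NormedAddCommGroup X] [NormedSpace ℝ X] [CompleteSpace X] [PartialOrder X]

/-- The properties of the gain and loss operators at a fixed time in terms of `y = Λ ^ 2 g`: for
`y ≥ 0`, `P y = Λ Q⁺(J ^ 2 y)` and `M y = Λ Q⁻(J ^ 2 y)` with `J = Λ⁻¹`, and `φ` is the functional
`x ↦ ‖Λ₁ J x‖`. -/
structure IsReducedPair (J : X →L[ℝ] X) (a ρ : ℝ → ℝ) (φ : X →L[ℝ] ℝ) (P M : X → X) : Prop where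
  gain_nonneg : ∀ y, 0 ≤ y → 0 ≤ P y
  loss_nonneg : ∀ y, 0 ≤ y → 0 ≤ M y
  gain_mono : ∀ y z, 0 ≤ y → y ≤ z → P y ≤ P z
  loss_mono : ∀ y z, 0 ≤ y → y ≤ z → M y ≤ M z
  loss_le : ∀ y, 0 ≤ y → M y ≤ a ‖J y‖ • y
  compl_mono : ∀ y z, 0 ≤ y → y ≤ z → a ‖J y‖ • y - M y ≤ a ‖J z‖ • z - M z
  diss_nonneg : ∀ y, 0 ≤ y → 0 ≤ ‖M y‖ - ‖P y‖
  diss_mono : ∀ y z, 0 ≤ y → y ≤ z → ‖M y‖ - ‖P y‖ ≤ ‖M z‖ - ‖P z‖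
  gain_closed : ∀ (u : ℕ → X) (g k : X), Monotone u → (∀ n, 0 ≤ u n) → Tendsto u atTop (𝓝 g) →
    Tendsto (fun n => P (u n)) atTop (𝓝 k) → P g = k
  loss_closed : ∀ (u : ℕ → X) (g k : X), Monotone u → (∀ n, 0 ≤ u n) → Tendsto u atTop (𝓝 g) →
    Tendsto (fun n => M (u n)) atTop (𝓝 k) → M g = k
  moment : ∀ y, 0 ≤ y → φ (P y) ≤ φ (M y)
  povzner : ∀ z, 0 ≤ z → ∃ p q, 0 ≤ p ∧ 0 ≤ q ∧ P (J z) = J p ∧ M (J z) = J q ∧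
    ‖p‖ ≤ ‖q‖ + ρ (φ (J (J z))) * ‖J z‖

/-- The evolution problem for `y = Λ ^ 2 f`, in terms of the bounded inverse `J` of `Λ`. -/
structure IsReducedProblem (S : ℝ → X →L[ℝ] X) (J : X →L[ℝ] X) (a ρ : ℝ → ℝ) (φ : X →L[ℝ] ℝ)
    (P M : ℝ → X → X) : Prop where
  space : IsAbstractStateSpace X
  pair : IsDampingPair S J
  a_nonneg : ∀ x : ℝ, 0 ≤ x → 0 ≤ a x
  a_mono : MonotoneOn a (Ici 0)
  a_convex : ConvexOn ℝ (Ici 0) a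
  rho_nonneg : ∀ x : ℝ, 0 ≤ x → 0 ≤ ρ x
  rho_mono : MonotoneOn ρ (Ici 0)
  phi_nonneg : ∀ x, 0 ≤ x → 0 ≤ φ x
  reduced : ∀ᵐ t ∂timeMeasure, IsReducedPair J a ρ φ (P t) (M t)
  gain_meas : ∀ y : ℝ → X, AEStronglyMeasurable y timeMeasure → (∀ t, 0 ≤ t → 0 ≤ y t) →
    AEStronglyMeasurable (fun t => P t (y t)) timeMeasure
  loss_meas : ∀ y : ℝ → X, AEStronglyMeasurable y timeMeasure → (∀ t, 0 ≤ t → 0 ≤ y t) →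
    AEStronglyMeasurable (fun t => M t (y t)) timeMeasure

/-- A nonnegative, locally bounded function `y` such that `x = J y` solves
`x' = P(t, y) - M(t, y)` with `x(0) = J y₀`. -/
structure IsReducedSolution (J : X →L[ℝ] X) (P M : ℝ → X → X) (y₀ : X) (y : ℝ → X) : Prop where
  nonneg : ∀ t, 0 ≤ t → 0 ≤ y t
  locBdd : IsLocBdd y
  equation : ∀ t, 0 ≤ t → J (y t) = J y₀ + ∫ s in (0 : ℝ)..t, (P s (y s) - M s (y s))

variable [IsOrderedAddMonoid X] [IsOrderedModule ℝ X] [OrderClosedTopology X]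
  {S : ℝ → X →L[ℝ] X} {J : X →L[ℝ] X} {a ρ : ℝ → ℝ} {φ : X →L[ℝ] ℝ} {P M : ℝ → X → X}

namespace IsReducedPair

variable {P M : X → X}

theorem tendsto_gain (hX : IsAbstractStateSpace X) (h : IsReducedPair J a ρ φ P M) {u : ℕ → X}
    {g : X} (hu : Monotone u) (h0 : ∀ n, 0 ≤ u n) (hg : Tendsto u atTop (𝓝 g)) :
    Tendsto (fun n => P (u n)) atTop (𝓝 (P g)) := by
  have hP0 : ∀ n, 0 ≤ P (u n) := fun n => h.gain_nonneg _ (h0 n)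
  obtain ⟨k, hk⟩ := hX.exists_tendsto_of_monotone (C := ‖P g‖)
    (fun m n hmn => h.gain_mono _ _ (h0 m) (hu hmn)) hP0
    fun n => hX.norm_le (hP0 n) (h.gain_mono _ _ (h0 n) (hu.ge_of_tendsto hg n))
  rwa [h.gain_closed u g k hu h0 hg hk]

theorem tendsto_loss (hX : IsAbstractStateSpace X) (h : IsReducedPair J a ρ φ P M) {u : ℕ → X}
    {g : X} (hu : Monotone u) (h0 : ∀ n, 0 ≤ u n) (hg : Tendsto u atTop (𝓝 g)) :
    Tendsto (fun n => M (u n)) atTop (𝓝 (M g)) := by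
  have hM0 : ∀ n, 0 ≤ M (u n) := fun n => h.loss_nonneg _ (h0 n)
  obtain ⟨k, hk⟩ := hX.exists_tendsto_of_monotone (C := ‖M g‖)
    (fun m n hmn => h.loss_mono _ _ (h0 m) (hu hmn)) hM0
    fun n => hX.norm_le (hM0 n) (h.loss_mono _ _ (h0 n) (hu.ge_of_tendsto hg n))
  rwa [h.loss_closed u g k hu h0 hg hk]

end IsReducedPair

/-- The right-hand side `P v - M v + a(‖J v‖ + d) v` of the equation with damping, at the time `s`.
If `d` is the energy dissipated up to this time, then the argument of `a` is the initial energy, so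
that the last term cancels the damping. -/
noncomputable def dampedRhs (J : X →L[ℝ] X) (a : ℝ → ℝ) (P M : ℝ → X → X) (s : ℝ) (v : X) (d : ℝ) :
    X :=
  P s v - M s v + a (‖J v‖ + d) • v

namespace IsReducedProblem

variable (h : IsReducedProblem S J a ρ φ P M)

include h

theorem norm_J_le {y z : X} (hy : 0 ≤ y) (hyz : y ≤ z) : ‖J y‖ ≤ ‖J z‖ :=
  h.space.norm_le (h.pair.J_nonneg y hy) (h.pair.J_mono hyz)

theorem dampedRhs_mono {s : ℝ} (hs : IsReducedPair J a ρ φ (P s) (M s)) {v w : X} {d e : ℝ}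
    (hv : 0 ≤ v) (hvw : v ≤ w) (hd : 0 ≤ d) (hde : d ≤ e) :
    dampedRhs J a P M s v d ≤ dampedRhs J a P M s w e := by
  have h1 : dampedRhs J a P M s v d
      = P s v + (a ‖J v‖ • v - M s v) + (a (‖J v‖ + d) - a ‖J v‖) • v := by
    rw [dampedRhs, sub_smul]; abel
  have h2 : dampedRhs J a P M s w e
      = P s w + (a ‖J w‖ • w - M s w) + (a (‖J w‖ + e) - a ‖J w‖) • w := by
    rw [dampedRhs, sub_smul]; abel
  rw [h1, h2]
  refine add_le_add (add_le_add (hs.gain_mono _ _ hv hvw) (hs.compl_mono _ _ hv hvw)) ?_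
  refine (smul_le_smul_of_nonneg_left hvw ?_).trans
    (smul_le_smul_of_nonneg_right ?_ (hv.trans hvw))
  · rw [sub_nonneg]
    exact h.a_mono (mem_Ici.2 (norm_nonneg _)) (mem_Ici.2 (by positivity)) (by linarith)
  · exact ConvexOn.increment_le h.a_convex h.a_mono (norm_nonneg _) (h.norm_J_le hv hvw) hd hde

theorem dampedRhs_nonneg {s : ℝ} (hs : IsReducedPair J a ρ φ (P s) (M s)) {v : X} {d : ℝ}
    (hv : 0 ≤ v) (hd : 0 ≤ d) : 0 ≤ dampedRhs J a P M s v d := by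
  rw [dampedRhs, sub_add_eq_add_sub, add_sub_assoc]
  refine add_nonneg (hs.gain_nonneg v hv) (sub_nonneg.2 ((hs.loss_le v hv).trans ?_))
  refine smul_le_smul_of_nonneg_right ?_ hv
  exact h.a_mono (mem_Ici.2 (norm_nonneg _)) (mem_Ici.2 (by positivity)) (by linarith)

theorem norm_loss_le {s : ℝ} (hs : IsReducedPair J a ρ φ (P s) (M s)) {v : X} (hv : 0 ≤ v) :
    ‖M s v‖ ≤ a ‖J v‖ * ‖v‖ := by
  have := h.space.norm_le (hs.loss_nonneg v hv) (hs.loss_le v hv)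
  rwa [norm_smul, Real.norm_of_nonneg (h.a_nonneg _ (norm_nonneg _))] at this

theorem isLocBdd_loss {y : ℝ → X} (hy : IsLocBdd y) (h0 : ∀ t, 0 ≤ t → 0 ≤ y t) :
    IsLocBdd fun s => M s (y s) := by
  refine ⟨h.loss_meas y hy.meas h0, fun T => ?_⟩
  obtain ⟨C, hC⟩ := hy.bound T
  refine ⟨a (‖J‖ * max C 0) * max C 0, ?_⟩
  filter_upwards [hC, h.reduced, ae_restrict_mem measurableSet_Ici] with s hs hr h0s hsT
  have hle : ‖y s‖ ≤ max C 0 := (hs hsT).trans (le_max_left _ _)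
  have hle' : ‖J (y s)‖ ≤ ‖J‖ * max C 0 :=
    (J.le_opNorm _).trans (mul_le_mul_of_nonneg_left hle (norm_nonneg _))
  have h0' : 0 ≤ ‖J‖ * max C 0 := mul_nonneg (norm_nonneg _) (le_max_right _ _)
  exact (h.norm_loss_le hr (h0 s h0s)).trans (mul_le_mul
    (h.a_mono (mem_Ici.2 (norm_nonneg _)) (mem_Ici.2 h0') hle') hle (norm_nonneg _)
    (h.a_nonneg _ h0'))

theorem isLocBdd_gain {y : ℝ → X} (hy : IsLocBdd y) (h0 : ∀ t, 0 ≤ t → 0 ≤ y t) :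
    IsLocBdd fun s => P s (y s) := by
  refine (h.isLocBdd_loss hy h0).mono (h.gain_meas y hy.meas h0) ?_
  filter_upwards [h.reduced, ae_restrict_mem measurableSet_Ici] with s hr h0s
  linarith [hr.diss_nonneg _ (h0 s h0s)]

theorem isLocBdd_diss {y : ℝ → X} (hy : IsLocBdd y) (h0 : ∀ t, 0 ≤ t → 0 ≤ y t) :
    IsLocBdd fun s => ‖M s (y s)‖ - ‖P s (y s)‖ :=
  (h.isLocBdd_loss hy h0).norm.sub (h.isLocBdd_gain hy h0).norm

end IsReducedProblem

end Reduced

end OrderedEvolution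

/-! ### The monotone scheme and its a priori bounds -/

namespace OrderedEvolution

section Scheme

variable {X : Type*} [NormedAddCommGroup X] [NormedSpace ℝ X] [CompleteSpace X] [PartialOrder X]

/-- The source of one step of the scheme: `J⁻¹` of the damped right-hand side at the smoothed
function `smoothing S J n ∘ y`. The smoothing puts the right-hand side into the range of `J`. -/
noncomputable def schemeSource (S : ℝ → X →L[ℝ] X) (J : X →L[ℝ] X) (a : ℝ → ℝ) (P M : ℝ → X → X)
    (n : ℕ) (y : ℝ → X) (D : ℝ → ℝ) (s : ℝ) : X :=
  Function.invFun J (dampedRhs J a P M s (smoothing S J n (y s)) (D s))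

/-- One step of the scheme for a pair of functions `y` and `D`, where `D` stands for the dissipated
energy. The new function is the mild solution of `z' + α J⁻¹ z = schemeSource S J a P M n y D`,
`z(0) = y₀`, with the damping constant `α = a ‖J y₀‖`. -/
noncomputable def schemeStep (S : ℝ → X →L[ℝ] X) (J : X →L[ℝ] X) (a : ℝ → ℝ) (P M : ℝ → X → X)
    (y₀ : X) (n : ℕ) (st : (ℝ → X) × (ℝ → ℝ)) : (ℝ → X) × (ℝ → ℝ) :=
  (fun t => S (a ‖J y₀‖ * t) y₀ + duhamel S (a ‖J y₀‖) (schemeSource S J a P M n st.1 st.2) t,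
    fun t => ∫ s in (0 : ℝ)..t,
      (‖M s (smoothing S J n (st.1 s))‖ - ‖P s (smoothing S J n (st.1 s))‖))

/-- The increasing sequence of approximate solutions, with their dissipated energies. -/
noncomputable def scheme (S : ℝ → X →L[ℝ] X) (J : X →L[ℝ] X) (a : ℝ → ℝ) (P M : ℝ → X → X)
    (y₀ : X) : ℕ → (ℝ → X) × (ℝ → ℝ)
  | 0 => (fun _ => 0, fun _ => 0)
  | n + 1 => schemeStep S J a P M y₀ n (scheme S J a P M y₀ n)

/-- The a priori bounds which are propagated by the scheme. -/
structure IsAdmissible (J : X →L[ℝ] X) (ρ : ℝ → ℝ) (φ : X →L[ℝ] ℝ) (y₀ : X) (y : ℝ → X)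
    (D : ℝ → ℝ) : Prop where
  nonneg : ∀ t, 0 ≤ t → 0 ≤ y t
  meas : AEStronglyMeasurable y timeMeasure
  D_nonneg : ∀ t, 0 ≤ t → 0 ≤ D t
  D_meas : AEStronglyMeasurable D timeMeasure
  energy : ∀ t, 0 ≤ t → ‖J (y t)‖ + D t ≤ ‖J y₀‖
  moment : ∀ t, 0 ≤ t → φ (J (y t)) ≤ φ (J y₀)
  growth : ∀ t, 0 ≤ t → ‖y t‖ ≤ ‖y₀‖ * Real.exp (ρ (φ (J y₀)) * t)

variable [IsOrderedAddMonoid X] [IsOrderedModule ℝ X] [OrderClosedTopology X]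
  {S : ℝ → X →L[ℝ] X} {J : X →L[ℝ] X} {a ρ : ℝ → ℝ} {φ : X →L[ℝ] ℝ} {P M : ℝ → X → X}
  {y₀ : X} {y z : ℝ → X} {D E : ℝ → ℝ}

namespace IsReducedProblem

variable (h : IsReducedProblem S J a ρ φ P M)

include h

theorem phi_mono {x x' : X} (hx : x ≤ x') : φ x ≤ φ x' := by
  have := h.phi_nonneg _ (sub_nonneg.2 hx)
  rwa [map_sub, sub_nonneg] at this

theorem isLocBdd_of_admissible (hA : IsAdmissible J ρ φ y₀ y D) (hy₀ : 0 ≤ y₀) : IsLocBdd y := by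
  refine .of_bound hA.meas (fun T => ‖y₀‖ * Real.exp (ρ (φ (J y₀)) * T)) fun T s hs hsT =>
    (hA.growth s hs).trans ?_
  have : 0 ≤ ρ (φ (J y₀)) := h.rho_nonneg _ (h.phi_nonneg _ (h.pair.J_nonneg _ hy₀))
  gcongr

/-- The facts on the source that are used in the estimates: it is the difference of the preimages `p`
and `q` of gain and loss plus a multiple of `diffQuot S n y`, which is dominated by the damping. -/
theorem schemeSource_spec (hA : IsAdmissible J ρ φ y₀ y D) (n : ℕ) {s : ℝ} (hs0 : 0 ≤ s)
    (hs : IsReducedPair J a ρ φ (P s) (M s)) :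
    ∃ (p q : X) (c : ℝ), 0 ≤ p ∧ 0 ≤ q ∧ 0 ≤ c ∧ c ≤ a ‖J y₀‖ ∧
      P s (smoothing S J n (y s)) = J p ∧ M s (smoothing S J n (y s)) = J q ∧
      schemeSource S J a P M n y D s = p - q + c • diffQuot S n (y s) ∧
      ‖p‖ ≤ ‖q‖ + ρ (φ (J y₀)) * ‖y s‖ ∧ ‖q‖ ≤ a ‖J y₀‖ * ‖diffQuot S n (y s)‖ ∧
      0 ≤ schemeSource S J a P M n y D s ∧
      J (schemeSource S J a P M n y D s)
        = dampedRhs J a P M s (smoothing S J n (y s)) (D s) := by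
  have hy := hA.nonneg s hs0
  have hz : 0 ≤ diffQuot S n (y s) := h.pair.diffQuot_nonneg n hy
  have hv : 0 ≤ smoothing S J n (y s) := h.pair.smoothing_nonneg n hy
  have hvy : smoothing S J n (y s) ≤ y s := h.pair.smoothing_le n hy
  obtain ⟨p, q, hp, hq, hPp, hMq, hpq⟩ := hs.povzner _ hz
  rw [← h.pair.smoothing_eq] at hPp hMq hpq
  have hN : ‖J (smoothing S J n (y s))‖ + D s ≤ ‖J y₀‖ :=
    (add_le_add_left (h.norm_J_le hv hvy) _).trans (hA.energy s hs0)
  have hD := hA.D_nonneg s hs0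
  have hc0 : 0 ≤ a (‖J (smoothing S J n (y s))‖ + D s) := h.a_nonneg _ (by positivity)
  have hc : a (‖J (smoothing S J n (y s))‖ + D s) ≤ a ‖J y₀‖ :=
    h.a_mono (mem_Ici.2 (by positivity)) (mem_Ici.2 (norm_nonneg _)) hN
  have hJ : J (p - q + a (‖J (smoothing S J n (y s))‖ + D s) • diffQuot S n (y s))
      = dampedRhs J a P M s (smoothing S J n (y s)) (D s) := by
    rw [dampedRhs, map_add, map_sub, map_smul, hPp, hMq, h.pair.smoothing_eq]
  have hsrc : schemeSource S J a P M n y D s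
      = p - q + a (‖J (smoothing S J n (y s))‖ + D s) • diffQuot S n (y s) := by
    rw [schemeSource, ← hJ, Function.leftInverse_invFun h.pair.injective]
  refine ⟨p, q, _, hp, hq, hc0, hc, hPp, hMq, hsrc, hpq.trans ?_, ?_, ?_, by rw [hsrc, hJ]⟩
  · have h1 : φ (J (smoothing S J n (y s))) ≤ φ (J y₀) :=
      (h.phi_mono (h.pair.J_mono hvy)).trans (hA.moment s hs0)
    have h0 : 0 ≤ φ (J (smoothing S J n (y s))) := h.phi_nonneg _ (h.pair.J_nonneg _ hv)
    have h2 := h.rho_mono (mem_Ici.2 h0) (mem_Ici.2 (h0.trans h1)) h1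
    have h3 := h.space.norm_le hv hvy
    have h4 := h.rho_nonneg _ h0
    gcongr
    exact h4.trans h2
  · have h1 : J q ≤ a ‖J (smoothing S J n (y s))‖ • smoothing S J n (y s) := by
      rw [← hMq]; exact hs.loss_le _ hv
    rw [h.pair.smoothing_eq n (y s), ← map_smul] at h1
    have h2 := h.space.norm_le hq (h.pair.le_of_J h1)
    rw [← h.pair.smoothing_eq n (y s), norm_smul,
      Real.norm_of_nonneg (h.a_nonneg _ (norm_nonneg _))] at h2
    refine h2.trans (mul_le_mul_of_nonneg_right ?_ (norm_nonneg _))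
    exact h.a_mono (mem_Ici.2 (norm_nonneg _)) (mem_Ici.2 (norm_nonneg _)) (by linarith)
  · refine h.pair.nonneg_of_J _ ?_
    rw [hsrc, hJ]
    exact h.dampedRhs_nonneg hs hv hD

theorem isLocBdd_smoothing (hA : IsAdmissible J ρ φ y₀ y D) (hy₀ : 0 ≤ y₀) (n : ℕ) :
    IsLocBdd fun s => smoothing S J n (y s) :=
  (h.isLocBdd_of_admissible hA hy₀).clm _

theorem smoothing_nonneg (hA : IsAdmissible J ρ φ y₀ y D) (n : ℕ) (t : ℝ) (ht : 0 ≤ t) :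
    0 ≤ smoothing S J n (y t) :=
  h.pair.smoothing_nonneg n (hA.nonneg t ht)

theorem isLocBdd_coefficient (hA : IsAdmissible J ρ φ y₀ y D) {v : ℝ → X} (hv : IsLocBdd v)
    (hv0 : ∀ t, 0 ≤ t → 0 ≤ v t) (hvy : ∀ t, 0 ≤ t → v t ≤ y t) :
    IsLocBdd fun s => a (‖J (v s)‖ + D s) := by
  have hN : ∀ s, 0 ≤ s → ‖J (v s)‖ + D s ≤ ‖J y₀‖ := fun s hs =>
    (add_le_add_left (h.norm_J_le (hv0 s hs) (hvy s hs)) _).trans (hA.energy s hs)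
  -- `a` is only monotone on `[0, ∞)`; it is composed with `max · 0` to obtain a Borel function
  have hmono : Monotone fun x : ℝ => a (max x 0) := fun x x' hx =>
    h.a_mono (mem_Ici.2 (le_max_right _ _)) (mem_Ici.2 (le_max_right _ _)) (max_le_max_right _ hx)
  refine .of_bound ?_ (fun _ => a ‖J y₀‖) fun T s hs _ => ?_
  · have h1 : AEMeasurable (fun s => ‖J (v s)‖ + D s) timeMeasure :=
      ((hv.clm J).norm.meas.add hA.D_meas).aemeasurable
    refine (hmono.measurable.comp_aemeasurable h1).aestronglyMeasurable.congr ?_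
    filter_upwards [ae_restrict_mem measurableSet_Ici] with s hs
    have := hA.D_nonneg s hs
    simp only [Function.comp_apply]
    rw [max_eq_left (by positivity)]
  · have hD := hA.D_nonneg s hs
    have h0 : 0 ≤ ‖J (v s)‖ + D s := by positivity
    rw [Real.norm_of_nonneg (h.a_nonneg _ h0)]
    exact h.a_mono (mem_Ici.2 h0) (mem_Ici.2 (norm_nonneg _)) (hN s hs)

theorem isLocBdd_dampedRhs (hA : IsAdmissible J ρ φ y₀ y D) {v : ℝ → X} (hv : IsLocBdd v)
    (hv0 : ∀ t, 0 ≤ t → 0 ≤ v t) (hvy : ∀ t, 0 ≤ t → v t ≤ y t) :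
    IsLocBdd fun s => dampedRhs J a P M s (v s) (D s) :=
  ((h.isLocBdd_gain hv hv0).sub (h.isLocBdd_loss hv hv0)).add
    ((h.isLocBdd_coefficient hA hv hv0 hvy).smul hv)

theorem isLocBdd_schemeSource (hA : IsAdmissible J ρ φ y₀ y D) (hy₀ : 0 ≤ y₀) (n : ℕ) :
    IsLocBdd (schemeSource S J a P M n y D) := by
  have hy := h.isLocBdd_of_admissible hA hy₀
  have hd := h.isLocBdd_dampedRhs hA (h.isLocBdd_smoothing hA hy₀ n) (h.smoothing_nonneg hA n)
    fun t ht => h.pair.smoothing_le n (hA.nonneg t ht)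
  have h1 : AEStronglyMeasurable (fun s => J (schemeSource S J a P M n y D s)) timeMeasure := by
    refine hd.meas.congr ?_
    filter_upwards [h.reduced, ae_restrict_mem measurableSet_Ici] with s hs hs0
    obtain ⟨p, q, c, -, -, -, -, -, -, -, -, -, -, hJ⟩ := h.schemeSource_spec hA n hs0 hs
    exact hJ.symm
  have hb : IsLocBdd fun s => (3 * a ‖J y₀‖) * ‖diffQuot S n (y s)‖ + ρ (φ (J y₀)) * ‖y s‖ :=
    ((IsLocBdd.const _).smul (hy.clm (diffQuot S n)).norm).add ((IsLocBdd.const _).smul hy.norm)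
  refine hb.mono (h.pair.aestronglyMeasurable_of_J h1) ?_
  filter_upwards [h.reduced, ae_restrict_mem measurableSet_Ici] with s hs hs0
  obtain ⟨p, q, c, -, -, hc0, hc, -, -, hsrc, hp, hq, -, -⟩ := h.schemeSource_spec hA n hs0 hs
  refine le_trans ?_ (le_abs_self _)
  rw [hsrc]
  have h2 : ‖c • diffQuot S n (y s)‖ ≤ a ‖J y₀‖ * ‖diffQuot S n (y s)‖ := by
    rw [norm_smul, Real.norm_of_nonneg hc0]
    exact mul_le_mul_of_nonneg_right hc (norm_nonneg _)
  have h3 := norm_add_le (p - q) (c • diffQuot S n (y s))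
  have h4 := norm_sub_le p q
  linarith

theorem schemeSource_nonneg (hA : IsAdmissible J ρ φ y₀ y D) (n : ℕ) :
    ∀ᵐ s ∂timeMeasure, 0 ≤ schemeSource S J a P M n y D s := by
  filter_upwards [h.reduced, ae_restrict_mem measurableSet_Ici] with s hs hs0
  obtain ⟨p, q, c, -, -, -, -, -, -, -, -, -, h0, -⟩ := h.schemeSource_spec hA n hs0 hs
  exact h0

theorem schemeStep_nonneg (hA : IsAdmissible J ρ φ y₀ y D) (hy₀ : 0 ≤ y₀) (n : ℕ) {t : ℝ}
    (ht : 0 ≤ t) : 0 ≤ (schemeStep S J a P M y₀ n (y, D)).1 t := by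
  have hα := h.a_nonneg _ (norm_nonneg (J y₀))
  exact add_nonneg (h.pair.nonneg _ (mul_nonneg hα ht) _ hy₀)
    (h.pair.duhamel_nonneg hα ht (h.schemeSource_nonneg hA n))

theorem isLocBdd_schemeStep (hA : IsAdmissible J ρ φ y₀ y D) (hy₀ : 0 ≤ y₀) (n : ℕ) :
    IsLocBdd (schemeStep S J a P M y₀ n (y, D)).1 :=
  have hα := h.a_nonneg _ (norm_nonneg (J y₀))
  (h.pair.isLocBdd_orbit hα y₀).add (h.pair.isLocBdd_duhamel hα (h.isLocBdd_schemeSource hA hy₀ n))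

/-- The mild form of `z' + α J⁻¹ z = b` for the result `z` of a step with source `b`. -/
theorem smul_integral_schemeStep (hA : IsAdmissible J ρ φ y₀ y D) (hy₀ : 0 ≤ y₀) (n : ℕ) {t : ℝ}
    (ht : 0 ≤ t) :
    a ‖J y₀‖ • ∫ s in (0 : ℝ)..t, (schemeStep S J a P M y₀ n (y, D)).1 s
      = J (y₀ + (∫ s in (0 : ℝ)..t, schemeSource S J a P M n y D s)
          - (schemeStep S J a P M y₀ n (y, D)).1 t) := by
  have hα := h.a_nonneg _ (norm_nonneg (J y₀))
  have hb := h.isLocBdd_schemeSource hA hy₀ n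
  simp only [schemeStep]
  rw [intervalIntegral.integral_add
    ((h.pair.isLocBdd_orbit hα y₀).intervalIntegrable le_rfl ht)
    ((h.pair.isLocBdd_duhamel hα hb).intervalIntegrable le_rfl ht), smul_add,
    h.pair.smul_integral hα ht, h.pair.smul_integral_duhamel hα hb ht,
    h.pair.comm _ (mul_nonneg hα ht)]
  simp only [map_sub, map_add]
  abel

/-- The basic estimate for a step which does not decrease the function: for the result `z` of the
step, the element `w = α J⁻¹ ∫₀ᵗ z` is bounded below by
`smoothing S J n w = α ∫₀ᵗ diffQuot S n z ≥ α ∫₀ᵗ diffQuot S n y`. -/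
theorem functional_schemeStep_le (hA : IsAdmissible J ρ φ y₀ y D) (hy₀ : 0 ≤ y₀) (n : ℕ)
    (hle : ∀ t, 0 ≤ t → y t ≤ (schemeStep S J a P M y₀ n (y, D)).1 t) {χ : X →L[ℝ] ℝ}
    (hχ : ∀ x, 0 ≤ x → 0 ≤ χ x) {g : ℝ → ℝ} (hg : IsLocBdd g)
    (hgle : ∀ᵐ s ∂timeMeasure, χ (schemeSource S J a P M n y D s)
      - a ‖J y₀‖ * χ (diffQuot S n (y s)) ≤ g s) {t : ℝ} (ht : 0 ≤ t) :
    χ ((schemeStep S J a P M y₀ n (y, D)).1 t) ≤ χ y₀ + ∫ s in (0 : ℝ)..t, g s := by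
  have hα := h.a_nonneg _ (norm_nonneg (J y₀))
  have hy := h.isLocBdd_of_admissible hA hy₀
  have hb := h.isLocBdd_schemeSource hA hy₀ n
  set z := (schemeStep S J a P M y₀ n (y, D)).1 with hz
  have hzb : IsLocBdd z := h.isLocBdd_schemeStep hA hy₀ n
  have hχmono : ∀ x x', x ≤ x' → χ x ≤ χ x' := fun x x' hx => by
    have := hχ _ (sub_nonneg.2 hx)
    rwa [map_sub, sub_nonneg] at this
  set w := y₀ + (∫ s in (0 : ℝ)..t, schemeSource S J a P M n y D s) - z t with hw
  have hJw : a ‖J y₀‖ • ∫ s in (0 : ℝ)..t, z s = J w := h.smul_integral_schemeStep hA hy₀ n ht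
  have hz0 : ∀ᵐ s ∂timeMeasure, s ≤ t → 0 ≤ z s := by
    filter_upwards [ae_restrict_mem measurableSet_Ici] with s hs _
    exact h.schemeStep_nonneg hA hy₀ n hs
  have hw0 : 0 ≤ w := by
    refine h.pair.nonneg_of_J _ ?_
    rw [← hJw]
    exact smul_nonneg hα (integral_nonneg_of_ae_timeMeasure ht hz0)
  have h1 : a ‖J y₀‖ • ∫ s in (0 : ℝ)..t, diffQuot S n (y s) ≤ w := by
    refine le_trans ?_ (h.pair.smoothing_le n hw0)
    rw [smoothing_apply, ← hJw, map_smul, ← ContinuousLinearMap.intervalIntegral_comp_comm _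
      (hzb.intervalIntegrable le_rfl ht)]
    refine smul_le_smul_of_nonneg_left (integral_mono_of_ae_timeMeasure ht
      ((hy.clm _).intervalIntegrable le_rfl ht) ((hzb.clm _).intervalIntegrable le_rfl ht) ?_) hα
    filter_upwards [ae_restrict_mem measurableSet_Ici] with s hs _
    exact h.pair.diffQuot_le n (hle s hs)
  have h2 := hχmono _ _ h1
  rw [map_smul, smul_eq_mul, ← ContinuousLinearMap.intervalIntegral_comp_comm _
    ((hy.clm _).intervalIntegrable le_rfl ht), ← intervalIntegral.integral_const_mul] at h2
  have h3 : z t = y₀ + (∫ s in (0 : ℝ)..t, schemeSource S J a P M n y D s) - w := by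
    rw [hw]; abel
  have hi1 : IsLocBdd fun s => χ (schemeSource S J a P M n y D s) := hb.clm χ
  have hi2 : IsLocBdd fun s => a ‖J y₀‖ * χ (diffQuot S n (y s)) :=
    (IsLocBdd.const _).smul ((hy.clm (diffQuot S n)).clm χ)
  have h4 := integral_mono_of_ae_timeMeasure ht
    ((hi1.sub hi2).intervalIntegrable le_rfl ht) (hg.intervalIntegrable le_rfl ht)
    (hgle.mono fun s hs _ => hs)
  rw [intervalIntegral.integral_sub (hi1.intervalIntegrable le_rfl ht)
    (hi2.intervalIntegrable le_rfl ht)] at h4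
  rw [h3, map_sub, map_add, ← ContinuousLinearMap.intervalIntegral_comp_comm _
    (hb.intervalIntegrable le_rfl ht)]
  linarith

/-- A step which does not decrease the function preserves the a priori bounds. The three bounds are
`functional_schemeStep_le` for the functionals `x ↦ ‖J x‖`, `φ ∘ J` and the norm on the cone. -/
theorem isAdmissible_schemeStep (hA : IsAdmissible J ρ φ y₀ y D) (hy₀ : 0 ≤ y₀) (n : ℕ)
    (hle : ∀ t, 0 ≤ t → y t ≤ (schemeStep S J a P M y₀ n (y, D)).1 t) :
    IsAdmissible J ρ φ y₀ (schemeStep S J a P M y₀ n (y, D)).1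
      (schemeStep S J a P M y₀ n (y, D)).2 := by
  obtain ⟨ψ, hψ⟩ := h.space.exists_normFunctional
  have hα := h.a_nonneg _ (norm_nonneg (J y₀))
  have hy := h.isLocBdd_of_admissible hA hy₀
  have hv := h.isLocBdd_smoothing hA hy₀ n
  have hdiss := h.isLocBdd_diss hv (h.smoothing_nonneg hA n)
  have hr0 : 0 ≤ φ (J y₀) := h.phi_nonneg _ (h.pair.J_nonneg _ hy₀)
  refine ⟨fun t ht => h.schemeStep_nonneg hA hy₀ n ht, (h.isLocBdd_schemeStep hA hy₀ n).meas,
    fun t ht => ?_, ?_, fun t ht => ?_, fun t ht => ?_, fun t ht => ?_⟩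
  · refine integral_nonneg_of_ae_timeMeasure ht ?_
    filter_upwards [h.reduced, ae_restrict_mem measurableSet_Ici] with s hs hs0 _
    exact hs.diss_nonneg _ (h.smoothing_nonneg hA n s hs0)
  · exact (IsLocBdd.of_continuousOn hdiss.continuousOn_integral).meas
  · have key := h.functional_schemeStep_le hA hy₀ n hle (χ := ψ.comp J)
      (g := fun s => -(‖M s (smoothing S J n (y s))‖ - ‖P s (smoothing S J n (y s))‖))
      (fun x hx => by
        rw [ContinuousLinearMap.comp_apply, hψ _ (h.pair.J_nonneg _ hx)]; exact norm_nonneg _)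
      (by simpa using (IsLocBdd.const (0 : ℝ)).sub hdiss) ?_ ht
    · rw [ContinuousLinearMap.comp_apply, ContinuousLinearMap.comp_apply,
        hψ _ (h.pair.J_nonneg _ hy₀), hψ _ (h.pair.J_nonneg _ (h.schemeStep_nonneg hA hy₀ n ht)),
        intervalIntegral.integral_neg] at key
      change _ + ∫ s in (0 : ℝ)..t,
        (‖M s (smoothing S J n (y s))‖ - ‖P s (smoothing S J n (y s))‖) ≤ _
      linarith
    · filter_upwards [h.reduced, ae_restrict_mem measurableSet_Ici] with s hs hs0
      obtain ⟨p, q, c, hp, hq, hc0, hc, hPp, hMq, hsrc, -⟩ := h.schemeSource_spec hA n hs0 hs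
      rw [hsrc, hPp, hMq]
      simp only [ContinuousLinearMap.comp_apply, map_add, map_sub, map_smul, smul_eq_mul]
      rw [hψ _ (h.pair.J_nonneg _ hp), hψ _ (h.pair.J_nonneg _ hq),
        hψ _ (h.pair.J_nonneg _ (h.pair.diffQuot_nonneg n (hA.nonneg s hs0)))]
      have := mul_le_mul_of_nonneg_right hc (norm_nonneg (J (diffQuot S n (y s))))
      linarith
  · have key := h.functional_schemeStep_le hA hy₀ n hle (χ := φ.comp J) (g := fun _ => 0)
      (fun x hx => h.phi_nonneg _ (h.pair.J_nonneg _ hx)) (.const 0) ?_ ht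
    · simpa using key
    · filter_upwards [h.reduced, ae_restrict_mem measurableSet_Ici] with s hs hs0
      obtain ⟨p, q, c, hp, hq, hc0, hc, hPp, hMq, hsrc, -⟩ := h.schemeSource_spec hA n hs0 hs
      have hm := hs.moment _ (h.smoothing_nonneg hA n s hs0)
      rw [hPp, hMq] at hm
      rw [hsrc]
      simp only [ContinuousLinearMap.comp_apply, map_add, map_sub, map_smul, smul_eq_mul]
      have := mul_le_mul_of_nonneg_right hc (h.phi_nonneg _ (h.pair.J_nonneg _
        (h.pair.diffQuot_nonneg n (hA.nonneg s hs0))))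
      linarith
  · set r := ρ (φ (J y₀)) with hr
    have hrr : 0 ≤ r := h.rho_nonneg _ hr0
    have hcont : Continuous fun s : ℝ => r * (‖y₀‖ * Real.exp (r * s)) := by fun_prop
    have key := h.functional_schemeStep_le hA hy₀ n hle (χ := ψ)
      (g := fun s => r * (‖y₀‖ * Real.exp (r * s)))
      (fun x hx => by rw [hψ _ hx]; exact norm_nonneg _)
      (.of_continuousOn hcont.continuousOn) ?_ ht
    · have hint : ∫ s in (0 : ℝ)..t, r * (‖y₀‖ * Real.exp (r * s))
          = ‖y₀‖ * Real.exp (r * t) - ‖y₀‖ * Real.exp (r * 0) := by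
        refine intervalIntegral.integral_eq_sub_of_hasDerivAt
          (f := fun s => ‖y₀‖ * Real.exp (r * s)) (fun s _ => ?_) (hcont.intervalIntegrable _ _)
        have := (((hasDerivAt_id s).const_mul r).exp).const_mul ‖y₀‖
        exact this.congr_deriv (by rw [id_eq]; ring)
      rw [hint, hψ _ hy₀, hψ _ (h.schemeStep_nonneg hA hy₀ n ht)] at key
      simpa using key
    · filter_upwards [h.reduced, ae_restrict_mem measurableSet_Ici] with s hs hs0
      obtain ⟨p, q, c, hp, hq, hc0, hc, hPp, hMq, hsrc, hpq, -⟩ := h.schemeSource_spec hA n hs0 hs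
      rw [hsrc]
      simp only [map_add, map_sub, map_smul, smul_eq_mul]
      rw [hψ _ hp, hψ _ hq, hψ _ (h.pair.diffQuot_nonneg n (hA.nonneg s hs0))]
      have h1 := mul_le_mul_of_nonneg_right hc (norm_nonneg (diffQuot S n (y s)))
      have h2 := mul_le_mul_of_nonneg_left (hA.growth s hs0) hrr
      linarith

/-- The steps are isotone, also in the smoothing index, as the damped right-hand side is isotone. -/
theorem schemeStep_mono (hA : IsAdmissible J ρ φ y₀ y D) (hB : IsAdmissible J ρ φ y₀ z E)
    (hy₀ : 0 ≤ y₀) (n : ℕ) (hyz : ∀ t, 0 ≤ t → y t ≤ z t) (hDE : ∀ t, 0 ≤ t → D t ≤ E t)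
    {t : ℝ} (ht : 0 ≤ t) :
    (schemeStep S J a P M y₀ n (y, D)).1 t ≤ (schemeStep S J a P M y₀ (n + 1) (z, E)).1 t ∧
      (schemeStep S J a P M y₀ n (y, D)).2 t ≤ (schemeStep S J a P M y₀ (n + 1) (z, E)).2 t := by
  have hα := h.a_nonneg _ (norm_nonneg (J y₀))
  have hvw : ∀ s, 0 ≤ s → smoothing S J n (y s) ≤ smoothing S J (n + 1) (z s) := fun s hs =>
    (h.pair.smoothing_mono n (hyz s hs)).trans (h.pair.smoothing_le_succ n (hB.nonneg s hs))
  constructor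
  · refine add_le_add_right (h.pair.duhamel_mono hα (h.isLocBdd_schemeSource hA hy₀ n)
      (h.isLocBdd_schemeSource hB hy₀ (n + 1)) ht ?_) _
    filter_upwards [h.reduced, ae_restrict_mem measurableSet_Ici] with s hs hs0
    obtain ⟨-, -, -, -, -, -, -, -, -, -, -, -, -, h1⟩ := h.schemeSource_spec hA n hs0 hs
    obtain ⟨-, -, -, -, -, -, -, -, -, -, -, -, -, h2⟩ := h.schemeSource_spec hB (n + 1) hs0 hs
    refine h.pair.le_of_J ?_
    rw [h1, h2]
    exact h.dampedRhs_mono hs (h.smoothing_nonneg hA n s hs0) (hvw s hs0) (hA.D_nonneg s hs0)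
      (hDE s hs0)
  · refine integral_mono_of_ae_timeMeasure ht
      ((h.isLocBdd_diss (h.isLocBdd_smoothing hA hy₀ n)
        (h.smoothing_nonneg hA n)).intervalIntegrable le_rfl ht)
      ((h.isLocBdd_diss (h.isLocBdd_smoothing hB hy₀ (n + 1))
        (h.smoothing_nonneg hB (n + 1))).intervalIntegrable le_rfl ht) ?_
    filter_upwards [h.reduced, ae_restrict_mem measurableSet_Ici] with s hs hs0 _
    exact hs.diss_mono _ _ (h.smoothing_nonneg hA n s hs0) (hvw s hs0)

/-- The approximate solutions are admissible and increasing. -/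
theorem scheme_spec (hy₀ : 0 ≤ y₀) (n : ℕ) :
    IsAdmissible J ρ φ y₀ (scheme S J a P M y₀ n).1 (scheme S J a P M y₀ n).2 ∧
      ∀ t, 0 ≤ t → (scheme S J a P M y₀ n).1 t ≤ (scheme S J a P M y₀ (n + 1)).1 t ∧
        (scheme S J a P M y₀ n).2 t ≤ (scheme S J a P M y₀ (n + 1)).2 t := by
  induction n with
  | zero =>
    have hA : IsAdmissible J ρ φ y₀ (scheme S J a P M y₀ 0).1 (scheme S J a P M y₀ 0).2 := by
      refine ⟨fun _ _ => le_rfl, aestronglyMeasurable_const, fun _ _ => le_rfl,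
        aestronglyMeasurable_const, fun _ _ => ?_, fun _ _ => ?_, fun _ _ => ?_⟩
      · simp [scheme]
      · simpa [scheme] using h.phi_nonneg _ (h.pair.J_nonneg _ hy₀)
      · simp only [scheme, norm_zero]; positivity
    refine ⟨hA, fun t ht => ⟨h.schemeStep_nonneg hA hy₀ 0 ht, ?_⟩⟩
    refine integral_nonneg_of_ae_timeMeasure ht ?_
    filter_upwards [h.reduced, ae_restrict_mem measurableSet_Ici] with s hs hs0 _
    exact hs.diss_nonneg _ (h.smoothing_nonneg hA 0 s hs0)
  | succ n ih =>
    have hB := h.isAdmissible_schemeStep ih.1 hy₀ n fun t ht => (ih.2 t ht).1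
    exact ⟨hB, fun t ht => h.schemeStep_mono ih.1 hB hy₀ n (fun t ht => (ih.2 t ht).1)
      (fun t ht => (ih.2 t ht).2) ht⟩

end IsReducedProblem

end Scheme

end OrderedEvolution

/-! ### The limit of the scheme -/

namespace OrderedEvolution

section Limit

variable {X : Type*} [NormedAddCommGroup X] [NormedSpace ℝ X] [CompleteSpace X] [PartialOrder X]
  [IsOrderedAddMonoid X] [IsOrderedModule ℝ X] [OrderClosedTopology X]
  {S : ℝ → X →L[ℝ] X} {J : X →L[ℝ] X} {a ρ : ℝ → ℝ} {φ : X →L[ℝ] ℝ} {P M : ℝ → X → X}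
  {y₀ : X} {y z : ℝ → X} {D : ℝ → ℝ}

namespace IsReducedProblem

variable (h : IsReducedProblem S J a ρ φ P M)

include h

theorem scheme_monotone (hy₀ : 0 ≤ y₀) {t : ℝ} (ht : 0 ≤ t) :
    (Monotone fun n => (scheme S J a P M y₀ n).1 t) ∧
      Monotone fun n => (scheme S J a P M y₀ n).2 t :=
  ⟨monotone_nat_of_le_succ fun n => ((h.scheme_spec hy₀ n).2 t ht).1,
    monotone_nat_of_le_succ fun n => ((h.scheme_spec hy₀ n).2 t ht).2⟩

theorem exists_scheme_limit (hy₀ : 0 ≤ y₀) : ∃ (y : ℝ → X) (D : ℝ → ℝ), ∀ t, 0 ≤ t →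
    Tendsto (fun n => (scheme S J a P M y₀ n).1 t) atTop (𝓝 (y t)) ∧
      Tendsto (fun n => (scheme S J a P M y₀ n).2 t) atTop (𝓝 (D t)) := by
  have h1 : ∀ t, ∃ x, 0 ≤ t → Tendsto (fun n => (scheme S J a P M y₀ n).1 t) atTop (𝓝 x) := by
    intro t
    by_cases ht : 0 ≤ t
    · obtain ⟨x, hx⟩ := h.space.exists_tendsto_of_monotone (h.scheme_monotone hy₀ ht).1
        (fun n => (h.scheme_spec hy₀ n).1.nonneg t ht)
        fun n => (h.scheme_spec hy₀ n).1.growth t ht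
      exact ⟨x, fun _ => hx⟩
    · exact ⟨0, fun h => absurd h ht⟩
  have h2 : ∀ t, ∃ x, 0 ≤ t → Tendsto (fun n => (scheme S J a P M y₀ n).2 t) atTop (𝓝 x) := by
    intro t
    by_cases ht : 0 ≤ t
    · refine ⟨_, fun _ => tendsto_atTop_ciSup (h.scheme_monotone hy₀ ht).2 ⟨‖J y₀‖, ?_⟩⟩
      rintro _ ⟨n, rfl⟩
      have := (h.scheme_spec hy₀ n).1.energy t ht
      simp only
      linarith [norm_nonneg (J ((scheme S J a P M y₀ n).1 t))]
    · exact ⟨0, fun h => absurd h ht⟩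
  choose y hy using h1
  choose D hD using h2
  exact ⟨y, D, fun t ht => ⟨hy t ht, hD t ht⟩⟩

theorem isAdmissible_limit (hy₀ : 0 ≤ y₀)
    (hlim : ∀ t, 0 ≤ t → Tendsto (fun n => (scheme S J a P M y₀ n).1 t) atTop (𝓝 (y t)) ∧
      Tendsto (fun n => (scheme S J a P M y₀ n).2 t) atTop (𝓝 (D t))) :
    IsAdmissible J ρ φ y₀ y D where
  nonneg t ht := ge_of_tendsto' (hlim t ht).1 fun n => (h.scheme_spec hy₀ n).1.nonneg t ht
  meas := aestronglyMeasurable_of_tendsto_ae atTop (fun n => (h.scheme_spec hy₀ n).1.meas) (by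
    filter_upwards [ae_restrict_mem measurableSet_Ici] with t ht using (hlim t ht).1)
  D_nonneg t ht := ge_of_tendsto' (hlim t ht).2 fun n => (h.scheme_spec hy₀ n).1.D_nonneg t ht
  D_meas := aestronglyMeasurable_of_tendsto_ae atTop (fun n => (h.scheme_spec hy₀ n).1.D_meas) (by
    filter_upwards [ae_restrict_mem measurableSet_Ici] with t ht using (hlim t ht).2)
  energy t ht := le_of_tendsto'
    ((((J.continuous.tendsto _).comp (hlim t ht).1).norm).add (hlim t ht).2)
    fun n => (h.scheme_spec hy₀ n).1.energy t ht
  moment t ht := le_of_tendsto' (((φ.comp J).continuous.tendsto _).comp (hlim t ht).1)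
    fun n => (h.scheme_spec hy₀ n).1.moment t ht
  growth t ht := le_of_tendsto' (hlim t ht).1.norm fun n => (h.scheme_spec hy₀ n).1.growth t ht

/-- `a` is continuous from the left. -/
theorem tendsto_a {N : ℝ} {x : ℕ → ℝ} {l : ℝ} (h0 : ∀ n, 0 ≤ x n) (hle : ∀ n, x n ≤ l) (hl : l ≤ N)
    (hx : Tendsto x atTop (𝓝 l)) : Tendsto (fun n => a (x n)) atTop (𝓝 (a l)) := by
  have hl0 : 0 ≤ l := (h0 0).trans (hle 0)
  have h1 : Tendsto (fun n => a l - a (x n)) atTop (𝓝 0) := by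
    refine squeeze_zero (fun n => sub_nonneg.2 (h.a_mono (h0 n) hl0 (hle n)))
      (fun n => ConvexOn.sub_le_mul h.a_convex (h0 n) (hle n) hl) ?_
    simpa using ((tendsto_const_nhds (x := l)).sub hx).const_mul (a (N + 1) - a N)
  simpa using (tendsto_const_nhds (x := a l)).sub h1

/-- The limit of the scheme solves the problem with damping. -/
theorem limit_equation (hy₀ : 0 ≤ y₀)
    (hlim : ∀ t, 0 ≤ t → Tendsto (fun n => (scheme S J a P M y₀ n).1 t) atTop (𝓝 (y t)) ∧
      Tendsto (fun n => (scheme S J a P M y₀ n).2 t) atTop (𝓝 (D t))) {t : ℝ} (ht : 0 ≤ t) :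
    D t = ∫ s in (0 : ℝ)..t, (‖M s (y s)‖ - ‖P s (y s)‖) ∧
    J (y t) = J y₀ + ∫ s in (0 : ℝ)..t,
      (P s (y s) - M s (y s) + (a (‖J (y s)‖ + D s) - a ‖J y₀‖) • y s) := by
  have hA := h.isAdmissible_limit hy₀ hlim
  have hy := h.isLocBdd_of_admissible hA hy₀
  have hP := h.isLocBdd_gain hy hA.nonneg
  have hM := h.isLocBdd_loss hy hA.nonneg
  have hα := h.a_nonneg _ (norm_nonneg (J y₀))
  set u : ℕ → ℝ → X := fun n => (scheme S J a P M y₀ n).1 with hu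
  set d : ℕ → ℝ → ℝ := fun n => (scheme S J a P M y₀ n).2 with hd
  have hAn : ∀ n, IsAdmissible J ρ φ y₀ (u n) (d n) := fun n => (h.scheme_spec hy₀ n).1
  have huy : ∀ n s, 0 ≤ s → u n s ≤ y s := fun n s hs =>
    (h.scheme_monotone hy₀ hs).1.ge_of_tendsto (hlim s hs).1 n
  have hdD : ∀ n s, 0 ≤ s → d n s ≤ D s := fun n s hs =>
    (h.scheme_monotone hy₀ hs).2.ge_of_tendsto (hlim s hs).2 n
  set v : ℕ → ℝ → X := fun n s => smoothing S J n (u n s) with hv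
  have hv0 : ∀ n s, 0 ≤ s → 0 ≤ v n s := fun n s hs => h.smoothing_nonneg (hAn n) n s hs
  have hvy : ∀ n s, 0 ≤ s → v n s ≤ y s := fun n s hs =>
    (h.pair.smoothing_le n ((hAn n).nonneg s hs)).trans (huy n s hs)
  have hvb : ∀ n, IsLocBdd (v n) := fun n => h.isLocBdd_smoothing (hAn n) hy₀ n
  have hvmono : ∀ s, 0 ≤ s → Monotone fun n => v n s := fun s hs =>
    monotone_nat_of_le_succ fun n =>
      (h.pair.smoothing_mono n ((h.scheme_monotone hy₀ hs).1 n.le_succ)).trans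
        (h.pair.smoothing_le_succ n ((hAn (n + 1)).nonneg s hs))
  have hvlim : ∀ s, 0 ≤ s → Tendsto (fun n => v n s) atTop (𝓝 (y s)) := fun s hs =>
    h.pair.tendsto_smoothing_of_monotone h.space (h.scheme_monotone hy₀ hs).1 (hlim s hs).1
  have hlimP : ∀ᵐ s ∂timeMeasure, Tendsto (fun n => P s (v n s)) atTop (𝓝 (P s (y s))) := by
    filter_upwards [h.reduced, ae_restrict_mem measurableSet_Ici] with s hs hs0
    exact hs.tendsto_gain h.space (hvmono s hs0) (fun n => hv0 n s hs0) (hvlim s hs0)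
  have hlimM : ∀ᵐ s ∂timeMeasure, Tendsto (fun n => M s (v n s)) atTop (𝓝 (M s (y s))) := by
    filter_upwards [h.reduced, ae_restrict_mem measurableSet_Ici] with s hs hs0
    exact hs.tendsto_loss h.space (hvmono s hs0) (fun n => hv0 n s hs0) (hvlim s hs0)
  have hleP : ∀ n, ∀ᵐ s ∂timeMeasure, ‖P s (v n s)‖ ≤ ‖P s (y s)‖ := fun n => by
    filter_upwards [h.reduced, ae_restrict_mem measurableSet_Ici] with s hs hs0
    exact h.space.norm_le (hs.gain_nonneg _ (hv0 n s hs0))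
      (hs.gain_mono _ _ (hv0 n s hs0) (hvy n s hs0))
  have hleM : ∀ n, ∀ᵐ s ∂timeMeasure, ‖M s (v n s)‖ ≤ ‖M s (y s)‖ := fun n => by
    filter_upwards [h.reduced, ae_restrict_mem measurableSet_Ici] with s hs hs0
    exact h.space.norm_le (hs.loss_nonneg _ (hv0 n s hs0))
      (hs.loss_mono _ _ (hv0 n s hs0) (hvy n s hs0))
  constructor
  · refine tendsto_nhds_unique ((tendsto_add_atTop_iff_nat 1).2 (hlim t ht).2) ?_
    refine tendsto_integral_of_dominated
      (F := fun n s => ‖M s (v n s)‖ - ‖P s (v n s)‖) (g := fun s => ‖M s (y s)‖ + ‖P s (y s)‖)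
      (fun n => h.isLocBdd_diss (hvb n) (hv0 n)) (hM.norm.add hP.norm) (fun n => ?_) ?_ ht
    · filter_upwards [hleP n, hleM n] with s h1 h2
      refine (norm_sub_le _ _).trans ?_
      rw [norm_norm, norm_norm]
      linarith
    · filter_upwards [hlimP, hlimM] with s h1 h2 using h2.norm.sub h1.norm
  · -- passage to the limit in the mild form of the equation of each step
    have hb : ∀ n, IsLocBdd fun s => dampedRhs J a P M s (v n s) (d n s) := fun n =>
      h.isLocBdd_dampedRhs (hAn n) (hvb n) (hv0 n)
        fun s hs => h.pair.smoothing_le n ((hAn n).nonneg s hs)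
    have hb' : IsLocBdd fun s => dampedRhs J a P M s (y s) (D s) :=
      h.isLocBdd_dampedRhs hA hy hA.nonneg fun _ _ => le_rfl
    have hstep : ∀ n, a ‖J y₀‖ • ∫ s in (0 : ℝ)..t, u (n + 1) s
        = J y₀ + (∫ s in (0 : ℝ)..t, dampedRhs J a P M s (v n s) (d n s)) - J (u (n + 1) t) := by
      intro n
      have h1 := h.smul_integral_schemeStep (hAn n) hy₀ n ht
      rw [map_sub, map_add, ← ContinuousLinearMap.intervalIntegral_comp_comm _
        ((h.isLocBdd_schemeSource (hAn n) hy₀ n).intervalIntegrable le_rfl ht)] at h1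
      have h2 : ∫ s in (0 : ℝ)..t, J (schemeSource S J a P M n (u n) (d n) s)
          = ∫ s in (0 : ℝ)..t, dampedRhs J a P M s (v n s) (d n s) := by
        refine integral_congr_of_ae_timeMeasure ht ?_
        filter_upwards [h.reduced, ae_restrict_mem measurableSet_Ici] with s hs hs0 _
        obtain ⟨-, -, -, -, -, -, -, -, -, -, -, -, -, h3⟩ := h.schemeSource_spec (hAn n) n hs0 hs
        exact h3
      rw [h2] at h1
      exact h1
    have hl1 : Tendsto (fun n => a ‖J y₀‖ • ∫ s in (0 : ℝ)..t, u (n + 1) s) atTop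
        (𝓝 (a ‖J y₀‖ • ∫ s in (0 : ℝ)..t, y s)) := by
      refine (tendsto_integral_of_dominated (g := fun s => ‖y s‖)
        (fun n => h.isLocBdd_of_admissible (hAn (n + 1)) hy₀) hy.norm (fun n => ?_) ?_ ht).const_smul _
      · filter_upwards [ae_restrict_mem measurableSet_Ici] with s hs
        exact h.space.norm_le ((hAn (n + 1)).nonneg s hs) (huy (n + 1) s hs)
      · filter_upwards [ae_restrict_mem measurableSet_Ici] with s hs
        exact (tendsto_add_atTop_iff_nat 1).2 (hlim s hs).1
    have hl2 : Tendsto (fun n => ∫ s in (0 : ℝ)..t, dampedRhs J a P M s (v n s) (d n s)) atTop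
        (𝓝 (∫ s in (0 : ℝ)..t, dampedRhs J a P M s (y s) (D s))) := by
      refine tendsto_integral_of_dominated
        (g := fun s => (‖P s (y s)‖ + ‖M s (y s)‖) + a ‖J y₀‖ * ‖y s‖) hb
        ((hP.norm.add hM.norm).add ((IsLocBdd.const _).smul hy.norm)) (fun n => ?_) ?_ ht
      · filter_upwards [hleP n, hleM n, ae_restrict_mem measurableSet_Ici] with s h1 h2 hs
        have hN : ‖J (v n s)‖ + d n s ≤ ‖J y₀‖ :=
          (add_le_add (h.norm_J_le (hv0 n s hs) (hvy n s hs)) (hdD n s hs)).trans (hA.energy s hs)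
        have hdn := (hAn n).D_nonneg s hs
        have hx0 : 0 ≤ ‖J (v n s)‖ + d n s := by positivity
        have h3 : ‖a (‖J (v n s)‖ + d n s) • v n s‖ ≤ a ‖J y₀‖ * ‖y s‖ := by
          rw [norm_smul, Real.norm_of_nonneg (h.a_nonneg _ hx0)]
          exact mul_le_mul (h.a_mono (mem_Ici.2 hx0) (mem_Ici.2 (norm_nonneg _)) hN)
            (h.space.norm_le (hv0 n s hs) (hvy n s hs)) (norm_nonneg _) hα
        refine (norm_add_le _ _).trans (add_le_add ((norm_sub_le _ _).trans ?_) h3)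
        exact add_le_add h1 h2
      · filter_upwards [hlimP, hlimM, ae_restrict_mem measurableSet_Ici] with s h1 h2 hs
        refine (h1.sub h2).add (Tendsto.smul ?_ (hvlim s hs))
        refine h.tendsto_a (N := ‖J y₀‖) (fun n => ?_) (fun n => ?_) (hA.energy s hs)
          (((J.continuous.tendsto _).comp (hvlim s hs)).norm.add (hlim s hs).2)
        · have := (hAn n).D_nonneg s hs
          positivity
        · exact add_le_add (h.norm_J_le (hv0 n s hs) (hvy n s hs)) (hdD n s hs)
    have hl3 : Tendsto (fun n => J (u (n + 1) t)) atTop (𝓝 (J (y t))) :=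
      (J.continuous.tendsto _).comp ((tendsto_add_atTop_iff_nat 1).2 (hlim t ht).1)
    have heq := tendsto_nhds_unique hl1
      (((tendsto_const_nhds.add hl2).sub hl3).congr fun n => (hstep n).symm)
    have hfin : ∫ s in (0 : ℝ)..t,
        (P s (y s) - M s (y s) + (a (‖J (y s)‖ + D s) - a ‖J y₀‖) • y s)
        = (∫ s in (0 : ℝ)..t, dampedRhs J a P M s (y s) (D s))
          - a ‖J y₀‖ • ∫ s in (0 : ℝ)..t, y s := by
      rw [← intervalIntegral.integral_smul, ← intervalIntegral.integral_sub
        (hb'.intervalIntegrable le_rfl ht)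
        (((IsLocBdd.const (a ‖J y₀‖)).smul hy).intervalIntegrable le_rfl ht)]
      refine intervalIntegral.integral_congr fun s _ => ?_
      simp only [dampedRhs, sub_smul]
      abel
    rw [hfin, heq]
    abel

/-- The norm of the values of a solution with an additional source is obtained by integration, as the
norm is linear on the cone. -/
theorem norm_J_eq (hy₀ : 0 ≤ y₀) (hy : IsLocBdd y) (h0 : ∀ t, 0 ≤ t → 0 ≤ y t) {r : ℝ → ℝ}
    (hr : IsLocBdd r) {t : ℝ} (ht : 0 ≤ t)
    (heq : J (y t) = J y₀ + ∫ s in (0 : ℝ)..t, (P s (y s) - M s (y s) + r s • y s)) :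
    ‖J (y t)‖ + ∫ s in (0 : ℝ)..t, (‖M s (y s)‖ - ‖P s (y s)‖)
      = ‖J y₀‖ + ∫ s in (0 : ℝ)..t, r s * ‖y s‖ := by
  obtain ⟨ψ, hψ⟩ := h.space.exists_normFunctional
  have hP := h.isLocBdd_gain hy h0
  have hM := h.isLocBdd_loss hy h0
  have hd := h.isLocBdd_diss hy h0
  have h1 := congrArg ψ heq
  have hr2 : IsLocBdd fun s => r s * ‖y s‖ := hr.smul hy.norm
  rw [map_add, ← ContinuousLinearMap.intervalIntegral_comp_comm _
    (((hP.sub hM).add (hr.smul hy)).intervalIntegrable le_rfl ht),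
    hψ _ (h.pair.J_nonneg _ (h0 t ht)), hψ _ (h.pair.J_nonneg _ hy₀)] at h1
  have h2 : ∫ s in (0 : ℝ)..t, ψ (P s (y s) - M s (y s) + r s • y s)
      = ∫ s in (0 : ℝ)..t, (r s * ‖y s‖ - (‖M s (y s)‖ - ‖P s (y s)‖)) := by
    refine integral_congr_of_ae_timeMeasure ht ?_
    filter_upwards [h.reduced, ae_restrict_mem measurableSet_Ici] with s hs hs0 _
    rw [map_add, map_sub, map_smul, hψ _ (hs.gain_nonneg _ (h0 s hs0)),
      hψ _ (hs.loss_nonneg _ (h0 s hs0)), hψ _ (h0 s hs0), smul_eq_mul]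
    ring
  rw [h2, intervalIntegral.integral_sub (hr2.intervalIntegrable le_rfl ht)
    (hd.intervalIntegrable le_rfl ht)] at h1
  rw [h1]
  ring

/-- The energy identity holds for each solution. -/
theorem solution_energy (hy₀ : 0 ≤ y₀) (hy : IsReducedSolution J P M y₀ y) {t : ℝ}
    (ht : 0 ≤ t) :
    ‖J (y t)‖ + ∫ s in (0 : ℝ)..t, (‖M s (y s)‖ - ‖P s (y s)‖) = ‖J y₀‖ := by
  have := h.norm_J_eq hy₀ hy.locBdd hy.nonneg (.const 0) ht (by simpa using hy.equation t ht)
  simpa using this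

/-- The limit of the scheme conserves the energy: by convexity of `a`, the defect `e` of the energy
identity satisfies `e(t) ≤ C ∫₀ᵗ e`, so that Gronwall's inequality applies. -/
theorem limit_energy (hy₀ : 0 ≤ y₀)
    (hlim : ∀ t, 0 ≤ t → Tendsto (fun n => (scheme S J a P M y₀ n).1 t) atTop (𝓝 (y t)) ∧
      Tendsto (fun n => (scheme S J a P M y₀ n).2 t) atTop (𝓝 (D t))) {t : ℝ} (ht : 0 ≤ t) :
    ‖J (y t)‖ + D t = ‖J y₀‖ := by
  have hA := h.isAdmissible_limit hy₀ hlim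
  have hy := h.isLocBdd_of_admissible hA hy₀
  set N := ‖J y₀‖ with hN
  have hx0 : ∀ s, 0 ≤ s → 0 ≤ ‖J (y s)‖ + D s := fun s hs => by
    have := hA.D_nonneg s hs
    positivity
  have hr : IsLocBdd fun s => a (‖J (y s)‖ + D s) - a N :=
    (h.isLocBdd_coefficient hA hy hA.nonneg fun _ _ => le_rfl).sub (.const _)
  have hrc : IsLocBdd fun s => (a (‖J (y s)‖ + D s) - a N) * ‖y s‖ := hr.smul hy.norm
  have hid : ∀ s, 0 ≤ s → N - (‖J (y s)‖ + D s)
      = -∫ r in (0 : ℝ)..s, (a (‖J (y r)‖ + D r) - a N) * ‖y r‖ := fun s hs => by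
    obtain ⟨h1, h2⟩ := h.limit_equation hy₀ hlim hs
    have := h.norm_J_eq hy₀ hy hA.nonneg hr hs h2
    rw [← h1] at this
    rw [this]
    ring
  have hcont : ContinuousOn (fun s => N - (‖J (y s)‖ + D s)) (Ici 0) :=
    hrc.continuousOn_integral.neg.congr hid
  have hr0 : 0 ≤ ρ (φ (J y₀)) := h.rho_nonneg _ (h.phi_nonneg _ (h.pair.J_nonneg _ hy₀))
  have hL : 0 ≤ a (N + 1) - a N :=
    sub_nonneg.2 (h.a_mono (mem_Ici.2 (norm_nonneg _)) (mem_Ici.2 (by positivity)) (by linarith))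
  have hz := eq_zero_of_le_mul_integral (T := t)
    (K := (a (N + 1) - a N) * (‖y₀‖ * Real.exp (ρ (φ (J y₀)) * t))) hcont
    (fun s hs => sub_nonneg.2 (hA.energy s hs)) (fun s hs => ?_) t ⟨ht, le_rfl⟩
  · linarith
  · rw [hid s hs.1, ← intervalIntegral.integral_neg, ← intervalIntegral.integral_const_mul]
    have hei : IsLocBdd fun r => (a (N + 1) - a N) * (‖y₀‖ * Real.exp (ρ (φ (J y₀)) * t)) *
        (N - (‖J (y r)‖ + D r)) := (IsLocBdd.const _).smul (.of_continuousOn hcont)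
    refine integral_mono_of_ae_timeMeasure hs.1
      (hrc.intervalIntegrable le_rfl hs.1).neg (hei.intervalIntegrable le_rfl hs.1) ?_
    filter_upwards [ae_restrict_mem measurableSet_Ici] with r hr0' hrs
    have hr0'' : (0 : ℝ) ≤ r := hr0'
    have h1 := ConvexOn.sub_le_mul h.a_convex (hx0 r hr0'') (hA.energy r hr0'') le_rfl
    have h2 : ‖y r‖ ≤ ‖y₀‖ * Real.exp (ρ (φ (J y₀)) * t) := by
      refine (hA.growth r hr0'').trans ?_
      have : r ≤ t := hrs.trans hs.2
      gcongr
    have h3 : 0 ≤ N - (‖J (y r)‖ + D r) := sub_nonneg.2 (hA.energy r hr0'')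
    calc -((a (‖J (y r)‖ + D r) - a N) * ‖y r‖)
        = (a N - a (‖J (y r)‖ + D r)) * ‖y r‖ := by ring
      _ ≤ ((a (N + 1) - a N) * (N - (‖J (y r)‖ + D r))) * ‖y r‖ :=
        mul_le_mul_of_nonneg_right h1 (norm_nonneg _)
      _ ≤ ((a (N + 1) - a N) * (N - (‖J (y r)‖ + D r))) *
          (‖y₀‖ * Real.exp (ρ (φ (J y₀)) * t)) :=
        mul_le_mul_of_nonneg_left h2 (mul_nonneg hL h3)
      _ = _ := by ring

theorem isReducedSolution_limit (hy₀ : 0 ≤ y₀)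
    (hlim : ∀ t, 0 ≤ t → Tendsto (fun n => (scheme S J a P M y₀ n).1 t) atTop (𝓝 (y t)) ∧
      Tendsto (fun n => (scheme S J a P M y₀ n).2 t) atTop (𝓝 (D t))) :
    IsReducedSolution J P M y₀ y := by
  have hA := h.isAdmissible_limit hy₀ hlim
  refine ⟨hA.nonneg, h.isLocBdd_of_admissible hA hy₀, fun t ht => ?_⟩
  rw [(h.limit_equation hy₀ hlim ht).2]
  congr 1
  refine integral_congr_of_ae_timeMeasure ht ?_
  filter_upwards [ae_restrict_mem measurableSet_Ici] with s hs _
  rw [h.limit_energy hy₀ hlim hs, sub_self, zero_smul, add_zero]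

/-- The approximate solutions lie below each solution `z`: by the energy identity, `z` satisfies
Duhamel's formula for the equation with damping, whose right-hand side is isotone. -/
theorem scheme_le_solution (hy₀ : 0 ≤ y₀) (hz : IsReducedSolution J P M y₀ z) (n : ℕ) :
    ∀ t, 0 ≤ t → (scheme S J a P M y₀ n).1 t ≤ z t ∧
      (scheme S J a P M y₀ n).2 t ≤ ∫ s in (0 : ℝ)..t, (‖M s (z s)‖ - ‖P s (z s)‖) := by
  have hα := h.a_nonneg _ (norm_nonneg (J y₀))
  have hdz := h.isLocBdd_diss hz.locBdd hz.nonneg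
  induction n with
  | zero =>
    refine fun t ht => ⟨hz.nonneg t ht, integral_nonneg_of_ae_timeMeasure ht ?_⟩
    filter_upwards [h.reduced, ae_restrict_mem measurableSet_Ici] with s hs hs0 _
    exact hs.diss_nonneg _ (hz.nonneg s hs0)
  | succ n ih =>
    intro t ht
    have hA := (h.scheme_spec hy₀ n).1
    have hb := h.isLocBdd_schemeSource hA hy₀ n
    have hv0 := h.smoothing_nonneg hA n
    have hvz : ∀ s, 0 ≤ s → smoothing S J n ((scheme S J a P M y₀ n).1 s) ≤ z s := fun s hs =>
      (h.pair.smoothing_le n (hA.nonneg s hs)).trans (ih s hs).1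
    constructor
    · have hc := (h.isLocBdd_gain hz.locBdd hz.nonneg).sub (h.isLocBdd_loss hz.locBdd hz.nonneg)
      have hJz := h.pair.eq_duhamel hα hc hz.locBdd hz.equation h.pair.injective ht
      refine h.pair.le_of_J ?_
      rw [hJz]
      change J (S (a ‖J y₀‖ * t) y₀ + duhamel S (a ‖J y₀‖) _ t) ≤ _
      rw [map_add, ← h.pair.comm _ (mul_nonneg hα ht), duhamel,
        ← ContinuousLinearMap.intervalIntegral_comp_comm _
          (h.pair.intervalIntegrable_kernel hα hb ht)]
      refine add_le_add_right ?_ _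
      have hcomm : ∫ s in (0 : ℝ)..t, J (S (a ‖J y₀‖ * (t - s)) (schemeSource S J a P M n
          (scheme S J a P M y₀ n).1 (scheme S J a P M y₀ n).2 s))
          = duhamel S (a ‖J y₀‖) (fun s => J (schemeSource S J a P M n
            (scheme S J a P M y₀ n).1 (scheme S J a P M y₀ n).2 s)) t := by
        refine intervalIntegral.integral_congr fun s hs => ?_
        rw [uIcc_of_le ht] at hs
        exact (h.pair.comm _ (mul_nonneg hα (sub_nonneg.2 hs.2)) _).symm
      rw [hcomm]
      refine h.pair.duhamel_mono hα (hb.clm J) (hc.add ((IsLocBdd.const _).smul hz.locBdd)) ht ?_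
      filter_upwards [h.reduced, ae_restrict_mem measurableSet_Ici] with s hs hs0
      obtain ⟨-, -, -, -, -, -, -, -, -, -, -, -, -, h1⟩ := h.schemeSource_spec hA n hs0 hs
      rw [h1]
      have h2 := h.dampedRhs_mono hs (hv0 s hs0) (hvz s hs0) (hA.D_nonneg s hs0) (ih s hs0).2
      rwa [dampedRhs, dampedRhs, h.solution_energy hy₀ hz hs0] at h2
    · refine integral_mono_of_ae_timeMeasure ht
        ((h.isLocBdd_diss (h.isLocBdd_smoothing hA hy₀ n) hv0).intervalIntegrable le_rfl ht)
        (hdz.intervalIntegrable le_rfl ht) ?_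
      filter_upwards [h.reduced, ae_restrict_mem measurableSet_Ici] with s hs hs0 _
      exact hs.diss_mono _ _ (hv0 s hs0) (hvz s hs0)

/-- Existence and uniqueness for the reduced problem. A second solution `z` lies above the limit `y`
of the scheme and dissipates at least as much energy, so that `‖J z‖ ≤ ‖J y‖` by the energy identity,
and `J z = J y` by additivity of the norm. -/
theorem exists_unique_solution (hy₀ : 0 ≤ y₀) :
    ∃ y, IsReducedSolution J P M y₀ y ∧
      (∀ t, 0 ≤ t → ‖y t‖ ≤ ‖y₀‖ * Real.exp (ρ (φ (J y₀)) * t)) ∧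
      ∀ z, IsReducedSolution J P M y₀ z → ∀ t, 0 ≤ t → z t = y t := by
  obtain ⟨y, D, hlim⟩ := h.exists_scheme_limit hy₀
  have hA := h.isAdmissible_limit hy₀ hlim
  refine ⟨y, h.isReducedSolution_limit hy₀ hlim, hA.growth, fun z hz t ht => ?_⟩
  have hle : y t ≤ z t :=
    le_of_tendsto' (hlim t ht).1 fun n => (h.scheme_le_solution hy₀ hz n t ht).1
  have hDle := le_of_tendsto' (hlim t ht).2 fun n => (h.scheme_le_solution hy₀ hz n t ht).2
  have h1 := h.limit_energy hy₀ hlim ht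
  have h2 := h.solution_energy hy₀ hz ht
  have h3 := h.space.norm_sub (h.pair.J_nonneg _ (hA.nonneg t ht)) (h.pair.J_mono hle)
  refine h.pair.injective (sub_eq_zero.1 (norm_le_zero_iff.1 ?_))
  rw [h3]
  linarith

end IsReducedProblem

end Limit

end OrderedEvolution

/-! ### Reduction by `Λ⁻¹` -/

namespace OrderedEvolution

section Calculus

variable {E : Type*} [NormedAddCommGroup E] [NormedSpace ℝ E] [CompleteSpace E] {b : ℝ → E}

theorem IsLocBdd.absolutelyContinuousOnInterval_integral (hb : IsLocBdd b) {T : ℝ} (hT : 0 ≤ T) :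
    AbsolutelyContinuousOnInterval (fun t => ∫ s in (0 : ℝ)..t, b s) 0 T := by
  obtain ⟨C, hC⟩ := hb.bound T
  refine LipschitzOnWith.absolutelyContinuousOnInterval (K := ⟨max C 0, le_max_right _ _⟩)
    (LipschitzOnWith.of_dist_le_mul fun t ht s hs => ?_)
  rw [uIcc_of_le hT] at ht hs
  rw [dist_eq_norm, intervalIntegral.integral_interval_sub_left
    (hb.intervalIntegrable le_rfl ht.1) (hb.intervalIntegrable le_rfl hs.1), Real.dist_eq]
  refine intervalIntegral.norm_integral_le_of_norm_le_const_ae ?_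
  have := ae_restrict_Ioc_of_ae_timeMeasure hC T
  rw [ae_restrict_iff' measurableSet_Ioc] at this
  filter_upwards [this] with r hr hrst
  have hr' : r ∈ Ioc 0 T := ⟨(le_min hs.1 ht.1).trans_lt hrst.1, hrst.2.trans (max_le hs.2 ht.2)⟩
  exact ((hr hr').1 hr'.2).trans (le_max_left _ _)

theorem IsLocBdd.ae_hasDerivAt_integral (hb : IsLocBdd b) :
    ∀ᵐ t ∂timeMeasure, HasDerivAt (fun t => ∫ s in (0 : ℝ)..t, b s) (b t) t := by
  have h1 : ∀ᵐ t, ∀ n : ℕ, t ∈ uIcc (0 : ℝ) n → ∀ c ∈ uIcc (0 : ℝ) n,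
      HasDerivAt (fun t => ∫ s in c..t, b s) (b t) t := ae_all_iff.2 fun n =>
    (hb.intervalIntegrable le_rfl n.cast_nonneg).ae_hasDerivAt_integral
  filter_upwards [ae_restrict_of_ae h1, ae_restrict_mem measurableSet_Ici] with t ht ht0
  obtain ⟨n, hn⟩ := exists_nat_ge t
  exact ht n (by rw [uIcc_of_le n.cast_nonneg]; exact ⟨ht0, hn⟩) 0 left_mem_uIcc

/-- The fundamental theorem of calculus for an absolutely continuous function with locally bounded
derivative. -/
theorem IsLocBdd.eq_add_integral (hb : IsLocBdd b) {F : ℝ → E}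
    (hac : ∀ T : ℝ, 0 < T → AbsolutelyContinuousOnInterval F 0 T)
    (hF : ∀ᵐ t ∂timeMeasure, HasDerivAt F (b t) t) {t : ℝ} (ht : 0 ≤ t) :
    F t = F 0 + ∫ s in (0 : ℝ)..t, b s := by
  have hT : 0 < t + 1 := by linarith
  have h1 := (hac _ hT).fun_sub (hb.absolutelyContinuousOnInterval_integral hT.le)
  obtain ⟨C, hC⟩ := h1.const_of_ae_hasDerivAt_zero (by
    have h2 : ∀ᵐ t ∂timeMeasure,
        HasDerivAt (fun t => F t - ∫ s in (0 : ℝ)..t, b s) 0 t := by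
      filter_upwards [hF, hb.ae_hasDerivAt_integral] with s h3 h4
      simpa using h3.fun_sub h4
    unfold timeMeasure at h2
    rw [ae_restrict_iff' measurableSet_Ici] at h2
    filter_upwards [h2] with s hs hst
    rw [uIcc_of_le hT.le] at hst
    exact hs hst.1)
  have h3 := hC t (by rw [uIcc_of_le hT.le]; exact ⟨ht, by linarith⟩)
  have h4 := hC 0 left_mem_uIcc
  simp only [intervalIntegral.integral_same, sub_zero] at h4
  rw [h4, ← h3, sub_add_cancel]

end Calculus

section Reduction

variable {X : Type*} [NormedAddCommGroup X] [NormedSpace ℝ X] [CompleteSpace X]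
  [PartialOrder X] [IsOrderedAddMonoid X] [IsOrderedModule ℝ X] [OrderClosedTopology X]
  {S : ℝ → X →L[ℝ] X} {J : X →L[ℝ] X} {Λ : X →ₗ.[ℝ] X}

theorem opVal_J (hdom : ∀ x y, (x ∈ Λ.domain ∧ opVal Λ x = y) ↔ x = J y) (y : X) :
    opVal Λ (J y) = y :=
  ((hdom (J y) y).2 rfl).2

theorem mem_domain_iff (hdom : ∀ x y, (x ∈ Λ.domain ∧ opVal Λ x = y) ↔ x = J y) (x : X) :
    x ∈ Λ.domain ↔ ∃ y, x = J y :=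
  ⟨fun h => ⟨_, (hdom x _).1 ⟨h, rfl⟩⟩, fun ⟨y, hy⟩ => ((hdom x y).2 hy).1⟩

theorem mem_posDom_one (h : IsDampingPair S J)
    (hdom : ∀ x y, (x ∈ Λ.domain ∧ opVal Λ x = y) ↔ x = J y) (x : X) :
    x ∈ posDom Λ 1 ↔ ∃ y, 0 ≤ y ∧ x = J y := by
  simp only [posDom, domPow, opPow, mem_ofPred_eq, mem_univ, true_and, mem_domain_iff hdom]
  constructor
  · rintro ⟨h0, y, rfl⟩
    exact ⟨y, h.nonneg_of_J _ h0, rfl⟩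
  · rintro ⟨y, hy, rfl⟩
    exact ⟨h.J_nonneg _ hy, y, rfl⟩

theorem mem_posDom_two (h : IsDampingPair S J)
    (hdom : ∀ x y, (x ∈ Λ.domain ∧ opVal Λ x = y) ↔ x = J y) (x : X) :
    x ∈ posDom Λ 2 ↔ ∃ y, 0 ≤ y ∧ x = J (J y) := by
  simp only [posDom, domPow, opPow, mem_ofPred_eq, mem_univ, true_and, mem_domain_iff hdom]
  constructor
  · rintro ⟨h0, ⟨y, rfl⟩, z, hz⟩
    rw [opVal_J hdom] at hz
    subst hz
    exact ⟨z, h.nonneg_of_J _ (h.nonneg_of_J _ h0), rfl⟩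
  · rintro ⟨y, hy, rfl⟩
    exact ⟨h.J_nonneg _ (h.J_nonneg _ hy), ⟨_, rfl⟩, y, opVal_J hdom _⟩

theorem J_mem_posDom_three (h : IsDampingPair S J)
    (hdom : ∀ x y, (x ∈ Λ.domain ∧ opVal Λ x = y) ↔ x = J y) {y : X} (hy : 0 ≤ y) :
    J (J (J y)) ∈ posDom Λ 3 := by
  simp only [posDom, domPow, opPow, mem_ofPred_eq, mem_univ, true_and, opVal_J hdom,
    mem_domain_iff hdom]
  exact ⟨h.J_nonneg _ (h.J_nonneg _ (h.J_nonneg _ hy)), ⟨⟨_, rfl⟩, _, rfl⟩, _, rfl⟩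

theorem opPow_two_J (hdom : ∀ x y, (x ∈ Λ.domain ∧ opVal Λ x = y) ↔ x = J y) (y : X) :
    opPow Λ 2 (J (J y)) = y := by
  simp only [opPow, opVal_J hdom]

/-- `y ↦ Λ Q(t, Λ⁻² y)`, in terms of `J = Λ⁻¹`. -/
noncomputable def reducedOp (Λ : X →ₗ.[ℝ] X) (J : X →L[ℝ] X) (Q : ℝ → X → X) (t : ℝ) (y : X) : X :=
  opVal Λ (Q t (J (J y)))

variable {D : Set X} {Qp Qm : ℝ → X → X} {a ρ : ℝ → ℝ} {D₁ : Set X} {Λ₁ : X → X} {φ : X →L[ℝ] ℝ}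

theorem J_reducedOp (h : IsDampingPair S J)
    (hdom : ∀ x y, (x ∈ Λ.domain ∧ opVal Λ x = y) ↔ x = J y) {Q : ℝ → X → X} {t : ℝ}
    (hQ : ∀ g ∈ posDom Λ 2, Q t g ∈ posDom Λ (2 - 1)) {y : X} (hy : 0 ≤ y) :
    J (reducedOp Λ J Q t y) = Q t (J (J y)) ∧ 0 ≤ reducedOp Λ J Q t y := by
  obtain ⟨p, hp, hQp⟩ := (mem_posDom_one h hdom _).1
    (hQ _ ((mem_posDom_two h hdom _).2 ⟨y, hy, rfl⟩))
  rw [reducedOp, hQp, opVal_J hdom]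
  exact ⟨rfl, hp⟩

/-- `x ↦ ‖Λ₁ Λ⁻¹ x‖` is additive on the cone, hence extends to a bounded linear functional. -/
theorem exists_norm_functional (hX : IsAbstractStateSpace X) (h : IsDampingPair S J)
    (hdom : ∀ x y, (x ∈ Λ.domain ∧ opVal Λ x = y) ↔ x = J y)
    (hA3 : AssumptionA3 Qp Qm Λ D₁ Λ₁ ρ) : ∃ φ : X →L[ℝ] ℝ, ∀ x, 0 ≤ x → φ x = ‖Λ₁ (J x)‖ := by
  have hmem : ∀ x, 0 ≤ x → J x ∈ D₁ := fun x hx =>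
    hA3.posDom_subset ((mem_posDom_one h hdom _).2 ⟨x, hx, rfl⟩)
  refine hX.exists_functional _ (fun _ _ => norm_nonneg _) (fun x y hx hy => ?_)
    fun c hc x hx => ?_
  · rw [map_add, hA3.positive.map_add _ (hmem x hx) _ (hmem y hy)]
    exact hX.norm_add _ _ (hA3.positive.map_nonneg _ (hmem x hx))
      (hA3.positive.map_nonneg _ (hmem y hy))
  · rw [map_smul, hA3.positive.map_smul c hc _ (hmem x hx), norm_smul, Real.norm_of_nonneg hc]

theorem isReducedProblem (hX : IsAbstractStateSpace X) (hQ : GeneralAssumptions D Qp Qm)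
    (hA : AssumptionA D Qp Qm Λ) (hA1 : AssumptionA1 Qm Λ a) (hA2 : AssumptionA2 Qp Qm Λ)
    (hA3 : AssumptionA3 Qp Qm Λ D₁ Λ₁ ρ) (h : IsDampingPair S J)
    (hdom : ∀ x y, (x ∈ Λ.domain ∧ opVal Λ x = y) ↔ x = J y)
    (hφ : ∀ x, 0 ≤ x → φ x = ‖Λ₁ (J x)‖) :
    IsReducedProblem S J a ρ φ (reducedOp Λ J Qp) (reducedOp Λ J Qm) := by
  have hpos1 : ∀ y, 0 ≤ y → J y ∈ posDom Λ 1 := fun y hy => (mem_posDom_one h hdom _).2 ⟨y, hy, rfl⟩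
  have hpos2 : ∀ y, 0 ≤ y → J (J y) ∈ posDom Λ 2 := fun y hy =>
    (mem_posDom_two h hdom _).2 ⟨y, hy, rfl⟩
  have hD : ∀ y, 0 ≤ y → J (J y) ∈ D := fun y hy => hA.posDom_subset (hpos1 _ (h.J_nonneg y hy))
  have hJJ : ∀ {y z}, y ≤ z → J (J y) ≤ J (J z) := fun hyz => h.J_mono (h.J_mono hyz)
  refine ⟨hX, h, hA1.nonneg, hA1.mono, hA1.convex, hA3.rho_nonneg, hA3.rho_mono,
    fun x hx => by rw [hφ x hx]; exact norm_nonneg _, ?_, fun y hy h0 => ?_, fun y hy h0 => ?_⟩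
  · filter_upwards [hQ.Qp_isotone, hQ.Qm_isotone, hQ.Qp_oClosed, hQ.Qm_oClosed,
      hA.Qp_maps 2 (Or.inl rfl), hA.Qm_maps 2 (Or.inl rfl), hA.Qp_maps 3 (Or.inr rfl),
      hA.Qm_maps 3 (Or.inr rfl), hA1.bound, hA1.isotone, hA2.nonneg, hA2.isotone,
      hA3.dissipative, hA3.povzner] with t hpi hmi hpc hmc hp2 hm2 hp3 hm3 hb hi hn2 hi2 hd hpov
    have hP : ∀ y, 0 ≤ y → J (reducedOp Λ J Qp t y) = Qp t (J (J y)) ∧ 0 ≤ reducedOp Λ J Qp t y :=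
      fun y hy => J_reducedOp h hdom hp2 hy
    have hM : ∀ y, 0 ≤ y → J (reducedOp Λ J Qm t y) = Qm t (J (J y)) ∧ 0 ≤ reducedOp Λ J Qm t y :=
      fun y hy => J_reducedOp h hdom hm2 hy
    have hclosed : ∀ {Q : ℝ → X → X}, OClosed D (Q t) →
        (∀ y, 0 ≤ y → J (reducedOp Λ J Q t y) = Q t (J (J y)) ∧ 0 ≤ reducedOp Λ J Q t y) →
        ∀ (u : ℕ → X) (g k : X), Monotone u → (∀ n, 0 ≤ u n) → Tendsto u atTop (𝓝 g) →
        Tendsto (fun n => reducedOp Λ J Q t (u n)) atTop (𝓝 k) → reducedOp Λ J Q t g = k := by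
      intro Q hc hQJ u g k hu hu0 hug huk
      have h1 := hc (fun n => J (J (u n))) (J (J g)) (J k) (fun m n hmn => hJJ (hu hmn))
        (fun n => hD _ (hu0 n)) (((J.comp J).continuous.tendsto g).comp hug)
        (((J.continuous.tendsto k).comp huk).congr fun n => (hQJ _ (hu0 n)).1)
      rw [reducedOp, h1.2, opVal_J hdom]
    refine ⟨fun y hy => (hP y hy).2, fun y hy => (hM y hy).2, fun y z hy hyz => ?_,
      fun y z hy hyz => ?_, fun y hy => ?_, fun y z hy hyz => ?_, fun y hy => ?_,
      fun y z hy hyz => ?_, hclosed hpc hP, hclosed hmc hM, fun y hy => ?_, fun z hz => ?_⟩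
    · refine h.le_of_J ?_
      rw [(hP y hy).1, (hP z (hy.trans hyz)).1]
      exact hpi (hD y hy) (hD z (hy.trans hyz)) (hJJ hyz)
    · refine h.le_of_J ?_
      rw [(hM y hy).1, (hM z (hy.trans hyz)).1]
      exact hmi (hD y hy) (hD z (hy.trans hyz)) (hJJ hyz)
    · have h1 := (hb _ (hpos1 _ (h.J_nonneg y hy))).2
      rw [opVal_J hdom, ← (hM y hy).1, ← map_smul] at h1
      exact h.le_of_J h1
    · have h1 := hi (hpos1 _ (h.J_nonneg y hy)) (hpos1 _ (h.J_nonneg z (hy.trans hyz))) (hJJ hyz)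
      simp only [opVal_J hdom] at h1
      rw [← (hM y hy).1, ← (hM z (hy.trans hyz)).1, ← map_smul, ← map_smul, ← map_sub,
        ← map_sub] at h1
      exact h.le_of_J h1
    · exact hn2 _ (hpos2 y hy)
    · exact hi2 (hpos2 y hy) (hpos2 z (hy.trans hyz)) (hJJ hyz)
    · have h1 := hd _ (hpos2 y hy)
      rw [← (hP y hy).1, ← (hM y hy).1, ← hφ _ (hP y hy).2, ← hφ _ (hM y hy).2] at h1
      linarith
    · have h3 := J_mem_posDom_three h hdom hz
      obtain ⟨p, hp, hQp⟩ := (mem_posDom_two h hdom _).1 (hp3 _ h3)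
      obtain ⟨q, hq, hQq⟩ := (mem_posDom_two h hdom _).1 (hm3 _ h3)
      refine ⟨p, q, hp, hq, ?_, ?_, ?_⟩
      · rw [reducedOp, hQp, opVal_J hdom]
      · rw [reducedOp, hQq, opVal_J hdom]
      · have h1 := hpov _ h3
        rwa [hQp, hQq, opPow_two_J hdom, opPow_two_J hdom, opPow_two_J hdom,
          ← hφ _ (h.J_nonneg _ (h.J_nonneg _ hz))] at h1
  · refine h.aestronglyMeasurable_of_J ((hQ.Qp_measurable (fun t => J (J (y t)))
      ((J.comp J).continuous.comp_aestronglyMeasurable hy)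
      (fun t ht => h.J_nonneg _ (h.J_nonneg _ (h0 t ht))) ?_).congr ?_)
    · filter_upwards [ae_restrict_mem measurableSet_Ici] with t ht using hD _ (h0 t ht)
    · filter_upwards [hA.Qp_maps 2 (Or.inl rfl), ae_restrict_mem measurableSet_Ici] with t h2 ht
      exact (J_reducedOp h hdom h2 (h0 t ht)).1.symm
  · refine h.aestronglyMeasurable_of_J ((hQ.Qm_measurable (fun t => J (J (y t)))
      ((J.comp J).continuous.comp_aestronglyMeasurable hy)
      (fun t ht => h.J_nonneg _ (h.J_nonneg _ (h0 t ht))) ?_).congr ?_)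
    · filter_upwards [ae_restrict_mem measurableSet_Ici] with t ht using hD _ (h0 t ht)
    · filter_upwards [hA.Qm_maps 2 (Or.inl rfl), ae_restrict_mem measurableSet_Ici] with t h2 ht
      exact (J_reducedOp h hdom h2 (h0 t ht)).1.symm

/-- `Λ²` maps regular solutions to solutions of the reduced problem. -/
theorem IsRegularSolution.isReducedSolution (hA : AssumptionA D Qp Qm Λ)
    (hdom : ∀ x y, (x ∈ Λ.domain ∧ opVal Λ x = y) ↔ x = J y)
    (hR : IsReducedProblem S J a ρ φ (reducedOp Λ J Qp) (reducedOp Λ J Qm)) {y₀ : X} {F : ℝ → X}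
    (hF : IsRegularSolution D Qp Qm Λ (J (J y₀)) F) :
    IsReducedSolution J (reducedOp Λ J Qp) (reducedOp Λ J Qm) y₀ (fun t => opPow Λ 2 (F t)) ∧
      ∀ t, 0 ≤ t → F t = J (J (opPow Λ 2 (F t))) := by
  have h := hR.pair
  have hFY : ∀ t, 0 ≤ t → F t = J (J (opPow Λ 2 (F t))) ∧ 0 ≤ opPow Λ 2 (F t) := fun t ht => by
    obtain ⟨y, hy, hFy⟩ := (mem_posDom_two h hdom _).1 (hF.mem_posDom t ht)
    rw [hFy, opPow_two_J hdom]
    exact ⟨rfl, hy⟩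
  have hcont : ContinuousOn F (Ici 0) := fun t ht => by
    have ht' : (0 : ℝ) ≤ t := ht
    have h1 := (hF.solution.absolutelyContinuous (t + 1) (by linarith)).continuousOn
    rw [uIcc_of_le (by linarith)] at h1
    refine (h1 t ⟨ht', by linarith⟩).mono_of_mem_nhdsWithin ?_
    rw [mem_nhdsWithin]
    exact ⟨Iio (t + 1), isOpen_Iio, by simp, fun s hs => ⟨hs.2, hs.1.le⟩⟩
  have hY : IsLocBdd fun t => opPow Λ 2 (F t) := by
    refine ⟨h.aestronglyMeasurable_of_J (h.aestronglyMeasurable_of_J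
      ((hcont.aestronglyMeasurable measurableSet_Ici (μ := volume)).congr ?_)), fun T => ?_⟩
    · filter_upwards [ae_restrict_mem measurableSet_Ici] with t ht using (hFY t ht).1
    · obtain ⟨C, hC⟩ := hF.locallyBounded (max T 1) (by positivity)
      refine ⟨C, ?_⟩
      filter_upwards [ae_restrict_mem measurableSet_Ici] with t ht htT
      exact hC t ⟨ht, htT.trans (le_max_left _ _)⟩
  have hY0 : ∀ t, 0 ≤ t → 0 ≤ opPow Λ 2 (F t) := fun t ht => (hFY t ht).2
  have hPM := (hR.isLocBdd_gain hY hY0).sub (hR.isLocBdd_loss hY hY0)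
  have hderiv : ∀ᵐ t ∂timeMeasure, HasDerivAt F (J (reducedOp Λ J Qp t (opPow Λ 2 (F t))
      - reducedOp Λ J Qm t (opPow Λ 2 (F t)))) t := by
    filter_upwards [hF.solution.equation, hA.Qp_maps 2 (Or.inl rfl), hA.Qm_maps 2 (Or.inl rfl),
      ae_restrict_mem measurableSet_Ici] with t h1 h2 h3 ht
    rw [map_sub, (J_reducedOp h hdom h2 (hY0 t ht)).1, (J_reducedOp h hdom h3 (hY0 t ht)).1,
      ← (hFY t ht).1]
    exact h1
  refine ⟨⟨hY0, hY, fun t ht => h.injective ?_⟩, fun t ht => (hFY t ht).1⟩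
  rw [← (hFY t ht).1, map_add, ← ContinuousLinearMap.intervalIntegral_comp_comm _
    (hPM.intervalIntegrable le_rfl ht), ← hF.solution.initial]
  exact (hPM.clm J).eq_add_integral hF.solution.absolutelyContinuous hderiv ht

end Reduction

end OrderedEvolution

/-! ### Existence and uniqueness of regular solutions -/

open OrderedEvolution in
theorem theorem3p1 {X : Type*} [NormedAddCommGroup X] [NormedSpace ℝ X] [CompleteSpace X]
    [TopologicalSpace.SeparableSpace X] [PartialOrder X] [IsOrderedAddMonoid X]
    [IsOrderedModule ℝ X] (hX : OrderedEvolution.IsAbstractStateSpace X)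
    (D : Set X) (Qp Qm : ℝ → X → X) (hQ : OrderedEvolution.GeneralAssumptions D Qp Qm)
    (Λ : X →ₗ.[ℝ] X) (hA : OrderedEvolution.AssumptionA D Qp Qm Λ)
    (hA0 : OrderedEvolution.AssumptionA0 Λ)
    (a : ℝ → ℝ) (hA1 : OrderedEvolution.AssumptionA1 Qm Λ a)
    (hA2 : OrderedEvolution.AssumptionA2 Qp Qm Λ)
    (D₁ : Set X) (Λ₁ : X → X) (ρ : ℝ → ℝ)
    (hA3 : OrderedEvolution.AssumptionA3 Qp Qm Λ D₁ Λ₁ ρ)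
    (hab : OrderedEvolution.ConditionA Qp Λ ∨ OrderedEvolution.ConditionB D Qp Qm)
    (f₀ : X) (hf₀ : f₀ ∈ OrderedEvolution.posDom Λ 2) :
    ∃ f : ℝ → X, OrderedEvolution.IsRegularSolution D Qp Qm Λ f₀ f ∧
      (∀ F : ℝ → X, OrderedEvolution.IsRegularSolution D Qp Qm Λ f₀ F → EqOn F f (Ici 0)) ∧
      (∀ t : ℝ, 0 ≤ t → 0 ≤ OrderedEvolution.opVal Λ (f t)) ∧
      ContinuousOn (fun t => OrderedEvolution.opVal Λ (f t)) (Ici 0) ∧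
      (∀ t : ℝ, 0 ≤ t →
        IntervalIntegrable (fun s => OrderedEvolution.dissipation Λ Qp Qm s (f s)) volume 0 t ∧
        ‖OrderedEvolution.opVal Λ (f t)‖
            + ∫ s in (0 : ℝ)..t, OrderedEvolution.dissipation Λ Qp Qm s (f s)
          = ‖OrderedEvolution.opVal Λ f₀‖) ∧
      (∀ t : ℝ, 0 ≤ t →
        ‖OrderedEvolution.opPow Λ 2 (f t)‖
          ≤ ‖OrderedEvolution.opPow Λ 2 f₀‖ * Real.exp (ρ ‖Λ₁ f₀‖ * t)) := by
  have hclosed := hX.orderClosedTopology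
  obtain ⟨S, hS, hpos, hgen⟩ := hA.generator
  obtain ⟨J, h, hdom⟩ := exists_isDampingPair hX hS hpos hgen hA0
  obtain ⟨φ, hφ⟩ := exists_norm_functional hX h hdom hA3
  have hR := isReducedProblem hX hQ hA hA1 hA2 hA3 h hdom hφ
  obtain ⟨y₀, hy₀, rfl⟩ := (mem_posDom_two h hdom f₀).1 hf₀
  obtain ⟨y, hy, hgrowth, huniq⟩ := hR.exists_unique_solution hy₀
  have hPM := (hR.isLocBdd_gain hy.locBdd hy.nonneg).sub (hR.isLocBdd_loss hy.locBdd hy.nonneg)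
  set b : ℝ → X := fun s => J (reducedOp Λ J Qp s (y s) - reducedOp Λ J Qm s (y s)) with hb
  have hbb : IsLocBdd b := hPM.clm J
  set f : ℝ → X := fun t => J (J y₀) + ∫ s in (0 : ℝ)..t, b s with hf
  have hfy : ∀ t, 0 ≤ t → f t = J (J (y t)) := fun t ht => by
    rw [hy.equation t ht, map_add, ← ContinuousLinearMap.intervalIntegral_comp_comm _
      (hPM.intervalIntegrable le_rfl ht)]
  have hval : ∀ t, 0 ≤ t → opVal Λ (f t) = J (y t) := fun t ht => by
    rw [hfy t ht, opVal_J hdom]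
  have hval2 : ∀ t, 0 ≤ t → opPow Λ 2 (f t) = y t := fun t ht => by
    rw [hfy t ht, opPow_two_J hdom]
  have hmem : ∀ t, 0 ≤ t → f t ∈ posDom Λ 2 := fun t ht =>
    (mem_posDom_two h hdom _).2 ⟨y t, hy.nonneg t ht, hfy t ht⟩
  have hdiss : ∀ t, 0 ≤ t → dissipation Λ Qp Qm t (f t)
      = ‖reducedOp Λ J Qm t (y t)‖ - ‖reducedOp Λ J Qp t (y t)‖ := fun t ht => by
    rw [dissipation, hfy t ht]
    rfl
  have hexp : ∀ t, 0 ≤ t → ‖opPow Λ 2 (f t)‖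
      ≤ ‖opPow Λ 2 (J (J y₀))‖ * Real.exp (ρ ‖Λ₁ (J (J y₀))‖ * t) := fun t ht => by
    rw [hval2 t ht, opPow_two_J hdom, ← hφ _ (h.J_nonneg _ hy₀)]
    exact hgrowth t ht
  refine ⟨f, ⟨⟨fun t ht => (hmem t ht).1, fun T hT => ?_, ?_, ?_, by simp [hf]⟩, hmem,
    fun T _ => ⟨‖opPow Λ 2 (J (J y₀))‖ * Real.exp (ρ ‖Λ₁ (J (J y₀))‖ * T), fun t ht => ?_⟩⟩,
    fun F hF t ht => ?_, fun t ht => ?_, ?_, fun t ht => ?_, hexp⟩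
  · have h1 := hbb.absolutelyContinuousOnInterval_integral hT.le
    exact ((LipschitzWith.const (J (J y₀))).lipschitzOnWith
      (s := uIcc 0 T)).absolutelyContinuousOnInterval.fun_add h1
  · filter_upwards [ae_restrict_mem measurableSet_Ici] with t ht
    exact hA.posDom_subset ((mem_posDom_one h hdom _).2
      ⟨J (y t), h.J_nonneg _ (hy.nonneg t ht), hfy t ht⟩)
  · filter_upwards [hbb.ae_hasDerivAt_integral, hA.Qp_maps 2 (Or.inl rfl),
      hA.Qm_maps 2 (Or.inl rfl), ae_restrict_mem measurableSet_Ici] with t h1 h2 h3 ht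
    rw [hfy t ht, ← (J_reducedOp h hdom h2 (hy.nonneg t ht)).1,
      ← (J_reducedOp h hdom h3 (hy.nonneg t ht)).1, ← map_sub]
    exact h1.const_add _
  · refine (hexp t ht.1).trans ?_
    have : 0 ≤ ρ ‖Λ₁ (J (J y₀))‖ := hA3.rho_nonneg _ (norm_nonneg _)
    have := ht.2
    gcongr
  · have ht' : (0 : ℝ) ≤ t := ht
    obtain ⟨h1, h2⟩ := hF.isReducedSolution hA hdom hR
    rw [h2 t ht', huniq _ h1 t ht', hfy t ht']
  · rw [hval t ht]
    exact h.J_nonneg _ (hy.nonneg t ht)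
  · refine ((continuousOn_const (c := J y₀)).add hPM.continuousOn_integral).congr fun t ht => ?_
    have ht' : (0 : ℝ) ≤ t := ht
    simp only [hval t ht', hy.equation t ht']
    rfl
  · have hd := hR.isLocBdd_diss hy.locBdd hy.nonneg
    constructor
    · refine (hd.intervalIntegrable le_rfl ht).congr fun s hs => ?_
      rw [uIoc_of_le ht] at hs
      exact (hdiss s hs.1.le).symm
    · rw [hval t ht, opVal_J hdom, ← hR.solution_energy hy₀ hy ht]
      congr 1
      refine intervalIntegral.integral_congr fun s hs => ?_
      rw [uIcc_of_le ht] at hs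
      exact hdiss s hs.1
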